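/- The following four statements are provable in $\mathsf{RCA}_0$; that is (by Gödel's completeness theorem), they hold in every model $(M,\mathcal S)$ of $\mathsf{RCA}_0$ (basic axioms, $\Sigma^0_1$-induction and $\Delta^0_1$-comprehension with number and set parameters), where all notions are read inside the model: numbers range over $M$, and sets, sequences, functions and codes are those in $\mathcal S$. 1. For every set $\emptyset\ne A\subseteq\mathbb N$ and every pseudo-quasi-metric $d:A\times A\to\mathbb R$ such that the coded space $X_A$ is Smyth-complete, there is a countable poset $P$ with $X_A\cong \mathrm{UF}(P)$. 2. For every countable poset $P$ there is a $\mathbf\Pi^0_2$-subspace $X$ of $\mathcal P(\mathbb N)$ with $\mathrm{UF}(P)\cong X$. 3. For every $\mathbf\Pi^0_2$-subspace $X$ of $\mathcal P(\mathbb N)$ there is a countably presented frame $\langle G;R\rangle$ that presents $X$. 4. For every countably presented frame $\langle G;R\rangle$ there is a $\mathbf\Pi^0_2$-subspace $X$ of $\mathcal P(\mathbb N)$ that is presented by $\langle G;R\rangle$. Definitions. *Homeomorphism.* A code of a continuous map $f:X\to Y$ is a set $\Phi$ of triples $(n,V,U)$ with $V$, $U$ basic open in $Y$, $X$; $f(x)=y$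 means that for every basic open $V$: $y\in V\leftrightarrow\exists n,U\,((n,V,U)\in\Phi\wedge x\in U)$. $X\cong Y$ means that there are codes of total continuous maps $f:X\to Y$, $g:Y\to X$ with $g\circ f=\mathrm{id}$ and $f\circ g=\mathrm{id}$. *Quasi-metric spaces.* A pseudo-quasi-metric satisfies $d\ge 0$, $d(a,a)=0$ and the triangle inequality. Points of $X_A$ are sequences $\langle a_n\rangle$ in $A$ with $d(a_n,a_m),d(a_m,a_n)<2^{-n}$ for $n<m$; basic open sets are the balls $\{y: d(a,y)<r\}$ with $a\in A$, $r\in\mathbb Q_{>0}$. $X_A$ is Smyth-complete if for every sequence $\langle a_n\rangle$ in $A$ with $d(a_n,a_m)<2^{-n}$ for $0<n<m$ there is a point $\langle b_n\rangle$ with $d(a_{n+1},b_{n+1})<2^{-n}$ for all $n$ and $\lim_n d(b_n,a_n)=0$. *UF spaces.* A countable poset is a set $P\subseteq\mathbb N$ with a preorder $\le$; $r<p$ means $r\le p$ and $p\not\le r$. Filters are represented by decreasing sequences in $P$ (which generate them). The points of $\mathrm{UF}(P)$ are the filters $F$ such that no $r\in P$ satisfies $r<p$ for all $p\in F$; basic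 open sets are $N_p=\{F:p\in F\}$, $p\in P$. *$\mathbf\Pi^0_2$-subspaces.* A point of $\mathcal P(\mathbb N)$ is a sequence of finite sets $q_i\subseteq\{0,\dots,i\}$ with $q_i\subseteq q_j$ for $i<j$, representing $\bigcup_i q_i$; basic open sets are $\{x:c\subseteq x\}$ for finite $c$. A $\mathbf\Pi^0_2$-subspace is $\bigcap_i(B_i\cup A_i)$ with $B_i=\bigcup_m v_{i,m}$ and $A_i=\mathcal P(\mathbb N)\setminus\bigcup_m w_{i,m}$, coded by sequences $v,w$ of basic open sets or $\emptyset$. *Countably presented frames.* $\langle G;R\rangle$ consists of a set $G\subseteq\mathbb N$ and a sequence $R$ of pairs $(u_j,v_j)$ of expressions over $G$. An expression $a=\bigvee_k\bigwedge a_k$ is a sequence whose terms are finite subsets of $G$ or are absent (so the empty join is allowed); $a\le b$ means that every term of $a$ includes some term of $b$, and a finite $p\subseteq G$ is read as the expression $\bigwedge p$. A generating pair $(Q,\prec_Q)$ is a sequence $Q$ of expressions, containing all finite meets and all $u_j,v_j$, with a reflexive relation $\prec_Q\supseteq R$ on $Q$. It generates the congruence preorder for which $a\prec_m b$ holds iff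 for every increasing sequence $(p_i)$ of finite subsets of $G$ with $p_0\le a$ and such that $p_i\le c\prec_Q d$ implies $\exists k\,(p_k\le d)$, there are $i$ and $r,l\in Q$ with $p_i\le r\prec_Q l\le b$. The least congruence preorder is: $a\prec b$ iff $a\prec_m b$ for every generating pair. A point of $\langle G;R\rangle$ is an increasing sequence $(p_i)$ of finite subsets of $G$ such that, for all $j$, $\exists k\,(p_k\le u_j)$ implies $\exists h\,(p_h\le v_j)$. The point space has the basic open sets $\{(p_i):\exists i\,(c\subseteq p_i)\}$ for finite $c\subseteq G$; $a\subseteq_{\mathrm{pt}}b$ means that for every point $(p_i)$, $\exists k\,(p_k\le a)$ implies $\exists h\,(p_h\le b)$. *Presents.* $\langle G;R\rangle$ presents $X$ if the point space of $\langle G;R\rangle$ is homeomorphic to $X$ and, both for $\triangleleft={\prec}$ and for $\triangleleft={\subseteq_{\mathrm{pt}}}$, $\langle G;R\rangle$ with $\triangleleft$ is spatial with $X$: there is a sequence $(U_g)_{g\in G}$ of open sets of $X$ such that, writing $f(\bigvee_k\bigwedge a_k)=\bigcup_k\bigcap_{g\in a_k}U_g$, one has $a\triangleleft b\leftrightarrow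 f(a)\subseteq f(b)$ for all expressions $a,b$, and every open set of $X$ is $f(a)$ for some expression $a$. -/

import Mathlib

universe u

namespace SOA

/-! ## Second-order arithmetic and the theory `RCA₀` -/

/-- A structure for the two-sorted language of second-order arithmetic: a set of numbers with
`0, 1, +, ·, <`, and a collection `Sets` of sets of numbers over which the set variables range. -/
structure L2Structure where
  Num : Type u
  [instZero : Zero Num]
  [instOne : One Num]
  [instAdd : Add Num]
  [instMul : Mul Num]
  [instLT : LT Num]
  Sets : Set (Set Num)

attribute [instance] L2Structure.instZero L2Structure.instOne L2Structure.instAdd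
  L2Structure.instMul L2Structure.instLT

/-- Number terms, with number variables `x₀, x₁, …`. -/
inductive Term where
  | var (i : ℕ) : Term
  | zero : Term
  | one : Term
  | add (s t : Term) : Term
  | mul (s t : Term) : Term

/-- Bounded (that is `Σ⁰₀`) formulas, with number variables `x₀, x₁, …` and set variables
`X₀, X₁, …`. The quantifier `ball i t φ` is `∀ xᵢ < t, φ`. The remaining connectives and the
bounded existential quantifier are definable. -/
inductive BddFormula where
  | eq (s t : Term) : BddFormula
  | lt (s t : Term) : BddFormula
  | mem (t : Term) (i : ℕ) : BddFormula
  | neg (φ : BddFormula) : BddFormula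
  | and (φ ψ : BddFormula) : BddFormula
  | ball (i : ℕ) (t : Term) (φ : BddFormula) : BddFormula

section Semantics

variable (𝔐 : L2Structure.{u})

/-- Value of a term under an assignment `e` of the number variables. -/
def Term.eval (e : ℕ → 𝔐.Num) : Term → 𝔐.Num
  | .var i => e i
  | .zero => 0
  | .one => 1
  | .add s t => Term.eval e s + Term.eval e t
  | .mul s t => Term.eval e s * Term.eval e t

/-- Truth of a bounded formula under assignments `e`, `E` of the number and set variables. -/
def BddFormula.Holds (E : ℕ → Set 𝔐.Num) : (ℕ → 𝔐.Num) → BddFormula → Prop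
  | e, .eq s t => s.eval 𝔐 e = t.eval 𝔐 e
  | e, .lt s t => s.eval 𝔐 e < t.eval 𝔐 e
  | e, .mem t i => t.eval 𝔐 e ∈ E i
  | e, .neg φ => ¬ BddFormula.Holds E e φ
  | e, .and φ ψ => BddFormula.Holds E e φ ∧ BddFormula.Holds E e ψ
  | e, .ball i t φ => ∀ a : 𝔐.Num, a < t.eval 𝔐 e → BddFormula.Holds E (Function.update e i a) φ

/-- Truth of `θ(x₀, x₁)` at `x₀ = n`, `x₁ = m`; all other variables are parameters, assigned
by `e` and `E`. -/
def BddFormula.HoldsAt (θ : BddFormula) (E : ℕ → Set 𝔐.Num) (e : ℕ → 𝔐.Num)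
    (n m : 𝔐.Num) : Prop :=
  θ.Holds 𝔐 E (Function.update (Function.update e 0 n) 1 m)

/-- `𝔐` is a model of `RCA₀`: the basic axioms, the scheme of `Σ⁰₁` induction and the scheme of
`Δ⁰₁` comprehension, both with number and set parameters. -/
structure ModelsRCA0 : Prop where
  succ_ne_zero : ∀ n : 𝔐.Num, n + 1 ≠ 0
  succ_inj : ∀ m n : 𝔐.Num, m + 1 = n + 1 → m = n
  add_zero : ∀ m : 𝔐.Num, m + 0 = m
  add_succ : ∀ m n : 𝔐.Num, m + (n + 1) = (m + n) + 1
  mul_zero : ∀ m : 𝔐.Num, m * 0 = 0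
  mul_succ : ∀ m n : 𝔐.Num, m * (n + 1) = m * n + m
  not_lt_zero : ∀ m : 𝔐.Num, ¬ m < 0
  lt_succ : ∀ m n : 𝔐.Num, m < n + 1 ↔ m < n ∨ m = n
  sigma_one_induction : ∀ (θ : BddFormula) (E : ℕ → Set 𝔐.Num) (e : ℕ → 𝔐.Num),
    (∀ i, E i ∈ 𝔐.Sets) →
    (∃ m, θ.HoldsAt 𝔐 E e 0 m) →
    (∀ n, (∃ m, θ.HoldsAt 𝔐 E e n m) → ∃ m, θ.HoldsAt 𝔐 E e (n + 1) m) →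
    ∀ n, ∃ m, θ.HoldsAt 𝔐 E e n m
  delta_one_comprehension : ∀ (θ ψ : BddFormula) (E : ℕ → Set 𝔐.Num) (e : ℕ → 𝔐.Num),
    (∀ i, E i ∈ 𝔐.Sets) →
    (∀ n, (∃ m, θ.HoldsAt 𝔐 E e n m) ↔ ∀ m, ψ.HoldsAt 𝔐 E e n m) →
    ∃ X ∈ 𝔐.Sets, ∀ n, n ∈ X ↔ ∃ m, θ.HoldsAt 𝔐 E e n m

end Semantics

/-! ## Coding inside a structure

Below, every quantifier ranges over numbers of `𝔐`, sets in `𝔐.Sets`, or functions whose graph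
is in `𝔐.Sets`, so each notion is one of second-order arithmetic, interpreted in `𝔐`. -/

section Coding

variable {𝔐 : L2Structure.{u}}

/-- The pairing function `(i, j) = (i + j)² + i`. -/
def pair (i j : 𝔐.Num) : 𝔐.Num := (i + j) * (i + j) + i

/-- `m ≤ n` for numbers. -/
def NLe (m n : 𝔐.Num) : Prop := m < n ∨ m = n

/-- The function `f` from numbers to numbers exists in `𝔐`. -/
def Coded (f : 𝔐.Num → 𝔐.Num) : Prop :=
  {z | ∃ n, z = pair n (f n)} ∈ 𝔐.Sets

/-- The function `f` from pairs of numbers to numbers exists in `𝔐`. -/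
def Coded₂ (f : 𝔐.Num → 𝔐.Num → 𝔐.Num) : Prop :=
  {z | ∃ i n, z = pair (pair i n) (f i n)} ∈ 𝔐.Sets

/-- `i` belongs to the finite set with code `c = ((k, m), n)`, which is
`{i < k : m (i + 1) + 1 divides n}`. (A finite set has many codes; a number that is not of
this form codes the empty set.) -/
def FinMem (i c : 𝔐.Num) : Prop :=
  ∃ k m n, c = pair (pair k m) n ∧ i < k ∧ ∃ q, (m * (i + 1) + 1) * q = n

/-- Inclusion of the finite sets with codes `c` and `d`. -/
def FinSub (c d : 𝔐.Num) : Prop := ∀ i, FinMem i c → FinMem i d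

/-- `c` codes a finite subset of `G`. -/
def FinSubset (G : Set 𝔐.Num) (c : 𝔐.Num) : Prop := ∀ i, FinMem i c → i ∈ G

/-! ### Rational and real numbers -/

variable (𝔐) in
/-- The rational number `(pos - neg) / (den + 1)`. -/
structure RatNum where
  pos : 𝔐.Num
  neg : 𝔐.Num
  den : 𝔐.Num

namespace RatNum

/-- The natural number coding a rational number. -/
def code (q : RatNum 𝔐) : 𝔐.Num := pair (pair q.pos q.neg) q.den

def zero : RatNum 𝔐 := ⟨0, 0, 0⟩

def add (q r : RatNum 𝔐) : RatNum 𝔐 :=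
  ⟨q.pos * (r.den + 1) + r.pos * (q.den + 1), q.neg * (r.den + 1) + r.neg * (q.den + 1),
    q.den * r.den + q.den + r.den⟩

def lt (q r : RatNum 𝔐) : Prop :=
  q.pos * (r.den + 1) + r.neg * (q.den + 1) < r.pos * (q.den + 1) + q.neg * (r.den + 1)

def le (q r : RatNum 𝔐) : Prop :=
  NLe (q.pos * (r.den + 1) + r.neg * (q.den + 1)) (r.pos * (q.den + 1) + q.neg * (r.den + 1))

end RatNum

/-- `y = 2 ^ k`, by primitive recursion. -/
def IsTwoPow (k y : 𝔐.Num) : Prop :=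
  ∃ f : 𝔐.Num → 𝔐.Num, Coded f ∧ f 0 = 1 ∧ (∀ n, f (n + 1) = f n + f n) ∧ f k = y

open Classical in
/-- The rational number `2 ^ (-k)`, namely `1 / (c + 1)` for the `c` with `c + 1 = 2 ^ k`
(which exists and is unique in a model of `RCA₀`). -/
noncomputable def twoNeg (k : 𝔐.Num) : RatNum 𝔐 :=
  ⟨1, 0, if h : ∃ c, IsTwoPow k (c + 1) then h.choose else 0⟩

/-- A sequence of rationals is (a representation of) a real number if
`|q_k - q_i| ≤ 2 ^ (-k)` for all `k ≤ i`. -/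
def IsReal (q : 𝔐.Num → RatNum 𝔐) : Prop :=
  ∀ k i, NLe k i → (q k).le ((q i).add (twoNeg k)) ∧ (q i).le ((q k).add (twoNeg k))

/-- `x ≤ y` for real numbers: `x_k ≤ y_k + 2 ^ (-k + 1)` for all `k`. -/
def RealLe (x y : 𝔐.Num → RatNum 𝔐) : Prop :=
  ∀ k, (x k).le ((y k).add ((twoNeg k).add (twoNeg k)))

/-- `x < y` for real numbers: `x_k + 2 ^ (-k + 1) < y_k` for some `k`. -/
def RealLt (x y : 𝔐.Num → RatNum 𝔐) : Prop :=
  ∃ k, ((x k).add ((twoNeg k).add (twoNeg k))).lt (y k)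

/-- The sum of two real numbers. -/
def realAdd (x y : 𝔐.Num → RatNum 𝔐) : 𝔐.Num → RatNum 𝔐 :=
  fun k => (x (k + 1)).add (y (k + 1))

/-- A rational number as a real number. -/
def ratReal (q : RatNum 𝔐) : 𝔐.Num → RatNum 𝔐 := fun _ => q

/-! ### Coded spaces and continuous maps -/

variable (𝔐) in
/-- A countably based space: a class of points, each of them given by a sequence of numbers, a
countable set of (codes of) basic open sets, and the relation of membership. -/
structure Space where
  IsPoint : (𝔐.Num → 𝔐.Num) → Prop
  IsBasic : 𝔐.Num → Prop
  Mem : (𝔐.Num → 𝔐.Num) → 𝔐.Num → Prop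

/-- `x` lies in the open set coded by the set `U` of pairs `(n, w)`, `w` a basic open set. -/
def Space.MemOpen (X : Space 𝔐) (x : 𝔐.Num → 𝔐.Num) (U : Set 𝔐.Num) : Prop :=
  ∃ n w, pair n w ∈ U ∧ X.IsBasic w ∧ X.Mem x w

/-- `f(x) = y`, for the partial continuous map `f : X → Y` coded by the set `Φ` of triples
`(n, V, U)`, with `V` and `U` basic open in `Y` and `X`: a basic open set `V` contains `y` if and
only if its formal inverse image contains `x`. -/
def MapsTo (X Y : Space 𝔐) (Φ : Set 𝔐.Num) (x y : 𝔐.Num → 𝔐.Num) : Prop :=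
  ∀ V, Y.IsBasic V →
    (Y.Mem y V ↔ ∃ n U, X.IsBasic U ∧ pair n (pair V U) ∈ Φ ∧ X.Mem x U)

/-- The continuous map coded by `Φ` is total. -/
def TotalMap (X Y : Space 𝔐) (Φ : Set 𝔐.Num) : Prop :=
  ∀ x, X.IsPoint x → ∃ y, Y.IsPoint y ∧ MapsTo X Y Φ x y

/-- `X` and `Y` are homeomorphic: there are codes of total continuous maps `f : X → Y` and
`g : Y → X` with `g(f(x)) = x` and `f(g(y)) = y`. -/
def Homeomorphic (X Y : Space 𝔐) : Prop :=
  ∃ Φ ∈ 𝔐.Sets, ∃ Ψ ∈ 𝔐.Sets, TotalMap X Y Φ ∧ TotalMap Y X Ψ ∧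
    (∀ x y, X.IsPoint x → Y.IsPoint y → MapsTo X Y Φ x y → MapsTo Y X Ψ y x) ∧
    (∀ x y, X.IsPoint x → Y.IsPoint y → MapsTo Y X Ψ y x → MapsTo X Y Φ x y)

/-! ### Quasi-metric spaces -/

variable (𝔐) in
/-- A code `(A, d)` of a countably based quasi-metric space: a nonempty set `A` of numbers and a
pseudo-quasi-metric `d : A × A → ℝ`; here `d a b k` is the `k`-th rational approximation of
`d(a, b)`. -/
structure QMCode where
  A : Set 𝔐.Num
  d : 𝔐.Num → 𝔐.Num → 𝔐.Num → RatNum 𝔐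
  A_mem : A ∈ 𝔐.Sets
  A_nonempty : ∃ a, a ∈ A
  d_mem : {z | ∃ a b k, z = pair (pair (pair a b) k) (d a b k).code} ∈ 𝔐.Sets
  d_real : ∀ a ∈ A, ∀ b ∈ A, IsReal (d a b)
  d_nonneg : ∀ a ∈ A, ∀ b ∈ A, RealLe (ratReal RatNum.zero) (d a b)
  d_self : ∀ a ∈ A, RealLe (d a a) (ratReal RatNum.zero)
  d_triangle : ∀ a ∈ A, ∀ b ∈ A, ∀ c ∈ A, RealLe (d a c) (realAdd (d a b) (d b c))

namespace QMCode

variable (C : QMCode 𝔐)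

/-- `x` is a point: a sequence in `A` with `d(x_n, x_m), d(x_m, x_n) < 2 ^ (-n)` for `n < m`. -/
def IsPoint (x : 𝔐.Num → 𝔐.Num) : Prop :=
  Coded x ∧ (∀ n, x n ∈ C.A) ∧ ∀ n m, n < m →
    RealLt (C.d (x n) (x m)) (ratReal (twoNeg n)) ∧ RealLt (C.d (x m) (x n)) (ratReal (twoNeg n))

/-- The real number `d(x, y) = lim d(x_n, y_n)` for points `x` and `y`, as a sequence of rationals
with the modulus of convergence that `IsReal` requires. -/
def dist (x y : 𝔐.Num → 𝔐.Num) : 𝔐.Num → RatNum 𝔐 :=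
  fun k => C.d (x (k + 1 + 1 + 1)) (y (k + 1 + 1 + 1)) (k + 1 + 1)

/-- The space `X_A`. The basic open sets are the balls `B(a, r)` with `a ∈ A` and `r > 0`
rational, where `B(a, r)` consists of the points `y` with `d(a, y) < r`; here `a` stands for the
constant sequence. -/
def space : Space 𝔐 where
  IsPoint := C.IsPoint
  IsBasic z := ∃ a r, z = pair a (RatNum.code r) ∧ a ∈ C.A ∧ RatNum.zero.lt r
  Mem y z := ∃ a r, z = pair a (RatNum.code r) ∧ a ∈ C.A ∧ RatNum.zero.lt r ∧
    RealLt (C.dist (fun _ => a) y) (ratReal r)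

/-- `a` is an effective left-Cauchy sequence in `A`. -/
def IsLeftCauchy (a : 𝔐.Num → 𝔐.Num) : Prop :=
  Coded a ∧ (∀ n, a n ∈ C.A) ∧ ∀ n m, 0 < n → n < m →
    RealLt (C.d (a n) (a m)) (ratReal (twoNeg n))

/-- Smyth-completeness: every effective left-Cauchy sequence `(a_n)` in `A` has a point `(b_n)`
with `d(a_{n+1}, b_{n+1}) < 2 ^ (-n)` for all `n`, and `lim d(b_n, a_n) = 0`. -/
def SmythComplete : Prop :=
  ∀ a, C.IsLeftCauchy a → ∃ b, C.IsPoint b ∧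
    (∀ n, RealLt (C.d (a (n + 1)) (b (n + 1))) (ratReal (twoNeg n))) ∧
    (∀ k, ∃ N, ∀ n, N < n → RealLt (C.d (b n) (a n)) (ratReal (twoNeg k)))

end QMCode

/-! ### Spaces of unbounded filters -/

variable (𝔐) in
/-- A countable poset: a set `P` of numbers and a preorder on `P`, which is given by the set
`rel` of all pairs `(p, q)` with `p ≤ q`. -/
structure PosetCode where
  P : Set 𝔐.Num
  rel : Set 𝔐.Num
  P_mem : P ∈ 𝔐.Sets
  rel_mem : rel ∈ 𝔐.Sets
  refl : ∀ p ∈ P, pair p p ∈ rel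
  trans : ∀ p ∈ P, ∀ q ∈ P, ∀ r ∈ P, pair p q ∈ rel → pair q r ∈ rel → pair p r ∈ rel

namespace PosetCode

variable (P : PosetCode 𝔐)

def le (p q : 𝔐.Num) : Prop := pair p q ∈ P.rel

def lt (p q : 𝔐.Num) : Prop := P.le p q ∧ ¬ P.le q p

/-- `x` is a decreasing sequence in `P`; it represents the filter that it generates. -/
def IsFilter (x : 𝔐.Num → 𝔐.Num) : Prop :=
  Coded x ∧ (∀ n, x n ∈ P.P) ∧ ∀ i j, i < j → P.le (x j) (x i)

/-- `p` belongs to the filter generated by `x`. -/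
def FilterMem (x : 𝔐.Num → 𝔐.Num) (p : 𝔐.Num) : Prop := p ∈ P.P ∧ ∃ i, P.le (x i) p

/-- The space `UF(P)` of unbounded filters, with the basic open sets `N_p = {F : p ∈ F}`. -/
def UF : Space 𝔐 where
  IsPoint x := P.IsFilter x ∧ ¬ ∃ r ∈ P.P, ∀ p, P.FilterMem x p → P.lt r p
  IsBasic p := p ∈ P.P
  Mem := P.FilterMem

end PosetCode

/-! ### `Π⁰₂`-subspaces of the power set of the natural numbers -/

variable (𝔐) in
/-- The space `𝒫(ℕ)`. A point is a sequence of finite sets `q_i ⊆ {0, …, i}` with `q_i ⊆ q_j` for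
`i < j` (it represents the union of the `q_i`); the basic open sets are the sets of all `x` that
include a given finite set. -/
def powerSpace : Space 𝔐 where
  IsPoint x := Coded x ∧ (∀ i n, FinMem n (x i) → NLe n i) ∧ ∀ i j, i < j → FinSub (x i) (x j)
  IsBasic _ := True
  Mem x c := ∃ i, FinSub c (x i)

variable (𝔐) in
/-- A code of a `Π⁰₂`-subspace `⋂ i, (B_i ∪ A_i)` of `𝒫(ℕ)`, where `B_i` is the union of the
`v_{i,m}` and `A_i` is the complement of the union of the `w_{i,m}`. Each `v_{i,m}` and `w_{i,m}` is
the empty set (coded by `0`) or a basic open set (coded by `c + 1` for a finite set `c`). -/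
structure Pi02Code where
  v : 𝔐.Num → 𝔐.Num → 𝔐.Num
  w : 𝔐.Num → 𝔐.Num → 𝔐.Num
  v_coded : Coded₂ v
  w_coded : Coded₂ w

/-- The subspace of `𝒫(ℕ)` coded by `C`. -/
def Pi02Code.space (C : Pi02Code 𝔐) : Space 𝔐 where
  IsPoint x := (powerSpace 𝔐).IsPoint x ∧ ∀ i,
    (∃ m c, C.v i m = c + 1 ∧ (powerSpace 𝔐).Mem x c) ∨
      ¬ ∃ m c, C.w i m = c + 1 ∧ (powerSpace 𝔐).Mem x c
  IsBasic := (powerSpace 𝔐).IsBasic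
  Mem := (powerSpace 𝔐).Mem

/-! ### Countably presented frames -/

/-- `a` is an expression over `G`, a formal countable join of finite meets of elements of `G`. The
term `a k` is the finite set coded by `c`, if `a k = c + 1`; if `a k = 0` there is no `k`-th
term (so that the empty join is an expression). -/
def IsExpr (G : Set 𝔐.Num) (a : 𝔐.Num → 𝔐.Num) : Prop :=
  Coded a ∧ ∀ k, a k = 0 ∨ ∃ c, a k = c + 1 ∧ FinSubset G c

/-- `p ≤ a` for a finite set `p` (a finite meet) and an expression `a`. -/
def FinLe (p : 𝔐.Num) (a : 𝔐.Num → 𝔐.Num) : Prop :=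
  ∃ j q, a j = q + 1 ∧ FinSub q p

/-- The preorder `a ≤ b` of the free frame on expressions. -/
def ExprLe (a b : 𝔐.Num → 𝔐.Num) : Prop :=
  ∀ i p, a i = p + 1 → FinLe p b

variable (𝔐) in
/-- A countable presentation `⟨G; R⟩` of a frame: a set `G` of generators and a sequence `R` of
relations `(u_j, v_j)` between expressions over `G`. -/
structure FrameCode where
  G : Set 𝔐.Num
  u : 𝔐.Num → 𝔐.Num → 𝔐.Num
  v : 𝔐.Num → 𝔐.Num → 𝔐.Num
  G_mem : G ∈ 𝔐.Sets
  u_coded : Coded₂ u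
  v_coded : Coded₂ v
  u_expr : ∀ j, IsExpr G (u j)
  v_expr : ∀ j, IsExpr G (v j)

namespace FrameCode

variable (F : FrameCode 𝔐)

/-- `(Q, ≺_Q)` generates a congruence preorder. Here `Q = {w_i}` is a countable set of expressions
that contains all finite meets and all `u_j`, `v_j`, and `≺_Q` is a reflexive relation on `Q`
that contains `R`, given by the set `L` of the pairs `(i, j)` with `w_i ≺_Q w_j`. -/
structure Generates (w : 𝔐.Num → 𝔐.Num → 𝔐.Num) (L : Set 𝔐.Num) : Prop where
  w_coded : Coded₂ w
  L_mem : L ∈ 𝔐.Sets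
  w_expr : ∀ i, IsExpr F.G (w i)
  fin_mem : ∀ p, FinSubset F.G p → ∃ i, ∀ n, w i n = p + 1
  rel_mem : ∀ j, ∃ k l, w k = F.u j ∧ w l = F.v j ∧ pair k l ∈ L
  refl : ∀ i, pair i i ∈ L

/-- `p` is a decreasing sequence of finite meets of generators, that is, an increasing sequence of
finite subsets of `G`. -/
def IsFinSeq (p : 𝔐.Num → 𝔐.Num) : Prop :=
  Coded p ∧ (∀ i, FinSubset F.G (p i)) ∧ ∀ i, FinSub (p i) (p (i + 1))

/-- The sequence `p` respects `≺_Q`: if some `p_i ≤ c` and `c ≺_Q d` then some `p_k ≤ d`. -/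
def Respects (w : 𝔐.Num → 𝔐.Num → 𝔐.Num) (L : Set 𝔐.Num) (p : 𝔐.Num → 𝔐.Num) : Prop :=
  F.IsFinSeq p ∧ ∀ k l, pair k l ∈ L → ∀ i, FinLe (p i) (w k) → ∃ h, FinLe (p h) (w l)

/-- The congruence preorder generated by `(Q, ≺_Q)`. -/
def GenPrec (w : 𝔐.Num → 𝔐.Num → 𝔐.Num) (L : Set 𝔐.Num) (a b : 𝔐.Num → 𝔐.Num) : Prop :=
  ∀ p, F.Respects w L p → FinLe (p 0) a →
    ∃ i k l, FinLe (p i) (w k) ∧ pair k l ∈ L ∧ ExprLe (w l) b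

/-- The least congruence preorder `≺`. -/
def Prec (a b : 𝔐.Num → 𝔐.Num) : Prop :=
  ∀ w L, F.Generates w L → F.GenPrec w L a b

/-- The space of points of `⟨G; R⟩`. A point is a decreasing sequence `p` of finite meets for
which the relation `(∃ k, p_k ≤ a) → (∃ h, p_h ≤ b)` between expressions `a`, `b` contains `R` (it
is then a congruence preorder). The basic open sets are given by the finite meets. -/
def ptSpace : Space 𝔐 where
  IsPoint p := F.IsFinSeq p ∧
    ∀ j, (∃ k, FinLe (p k) (F.u j)) → ∃ h, FinLe (p h) (F.v j)
  IsBasic c := FinSubset F.G c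
  Mem p c := ∃ i, FinSub c (p i)

/-- The order `a ⊆_pt b`. -/
def PtLe (a b : 𝔐.Num → 𝔐.Num) : Prop :=
  ∀ p, F.ptSpace.IsPoint p → (∃ k, FinLe (p k) a) → ∃ h, FinLe (p h) b

/-- `x ∈ f(a)`, where `a` is an expression and `f` is the map from expressions to open sets that
preserves countable joins and finite meets and takes each generator `g` to the open set `U_g`;
the sequence `(U_g)` is given by the set `U` of all `(g, z)` with `z ∈ U_g`. -/
def MemImage (X : Space 𝔐) (U : Set 𝔐.Num) (x a : 𝔐.Num → 𝔐.Num) : Prop :=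
  ∃ k c, a k = c + 1 ∧ ∀ g, FinMem g c → X.MemOpen x {z | pair g z ∈ U}

/-- `⟨G; R⟩` with the preorder `tri` is spatial with the space `X`: the expressions, preordered by
`tri`, are isomorphic (as a frame) to the open sets of `X`. -/
def SpatialWith (tri : (𝔐.Num → 𝔐.Num) → (𝔐.Num → 𝔐.Num) → Prop) (X : Space 𝔐) : Prop :=
  ∃ U ∈ 𝔐.Sets,
    (∀ a b, IsExpr F.G a → IsExpr F.G b →
      (tri a b ↔ ∀ x, X.IsPoint x → MemImage X U x a → MemImage X U x b)) ∧
    (∀ V ∈ 𝔐.Sets, ∃ a, IsExpr F.G a ∧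
      ∀ x, X.IsPoint x → (X.MemOpen x V ↔ MemImage X U x a))

/-- `⟨G; R⟩` and `X` represent the same space: `X` is homeomorphic to the space of points of
`⟨G; R⟩`, and `⟨G; R⟩`, with `≺` as well as with `⊆_pt`, is isomorphic to the frame of open sets
of `X`. -/
def Presents (X : Space 𝔐) : Prop :=
  Homeomorphic F.ptSpace X ∧ F.SpatialWith F.Prec X ∧ F.SpatialWith F.PtLe X

end FrameCode

end Coding

end SOA

/-!
All four statements are proved inside an arbitrary model `(M, 𝒮)` of `RCA₀`. The first task is to
make the usual informal reasoning available there. Bounded formulas are used only to set up three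
semantic notions, for predicates and functions on tuples of numbers of the model: `S1` (`Σ⁰₁` with
parameters), `D1` (`Δ⁰₁` with parameters) and `DF` (functions with a `Σ⁰₁` graph). They have the
expected closure properties, which `by_def` applies automatically; the only one with a real proof
is closure of `Σ⁰₁` under bounded quantification, which rests on collection (`S0.collection`). With
induction, `M` becomes an ordered semiring. Finite sets are coded by divisibility, as in Gödel's
`β`-function (`D1.exists_finCode`), and this yields recursion along `Σ⁰₁` relations
(`S1.exists_seq`).

*Frames.* A point of `⟨G; R⟩` is, up to the choice of an enumeration, a subset of `G` that satisfies
the conditions `R`; such sets are exactly the points of a `Π⁰₂`-subspace, and conversely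
(`FrameCode.exists_presents`, `Pi02Code.exists_presents`). Spatiality with respect to `⊆_pt` is then
immediate. For the least congruence preorder it follows from `FrameCode.prec_iff_ptLe`: the finite
meets together with the expressions in `R` form a generating pair, and the sequences that respect it
are the points; the sequences that respect any other generating pair are points as well.

*Unbounded filters.* To be an unbounded filter is a `Π⁰₂` condition on subsets of the poset, and an
enumerated filter is generated by a decreasing sequence, found by recursion
(`PosetCode.exists_homeomorphic`).

*Smyth-complete spaces.* The poset consists of the formal balls `(a, n)` with centre `a` and radius
`2 ^ (-n)`, and `(b, m) < (a, n)` if the `m`-th approximation of `d(a, b)` is less than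
`2 ^ (-n) - 3 · 2 ^ (-m)`. This is a decidable condition, it implies
`d(a, b) < 2 ^ (-n) - 2 · 2 ^ (-m)`, and it follows from `d(a, b) < 2 ^ (-n) - 4 · 2 ^ (-m)`. A
point corresponds to the filter of the formal balls to which it belongs. Conversely, each ball in
an unbounded filter has another one strongly inside it (`QMCode.IsBallPoset.exists_inside`), so that
the radii tend to `0` and suitable centres form a left-Cauchy sequence, to which Smyth-completeness
applies (`QMCode.IsBallPoset.exists_point`). To compute with rationals of the
model, `M` is embedded into an ordered field (`exists_orderedField`); inequalities between rationals
are then inequalities there.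
-/

set_option linter.unusedSectionVars false

namespace SOA

section

/-! ### Definability by bounded formulas -/

/-- Renaming of the number variables of a term. -/
def Term.rename (ρ : ℕ → ℕ) : Term → Term
  | .var i => .var (ρ i)
  | .zero => .zero
  | .one => .one
  | .add s t => .add (s.rename ρ) (t.rename ρ)
  | .mul s t => .mul (s.rename ρ) (t.rename ρ)

/-- Renaming of the number variables (free and bound) and the set variables of a formula. -/
def BddFormula.rename (ρ σ : ℕ → ℕ) : BddFormula → BddFormula
  | .eq s t => .eq (s.rename ρ) (t.rename ρ)
  | .lt s t => .lt (s.rename ρ) (t.rename ρ)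
  | .mem t i => .mem (t.rename ρ) (σ i)
  | .neg φ => .neg (φ.rename ρ σ)
  | .and φ ψ => .and (φ.rename ρ σ) (ψ.rename ρ σ)
  | .ball i t φ => .ball (ρ i) (t.rename ρ) (φ.rename ρ σ)

variable {𝔐 : L2Structure.{u}}

theorem Term.eval_rename (ρ : ℕ → ℕ) (e : ℕ → 𝔐.Num) (t : Term) :
    (t.rename ρ).eval 𝔐 e = t.eval 𝔐 (e ∘ ρ) := by
  induction t with
  | var i => rfl
  | zero => rfl
  | one => rfl
  | add s t hs ht => simp only [Term.rename, Term.eval, hs, ht]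
  | mul s t hs ht => simp only [Term.rename, Term.eval, hs, ht]

/-- Injectivity of the renaming prevents the capture of variables. -/
theorem BddFormula.holds_rename {ρ : ℕ → ℕ} (hρ : Function.Injective ρ) (σ : ℕ → ℕ)
    (E : ℕ → Set 𝔐.Num) (θ : BddFormula) (e : ℕ → 𝔐.Num) :
    (θ.rename ρ σ).Holds 𝔐 E e ↔ θ.Holds 𝔐 (E ∘ σ) (e ∘ ρ) := by
  induction θ generalizing e with
  | eq s t => simp only [BddFormula.rename, BddFormula.Holds, Term.eval_rename]
  | lt s t => simp only [BddFormula.rename, BddFormula.Holds, Term.eval_rename]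
  | mem t i => simp only [BddFormula.rename, BddFormula.Holds, Term.eval_rename,
      Function.comp_apply]
  | neg φ h => simp only [BddFormula.rename, BddFormula.Holds, h]
  | and φ ψ h h' => simp only [BddFormula.rename, BddFormula.Holds, h, h']
  | ball i t φ h =>
    simp only [BddFormula.rename, BddFormula.Holds, Term.eval_rename, h]
    refine forall_congr' fun a => imp_congr_right fun _ => ?_
    rw [Function.update_comp_eq_of_injective e hρ]

/-- The sequence that runs through `x` at the even and through `y` at the odd indices. -/
def mix {β : Type*} (x y : ℕ → β) (k : ℕ) : β := if k % 2 = 0 then x (k / 2) else y (k / 2)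

theorem mix_even {β : Type*} (x y : ℕ → β) (i : ℕ) : mix x y (2 * i) = x i := by
  simp [mix]

theorem mix_odd {β : Type*} (x y : ℕ → β) (i : ℕ) : mix x y (2 * i + 1) = y i := by
  simp only [mix]
  rw [if_neg (by omega)]
  congr 1
  omega

theorem mix_ext {β : Type*} {x y z : ℕ → β} (h : ∀ i, z (2 * i) = x i)
    (h' : ∀ i, z (2 * i + 1) = y i) : z = mix x y := by
  funext k
  obtain ⟨i, rfl | rfl⟩ := k.even_or_odd'
  · rw [h, mix_even]
  · rw [h', mix_odd]

theorem mix_injective {ρ ρ' : ℕ → ℕ} (h : Function.Injective ρ) (h' : Function.Injective ρ')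
    (hne : ∀ i j, ρ i ≠ ρ' j) : Function.Injective (mix ρ ρ') := by
  intro k l hkl
  obtain ⟨i, rfl | rfl⟩ := k.even_or_odd' <;> obtain ⟨j, rfl | rfl⟩ := l.even_or_odd' <;>
    simp only [mix_even, mix_odd] at hkl
  · rw [h hkl]
  · exact absurd hkl (hne _ _)
  · exact absurd hkl.symm (hne _ _)
  · rw [h' hkl]

/-- Contexts for definable predicates: types of tuples of numbers of `𝔐`. The `i`-th entry of the
tuple `a`, counted from its right end, is `ev a i` (and `0` if the tuple is shorter). -/
class Ctx (𝔐 : outParam L2Structure.{u}) (α : Type u) where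
  ev : α → ℕ → 𝔐.Num

instance : Ctx 𝔐 𝔐.Num where
  ev x i := Nat.casesOn i x fun _ => 0

instance {α : Type u} [Ctx 𝔐 α] : Ctx 𝔐 (α × 𝔐.Num) where
  ev p i := Nat.casesOn i p.2 (Ctx.ev p.1)

section

variable {α β : Type u} [Ctx 𝔐 α] [Ctx 𝔐 β]

/-- `P` is defined by a bounded formula with parameters; the variables with even index stand for
the entries of the tuple, those with odd index for number parameters. -/
def S0 (P : α → Prop) : Prop :=
  ∃ (θ : BddFormula) (E : ℕ → Set 𝔐.Num) (e : ℕ → 𝔐.Num), (∀ i, E i ∈ 𝔐.Sets) ∧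
    ∀ a, P a ↔ θ.Holds 𝔐 E (mix (Ctx.ev a) e)

/-- `f` is defined by a term with parameters. -/
def T0 (f : α → 𝔐.Num) : Prop :=
  ∃ (t : Term) (e : ℕ → 𝔐.Num), ∀ a, f a = t.eval 𝔐 (mix (Ctx.ev a) e)

theorem T0.ev (i : ℕ) : T0 (fun a : α => Ctx.ev a i) :=
  ⟨.var (2 * i), fun _ => 0, fun a => by simp [Term.eval, mix_even]⟩

theorem T0.const (c : 𝔐.Num) : T0 (fun _ : α => c) :=
  ⟨.var 1, fun _ => c, fun a => by simp [Term.eval, mix]⟩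

/-- Renamings that keep the entries of the tuple and separate two lists of parameters. -/
theorem exists_separating : ∃ ρ ρ' : ℕ → ℕ, Function.Injective ρ ∧ Function.Injective ρ' ∧
    ∀ {γ : Type u} (x e e' : ℕ → γ), mix x (mix e e') ∘ ρ = mix x e ∧
      mix x (mix e e') ∘ ρ' = mix x e' := by
  refine ⟨mix (fun i => 2 * i) (fun j => 2 * (2 * j) + 1),
    mix (fun i => 2 * i) (fun j => 2 * (2 * j + 1) + 1),
    mix_injective (fun i j h => by omega) (fun i j h => by omega)
      (fun i j => by omega),
    mix_injective (fun i j h => by omega) (fun i j h => by omega)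
      (fun i j => by omega), fun x e e' => ⟨?_, ?_⟩⟩ <;>
  · refine mix_ext (fun i => ?_) fun i => ?_ <;> simp only [Function.comp, mix_even, mix_odd]

theorem T0.common {f g : α → 𝔐.Num} (hf : T0 f) (hg : T0 g) :
    ∃ (s t : Term) (e : ℕ → 𝔐.Num), (∀ a, f a = s.eval 𝔐 (mix (Ctx.ev a) e)) ∧
      ∀ a, g a = t.eval 𝔐 (mix (Ctx.ev a) e) := by
  obtain ⟨s, e, hs⟩ := hf
  obtain ⟨t, e', ht⟩ := hg
  obtain ⟨ρ, ρ', -, -, h⟩ := exists_separating.{u}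
  refine ⟨s.rename ρ, t.rename ρ', mix e e', fun a => ?_, fun a => ?_⟩
  · rw [Term.eval_rename, (h _ _ _).1, hs]
  · rw [Term.eval_rename, (h _ _ _).2, ht]

theorem S0.common {P Q : α → Prop} (hP : S0 P) (hQ : S0 Q) :
    ∃ (θ ψ : BddFormula) (E : ℕ → Set 𝔐.Num) (e : ℕ → 𝔐.Num), (∀ i, E i ∈ 𝔐.Sets) ∧
      (∀ a, P a ↔ θ.Holds 𝔐 E (mix (Ctx.ev a) e)) ∧
      ∀ a, Q a ↔ ψ.Holds 𝔐 E (mix (Ctx.ev a) e) := by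
  obtain ⟨θ, E, e, hE, hθ⟩ := hP
  obtain ⟨ψ, E', e', hE', hψ⟩ := hQ
  obtain ⟨ρ, ρ', hρ, hρ', h⟩ := exists_separating.{u}
  refine ⟨θ.rename ρ (fun j => 2 * j), ψ.rename ρ' (fun j => 2 * j + 1), mix E E', mix e e',
    fun i => ?_, fun a => ?_, fun a => ?_⟩
  · unfold mix
    split_ifs
    exacts [hE _, hE' _]
  · rw [BddFormula.holds_rename hρ, (h _ _ _).1, hθ]
    have : mix E E' ∘ (fun j => 2 * j) = E := by funext j; simp only [Function.comp, mix_even]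
    rw [this]
  · rw [BddFormula.holds_rename hρ', (h _ _ _).2, hψ]
    have : mix E E' ∘ (fun j => 2 * j + 1) = E' := by
      funext j; simp only [Function.comp, mix_odd]
    rw [this]

theorem T0.add {f g : α → 𝔐.Num} (hf : T0 f) (hg : T0 g) : T0 (fun a => f a + g a) := by
  obtain ⟨s, t, e, hs, ht⟩ := hf.common hg
  exact ⟨.add s t, e, fun a => by rw [Term.eval, ← hs, ← ht]⟩

theorem T0.mul {f g : α → 𝔐.Num} (hf : T0 f) (hg : T0 g) : T0 (fun a => f a * g a) := by
  obtain ⟨s, t, e, hs, ht⟩ := hf.common hg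
  exact ⟨.mul s t, e, fun a => by rw [Term.eval, ← hs, ← ht]⟩

theorem S0.not {P : α → Prop} (hP : S0 P) : S0 (fun a => ¬ P a) := by
  obtain ⟨θ, E, e, hE, hθ⟩ := hP
  exact ⟨.neg θ, E, e, hE, fun a => by beta_reduce; rw [BddFormula.Holds, hθ]⟩

theorem S0.and {P Q : α → Prop} (hP : S0 P) (hQ : S0 Q) : S0 (fun a => P a ∧ Q a) := by
  obtain ⟨θ, ψ, E, e, hE, hθ, hψ⟩ := hP.common hQ
  exact ⟨.and θ ψ, E, e, hE, fun a => by beta_reduce; rw [BddFormula.Holds, hθ, hψ]⟩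

theorem S0.congr {P Q : α → Prop} (hP : S0 P) (h : ∀ a, Q a ↔ P a) : S0 Q := by
  rwa [show Q = P from funext fun a => propext (h a)]

theorem S0.or {P Q : α → Prop} (hP : S0 P) (hQ : S0 Q) : S0 (fun a => P a ∨ Q a) :=
  (hP.not.and hQ.not).not.congr fun a => by tauto

theorem T0.mem {f : α → 𝔐.Num} {A : Set 𝔐.Num} (hf : T0 f) (hA : A ∈ 𝔐.Sets) :
    S0 (fun a => f a ∈ A) := by
  obtain ⟨t, e, ht⟩ := hf
  exact ⟨.mem t 0, fun _ => A, e, fun _ => hA, fun a => by rw [BddFormula.Holds, ← ht]⟩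

/-- `h : α → β` makes a tuple out of constants `c i` and of entries of the given tuple, no entry
being used twice. -/
structure Reindex (h : α → β) (ρ : ℕ → Option ℕ) (c : ℕ → 𝔐.Num) : Prop where
  inj : ∀ i j k, ρ i = some k → ρ j = some k → i = j
  ev : ∀ a i, Ctx.ev (h a) i = (ρ i).elim (c i) (Ctx.ev a)

theorem S0.reindex {P : β → Prop} (hP : S0 P) {h : α → β} {ρ : ℕ → Option ℕ} {c : ℕ → 𝔐.Num}
    (hh : Reindex h ρ c) : S0 (fun a => P (h a)) := by
  obtain ⟨θ, E, e, hE, hθ⟩ := hP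
  let τ : ℕ → ℕ := fun i => (ρ i).elim (2 * (2 * i) + 1) (2 * ·)
  have hτ : Function.Injective τ := by
    intro i j hij
    simp only [τ] at hij
    rcases hi : ρ i with _ | k <;> rcases hj : ρ j with _ | l <;>
      simp only [hi, hj, Option.elim] at hij
    · omega
    · omega
    · omega
    · obtain rfl : k = l := by omega
      exact hh.inj i j k hi hj
  have hinj : Function.Injective (mix τ (fun j => 2 * (2 * j + 1) + 1)) := by
    refine mix_injective hτ (fun i j h => by omega) (fun i j => ?_)
    simp only [τ]
    rcases ρ i with _ | k <;> simp only [Option.elim] <;> omega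
  refine ⟨θ.rename (mix τ (fun j => 2 * (2 * j + 1) + 1)) id, E, mix c e, hE, fun a => ?_⟩
  beta_reduce
  rw [BddFormula.holds_rename hinj, hθ, Function.comp_id]
  have : mix (Ctx.ev a) (mix c e) ∘ mix τ (fun j => 2 * (2 * j + 1) + 1) =
      mix (Ctx.ev (h a)) e := by
    refine mix_ext (fun i => ?_) fun i => ?_
    · simp only [Function.comp, mix_even, τ, hh.ev]
      rcases ρ i with _ | k <;> simp only [Option.elim, mix_even, mix_odd]
    · simp only [Function.comp, mix_odd]
  rw [this]

theorem S0.ball {P : α × 𝔐.Num → Prop} {f : α → 𝔐.Num} (hP : S0 P) (hf : T0 f) :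
    S0 (fun a => ∀ x, x < f a → P (a, x)) := by
  obtain ⟨θ, E, e, hE, hθ⟩ := hP
  obtain ⟨t, e', ht⟩ := hf
  obtain ⟨σ, σ', hσ, -, h⟩ := exists_separating.{u}
  -- the bound variable gets the index `1`
  let ρ : ℕ → ℕ := mix (fun i => if i = 0 then 1 else 2 * (i - 1))
    (fun j => 2 * (2 * (2 * j) + 1) + 1)
  have hρ : Function.Injective ρ := by
    refine mix_injective (fun i j h => ?_) (fun i j h => by omega) (fun i j => ?_) <;>
      beta_reduce at *
    · split_ifs at h <;> omega
    · split_ifs <;> omega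
  let ρ' : ℕ → ℕ := mix (fun i => 2 * i) (fun j => 2 * (2 * (2 * j + 1) + 1) + 1)
  let d : ℕ → 𝔐.Num := mix (fun _ => 0) (mix e e')
  refine ⟨.ball 1 (t.rename ρ') (θ.rename ρ id), E, d, hE, fun a => ?_⟩
  have h1 : mix (Ctx.ev a) d ∘ ρ' = mix (Ctx.ev a) e' := by
    refine mix_ext (fun i => ?_) fun i => ?_ <;>
      simp only [Function.comp, ρ', d, mix_even, mix_odd]
  rw [BddFormula.Holds, Term.eval_rename, h1, ← ht]
  refine forall_congr' fun x => imp_congr_right fun _ => ?_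
  rw [BddFormula.holds_rename hρ, hθ, Function.comp_id]
  have h2 : Function.update (mix (Ctx.ev a) d) 1 x ∘ ρ = mix (Ctx.ev (a, x)) e := by
    refine mix_ext (fun i => ?_) fun i => ?_
    · simp only [Function.comp, ρ, mix_even]
      cases i with
      | zero => simp [Ctx.ev]
      | succ i =>
        rw [if_neg (by omega), Function.update_of_ne (by omega), Nat.add_sub_cancel, mix_even]
        rfl
    · simp only [Function.comp, ρ, mix_odd]
      rw [Function.update_of_ne (by omega)]
      simp only [d, mix_odd, mix_even]
  rw [h2]

theorem S0.bex {P : α × 𝔐.Num → Prop} {f : α → 𝔐.Num} (hP : S0 P) (hf : T0 f) :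
    S0 (fun a => ∃ x, x < f a ∧ P (a, x)) :=
  (hP.not.ball hf).not.congr fun a => by push Not; rfl

theorem T0.fst {f : α → 𝔐.Num} (hf : T0 f) : T0 (fun p : α × 𝔐.Num => f p.1) := by
  obtain ⟨t, e, ht⟩ := hf
  refine ⟨t.rename (mix (fun i => 2 * (i + 1)) fun j => 2 * j + 1), e, fun p => ?_⟩
  beta_reduce
  rw [Term.eval_rename, ht]
  congr 1
  symm
  refine mix_ext (fun i => ?_) fun i => ?_
  · simp only [Function.comp, mix_even]; rfl
  · simp only [Function.comp, mix_odd]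

theorem T0.id : T0 (fun x : 𝔐.Num => x) := T0.ev 0
theorem T0.v0 : T0 (fun p : α × 𝔐.Num => p.2) := T0.ev 0
theorem T0.v1 : T0 (fun p : (α × 𝔐.Num) × 𝔐.Num => p.1.2) := T0.ev 1

theorem Reindex.fst : Reindex (Prod.fst : α × 𝔐.Num → α) (fun i => some (i + 1)) fun _ => 0 :=
  ⟨fun i j k h h' => by grind, fun _ _ => rfl⟩

theorem Reindex.fst_fst : Reindex (fun p : (α × 𝔐.Num) × 𝔐.Num => p.1.1)
    (fun i => some (i + 2)) fun _ => 0 :=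
  ⟨fun i j k h h' => by grind, fun _ _ => rfl⟩

theorem Reindex.snd : Reindex (Prod.snd : α × 𝔐.Num → 𝔐.Num)
    (fun i => if i = 0 then some 0 else none) fun _ => 0 :=
  ⟨fun i j k h h' => by grind, fun a i => by cases i <;> rfl⟩

theorem Reindex.mk_left (a : α) : Reindex (fun x : 𝔐.Num => (a, x))
    (fun i => if i = 0 then some 0 else none) (fun i => Ctx.ev a (i - 1)) :=
  ⟨fun i j k h h' => by grind, fun a i => by cases i <;> rfl⟩

theorem Reindex.succ {h : α → β} {ρ : ℕ → Option ℕ} {c : ℕ → 𝔐.Num} (hh : Reindex h ρ c) :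
    Reindex (fun p : α × 𝔐.Num => (h p.1, p.2))
      (fun i => Nat.casesOn i (some 0) fun i => (ρ i).map (· + 1)) (fun i => c (i - 1)) where
  inj i j k hi hj := by
    rcases i with _ | i <;> rcases j with _ | j
    · rfl
    · obtain ⟨l, -, rfl⟩ := Option.map_eq_some_iff.1 hj
      cases hi
    · obtain ⟨l, -, rfl⟩ := Option.map_eq_some_iff.1 hi
      cases hj
    · simp only [Option.map_eq_some_iff] at hi hj
      obtain ⟨l, hl, rfl⟩ := hi
      obtain ⟨l', hl', h⟩ := hj
      obtain rfl : l' = l := by omega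
      rw [hh.inj i j l' hl hl']
  ev p i := by
    cases i with
    | zero => rfl
    | succ i =>
      change Ctx.ev (h p.1) i = _
      simp only [hh.ev, Nat.add_sub_cancel]
      cases ρ i <;> rfl

theorem S0.fst {P : α → Prop} (hP : S0 P) : S0 (fun p : α × 𝔐.Num => P p.1) :=
  hP.reindex Reindex.fst

theorem T0.eq [h : Nonempty 𝔐.Sets] {f g : α → 𝔐.Num} (hf : T0 f) (hg : T0 g) :
    S0 (fun a => f a = g a) := by
  obtain ⟨s, t, e, hs, ht⟩ := hf.common hg
  exact ⟨.eq s t, fun _ => h.some.1, e, fun _ => h.some.2,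
    fun a => by rw [BddFormula.Holds, ← hs, ← ht]⟩

theorem T0.lt [h : Nonempty 𝔐.Sets] {f g : α → 𝔐.Num} (hf : T0 f) (hg : T0 g) :
    S0 (fun a => f a < g a) := by
  obtain ⟨s, t, e, hs, ht⟩ := hf.common hg
  exact ⟨.lt s t, fun _ => h.some.1, e, fun _ => h.some.2,
    fun a => by rw [BddFormula.Holds, ← hs, ← ht]⟩

/-- Two predicates given by formulas with the variables `x₀ = n`, `x₁ = m` and with common
parameters. -/
theorem S0.exists_holdsAt {Q R : 𝔐.Num × 𝔐.Num → Prop} (hQ : S0 Q) (hR : S0 R) :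
    ∃ (θ ψ : BddFormula) (E : ℕ → Set 𝔐.Num) (e : ℕ → 𝔐.Num), (∀ i, E i ∈ 𝔐.Sets) ∧
      (∀ n m, Q (n, m) ↔ θ.HoldsAt 𝔐 E e n m) ∧ ∀ n m, R (n, m) ↔ ψ.HoldsAt 𝔐 E e n m := by
  obtain ⟨θ, ψ, E, e, hE, hθ, hψ⟩ := hQ.common hR
  let ρ : ℕ → ℕ := fun k => if k = 0 then 1 else if k = 1 then 2 else if k = 2 then 0 else k
  have hρ : Function.Injective ρ := by
    intro i j hij
    simp only [ρ] at hij
    split_ifs at hij <;> omega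
  have key : ∀ n m : 𝔐.Num, mix (Ctx.ev (n, m)) e = Function.update (Function.update
      (fun k => if k = 2 then e 0 else mix (fun _ => 0) e k) 0 n) 1 m ∘ ρ := by
    intro n m
    funext k
    match k with
    | 0 => simp [ρ, mix, Ctx.ev]
    | 1 => simp [ρ, mix]
    | 2 => simp [ρ, mix, Ctx.ev]
    | k + 3 =>
      have h0 : ρ (k + 3) = k + 3 := by simp [ρ]
      simp only [Function.comp, h0]
      rw [Function.update_of_ne (by omega), Function.update_of_ne (by omega),
        if_neg (by omega)]
      simp only [mix]
      split_ifs with hk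
      · obtain ⟨l, hl⟩ : ∃ l, (k + 3) / 2 = l + 1 + 1 := ⟨(k + 3) / 2 - 2, by omega⟩
        rw [hl]
        rfl
      · rfl
  refine ⟨θ.rename ρ id, ψ.rename ρ id, E, fun k => if k = 2 then e 0 else mix (fun _ => 0) e k,
    hE, fun n m => ?_, fun n m => ?_⟩
  · rw [BddFormula.HoldsAt, BddFormula.holds_rename hρ, Function.comp_id, hθ, key]
  · rw [BddFormula.HoldsAt, BddFormula.holds_rename hρ, Function.comp_id, hψ, key]

end

end

section

variable {𝔐 : L2Structure.{u}}

/-! ### Arithmetic in a model -/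

/-- A model of `RCA₀` with at least one set. (Without a set, the schemes of induction and
comprehension are void, because their set parameters cannot be assigned.) -/
class Model (𝔐 : L2Structure.{u}) : Prop where
  rca : ModelsRCA0 𝔐
  nonempty : Nonempty 𝔐.Sets

instance [h : Model 𝔐] : Nonempty 𝔐.Sets := h.nonempty

/-- `P` is a `Σ⁰₁` predicate with parameters. -/
def S1 {α : Type u} [Ctx 𝔐 α] (P : α → Prop) : Prop :=
  ∃ Q : α × 𝔐.Num → Prop, S0 Q ∧ ∀ a, P a ↔ ∃ m, Q (a, m)

theorem S0.s1 {α : Type u} [Ctx 𝔐 α] {P : α → Prop} (hP : S0 P) : S1 P :=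
  ⟨fun p => P p.1, hP.fst, fun _ => ⟨fun h => ⟨0, h⟩, fun ⟨_, h⟩ => h⟩⟩

theorem S0.ex {α : Type u} [Ctx 𝔐 α] {P : α × 𝔐.Num → Prop} (hP : S0 P) :
    S1 (fun a => ∃ m, P (a, m)) :=
  ⟨P, hP, fun _ => Iff.rfl⟩

variable [hM : Model 𝔐]

theorem S1.induction {P : 𝔐.Num → Prop} (hP : S1 P) (h0 : P 0) (hs : ∀ n, P n → P (n + 1))
    (n : 𝔐.Num) : P n := by
  obtain ⟨Q, hQ, hPQ⟩ := hP
  obtain ⟨θ, -, E, e, hE, hθ, -⟩ := hQ.exists_holdsAt hQ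
  have key : ∀ n, P n ↔ ∃ m, θ.HoldsAt 𝔐 E e n m := fun n => by simp only [hPQ, hθ]
  rw [key]
  refine hM.rca.sigma_one_induction θ E e hE ((key 0).1 h0) (fun n hn => ?_) n
  rw [← key] at hn ⊢
  exact hs n hn

theorem S0.induction {P : 𝔐.Num → Prop} (hP : S0 P) (h0 : P 0) (hs : ∀ n, P n → P (n + 1))
    (n : 𝔐.Num) : P n := hP.s1.induction h0 hs n

namespace Arith

variable (a b c : 𝔐.Num)

theorem add_zero : a + 0 = a := hM.rca.add_zero a
theorem add_succ : a + (b + 1) = a + b + 1 := hM.rca.add_succ a b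
theorem mul_zero : a * 0 = 0 := hM.rca.mul_zero a
theorem mul_succ : a * (b + 1) = a * b + a := hM.rca.mul_succ a b

theorem zero_add : 0 + a = a := by
  refine S0.induction (P := fun a : 𝔐.Num => 0 + a = a) (((T0.const 0).add T0.id).eq T0.id)
    (add_zero 0) (fun n h => ?_) a
  rw [add_succ, h]

theorem add_assoc : a + b + c = a + (b + c) := by
  refine S0.induction (P := fun c : 𝔐.Num => a + b + c = a + (b + c))
    (((T0.const _).add T0.id).eq ((T0.const a).add ((T0.const b).add T0.id)))
    (by rw [add_zero, add_zero]) (fun n h => ?_) c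
  rw [add_succ, add_succ, add_succ, h]

theorem succ_add : a + 1 + b = a + b + 1 := by
  refine S0.induction (P := fun b : 𝔐.Num => a + 1 + b = a + b + 1)
    (((T0.const _).add T0.id).eq (((T0.const a).add T0.id).add (T0.const 1)))
    (by rw [add_zero, add_zero]) (fun n h => ?_) b
  rw [add_succ, add_succ, h]

theorem add_comm : a + b = b + a := by
  refine S0.induction (P := fun b : 𝔐.Num => a + b = b + a)
    (((T0.const _).add T0.id).eq (T0.id.add (T0.const a)))
    (by rw [add_zero, zero_add]) (fun n h => ?_) b
  rw [add_succ, succ_add, h]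

theorem add_right_cancel (h : a + c = b + c) : a = b := by
  revert h
  refine S0.induction (P := fun c : 𝔐.Num => a + c = b + c → a = b) ?_
    (by rw [add_zero, add_zero]; exact id) (fun n h h' => ?_) c
  · refine S0.congr (P := fun c : 𝔐.Num => ¬ a + c = b + c ∨ a = b) ?_ fun c => imp_iff_not_or
    exact (((T0.const a).add T0.id).eq ((T0.const b).add T0.id)).not.or
      ((T0.const a).eq (T0.const b))
  · rw [add_succ, add_succ] at h'
    exact h (hM.rca.succ_inj _ _ h')

theorem zero_mul : 0 * a = 0 := by
  refine S0.induction (P := fun a : 𝔐.Num => 0 * a = 0) (((T0.const 0).mul T0.id).eq (T0.const 0))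
    (mul_zero 0) (fun n h => ?_) a
  rw [mul_succ, h, add_zero]

theorem succ_mul : (a + 1) * b = a * b + b := by
  refine S0.induction (P := fun b : 𝔐.Num => (a + 1) * b = a * b + b)
    (((T0.const _).mul T0.id).eq (((T0.const a).mul T0.id).add T0.id))
    (by rw [mul_zero, mul_zero, add_zero]) (fun n h => ?_) b
  rw [mul_succ, mul_succ, h, add_assoc, add_assoc, add_succ a, add_succ n, add_comm n a]

theorem mul_comm : a * b = b * a := by
  refine S0.induction (P := fun b : 𝔐.Num => a * b = b * a)
    (((T0.const _).mul T0.id).eq (T0.id.mul (T0.const a)))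
    (by rw [mul_zero, zero_mul]) (fun n h => ?_) b
  rw [mul_succ, succ_mul, h]

theorem mul_add : a * (b + c) = a * b + a * c := by
  refine S0.induction (P := fun c : 𝔐.Num => a * (b + c) = a * b + a * c)
    (((T0.const a).mul ((T0.const b).add T0.id)).eq ((T0.const _).add ((T0.const a).mul T0.id)))
    (by rw [add_zero, mul_zero, add_zero]) (fun n h => ?_) c
  rw [add_succ, mul_succ, mul_succ, h, add_assoc]

theorem mul_assoc : a * b * c = a * (b * c) := by
  refine S0.induction (P := fun c : 𝔐.Num => a * b * c = a * (b * c))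
    (((T0.const _).mul T0.id).eq ((T0.const a).mul ((T0.const b).mul T0.id)))
    (by rw [mul_zero, mul_zero, mul_zero]) (fun n h => ?_) c
  rw [mul_succ, mul_succ, mul_add, h]

theorem mul_one : a * 1 = a := by
  have := mul_succ a 0
  rwa [zero_add, mul_zero, zero_add] at this

theorem lt_add_succ : a < a + (b + 1) := by
  refine S0.induction (P := fun b : 𝔐.Num => a < a + (b + 1))
    ((T0.const a).lt ((T0.const a).add (T0.id.add (T0.const 1)))) ?_ (fun n h => ?_) b
  · rw [zero_add]
    exact (hM.rca.lt_succ _ _).2 (Or.inr rfl)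
  · rw [add_succ a (n + 1)]
    exact (hM.rca.lt_succ _ _).2 (Or.inl h)

theorem exists_of_lt (h : a < b) : ∃ k, a + (k + 1) = b := by
  suffices ∃ k, ¬ a < b ∨ a + (k + 1) = b by
    obtain ⟨k, hk⟩ := this
    exact ⟨k, hk.resolve_left (not_not.2 h)⟩
  refine S1.induction (P := fun b : 𝔐.Num => ∃ k, ¬ a < b ∨ a + (k + 1) = b) ?_
    ⟨0, Or.inl (hM.rca.not_lt_zero a)⟩ (fun n h => ?_) b
  · exact S0.ex (P := fun p : 𝔐.Num × 𝔐.Num => ¬ a < p.1 ∨ a + (p.2 + 1) = p.1)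
      (((T0.const a).lt T0.id.fst).not.or
        (((T0.const a).add (T0.v0.add (T0.const 1))).eq T0.id.fst))
  · by_cases hn : a < n
    · obtain ⟨k, hk⟩ := h
      exact ⟨k + 1, Or.inr (by rw [add_succ, hk.resolve_left (not_not.2 hn)])⟩
    · by_cases han : a = n
      · exact ⟨0, Or.inr (by rw [zero_add, han])⟩
      · exact ⟨0, Or.inl fun h' => ((hM.rca.lt_succ _ _).1 h').elim hn han⟩

theorem lt_irrefl : ¬ a < a := by
  intro h
  obtain ⟨k, hk⟩ := exists_of_lt a a h
  refine hM.rca.succ_ne_zero k (add_right_cancel _ _ a ?_)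
  rw [add_comm, hk, zero_add]

theorem lt_trans (h : a < b) (h' : b < c) : a < c := by
  obtain ⟨k, rfl⟩ := exists_of_lt a b h
  obtain ⟨l, rfl⟩ := exists_of_lt _ c h'
  rw [add_assoc, ← add_assoc (k + 1)]
  exact lt_add_succ _ _

theorem zero_lt_or_eq : 0 < a ∨ 0 = a := by
  refine S0.induction (P := fun a : 𝔐.Num => 0 < a ∨ 0 = a)
    (((T0.const 0).lt T0.id).or ((T0.const 0).eq T0.id)) (Or.inr rfl) (fun n h => ?_) a
  exact Or.inl ((hM.rca.lt_succ _ _).2 h)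

theorem lt_trichotomy : a < b ∨ a = b ∨ b < a := by
  refine S0.induction (P := fun b : 𝔐.Num => a < b ∨ a = b ∨ b < a)
    (((T0.const a).lt T0.id).or (((T0.const a).eq T0.id).or (T0.id.lt (T0.const a)))) ?_
    (fun n h => ?_) b
  · exact Or.inr ((zero_lt_or_eq a).symm.imp Eq.symm id)
  · rcases h with h | h | h
    · exact Or.inl ((hM.rca.lt_succ _ _).2 (Or.inl h))
    · exact Or.inl ((hM.rca.lt_succ _ _).2 (Or.inr h))
    · obtain ⟨k, rfl⟩ := exists_of_lt _ _ h
      refine Or.inr ?_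
      rcases zero_lt_or_eq k with hk | hk
      · obtain ⟨l, rfl⟩ := exists_of_lt _ _ hk
        refine Or.inr ?_
        rw [zero_add, add_comm (l + 1) 1, ← add_assoc]
        exact lt_add_succ _ _
      · exact Or.inl (by rw [← hk, zero_add])

end Arith

instance : CommSemiring 𝔐.Num where
  add_assoc := Arith.add_assoc
  zero_add := Arith.zero_add
  add_zero := Arith.add_zero
  add_comm := Arith.add_comm
  left_distrib := Arith.mul_add
  right_distrib a b c := by
    rw [Arith.mul_comm, Arith.mul_add, Arith.mul_comm a, Arith.mul_comm b]
  zero_mul := Arith.zero_mul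
  mul_zero := Arith.mul_zero
  mul_assoc := Arith.mul_assoc
  one_mul a := by rw [Arith.mul_comm, Arith.mul_one]
  mul_one := Arith.mul_one
  mul_comm := Arith.mul_comm
  nsmul := nsmulRec

open Classical in
noncomputable instance : LinearOrder 𝔐.Num where
  le := NLe
  le_refl a := Or.inr rfl
  le_trans a b c h h' := by
    rcases h with h | rfl
    · rcases h' with h' | rfl
      · exact Or.inl (Arith.lt_trans _ _ _ h h')
      · exact Or.inl h
    · exact h'
  lt_iff_le_not_ge a b := by
    refine ⟨fun h => ⟨Or.inl h, ?_⟩, fun h => h.1.resolve_right fun e => h.2 (Or.inr e.symm)⟩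
    rintro (h' | rfl)
    · exact Arith.lt_irrefl _ (Arith.lt_trans _ _ _ h h')
    · exact Arith.lt_irrefl _ h
  le_antisymm a b h h' := by
    rcases h with h | rfl
    · rcases h' with h' | rfl
      · exact absurd (Arith.lt_trans _ _ _ h h') (Arith.lt_irrefl _)
      · rfl
    · rfl
  le_total a b := by
    rcases Arith.lt_trichotomy a b with h | h | h
    exacts [Or.inl (Or.inl h), Or.inl (Or.inr h), Or.inr (Or.inl h)]
  toDecidableLE := Classical.decRel _

theorem lt_add_one_iff {a b : 𝔐.Num} : a < b + 1 ↔ a ≤ b := hM.rca.lt_succ a b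

theorem add_one_le_iff {a b : 𝔐.Num} : a + 1 ≤ b ↔ a < b := by
  rw [← not_lt, lt_add_one_iff, not_le]

theorem lt_iff_exists_add_one {a b : 𝔐.Num} : a < b ↔ ∃ k, a + (k + 1) = b :=
  ⟨Arith.exists_of_lt a b, fun ⟨k, hk⟩ => hk ▸ Arith.lt_add_succ a k⟩

instance : CanonicallyOrderedAdd 𝔐.Num where
  exists_add_of_le {a b} h := by
    rcases h with h | rfl
    · obtain ⟨k, rfl⟩ := Arith.exists_of_lt a b h
      exact ⟨_, rfl⟩
    · exact ⟨0, (Arith.add_zero _).symm⟩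
  le_add_self a b := by
    rcases Arith.zero_lt_or_eq b with h | rfl
    · obtain ⟨k, rfl⟩ := Arith.exists_of_lt _ _ h
      rw [zero_add, add_comm]
      exact Or.inl (Arith.lt_add_succ _ _)
    · exact Or.inr (zero_add _).symm
  le_self_add a b := by
    rcases Arith.zero_lt_or_eq b with h | rfl
    · obtain ⟨k, rfl⟩ := Arith.exists_of_lt _ _ h
      rw [zero_add]
      exact Or.inl (Arith.lt_add_succ _ _)
    · exact Or.inr (add_zero _).symm

theorem exists_eq_add_one {a : 𝔐.Num} (h : 0 < a) : ∃ b, a = b + 1 := by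
  obtain ⟨k, rfl⟩ := Arith.exists_of_lt _ _ h
  exact ⟨k, zero_add _⟩

instance : IsCancelAdd 𝔐.Num where
  add_left_cancel a b c h := Arith.add_right_cancel b c a (by
    rwa [add_comm b, add_comm c])
  add_right_cancel a b c h := Arith.add_right_cancel b c a h

instance : IsStrictOrderedRing 𝔐.Num where
  add_le_add_left a b h c := by
    obtain ⟨k, rfl⟩ := exists_add_of_le h
    rw [add_right_comm]
    exact le_self_add
  le_of_add_le_add_left a b c h := by
    obtain ⟨k, hk⟩ := exists_add_of_le h
    rw [add_assoc] at hk
    rw [add_left_cancel hk]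
    exact le_self_add
  zero_le_one := zero_le
  exists_pair_ne := ⟨1, 0, fun h => hM.rca.succ_ne_zero 0 (by rw [zero_add]; exact h)⟩
  mul_lt_mul_of_pos_left a ha b c h := by
    obtain ⟨k, rfl⟩ := lt_iff_exists_add_one.1 h
    obtain ⟨l, rfl⟩ := exists_eq_add_one ha
    refine lt_iff_exists_add_one.2 ⟨l * k + k + l, ?_⟩
    ring
  mul_lt_mul_of_pos_right a ha b c h := by
    obtain ⟨k, rfl⟩ := lt_iff_exists_add_one.1 h
    obtain ⟨l, rfl⟩ := exists_eq_add_one ha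
    refine lt_iff_exists_add_one.2 ⟨l * k + k + l, ?_⟩
    ring

theorem pair_lt_pair_of_add_lt {i j k l : 𝔐.Num} (h : i + j < k + l) : pair i j < pair k l := by
  obtain ⟨m, hm⟩ := lt_iff_exists_add_one.1 h
  have hij : i ≤ i + j := le_self_add
  simp only [pair, ← hm]
  calc (i + j) * (i + j) + i ≤ (i + j) * (i + j) + (i + j) := by gcongr
    _ < (i + j) * (i + j) + (i + j) + (i + j + 1) := by
      exact Arith.lt_add_succ _ _
    _ ≤ (i + j + (m + 1)) * (i + j + (m + 1)) + k := by
      have : (i + j + (m + 1)) * (i + j + (m + 1)) + k = (i + j) * (i + j) + (i + j) +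
        (i + j + 1) + (2 * (i + j) * m + m * m + 2 * m + k) := by ring
      rw [this]
      exact le_self_add

theorem pair_inj {i j k l : 𝔐.Num} : pair i j = pair k l ↔ i = k ∧ j = l := by
  refine ⟨fun h => ?_, fun ⟨h, h'⟩ => by rw [h, h']⟩
  have hs : i + j = k + l := by
    rcases lt_trichotomy (i + j) (k + l) with h' | h' | h'
    · exact absurd h (pair_lt_pair_of_add_lt h').ne
    · exact h'
    · exact absurd h (pair_lt_pair_of_add_lt h').ne'
  simp only [pair, hs] at h
  obtain rfl := add_left_cancel h
  exact ⟨rfl, add_left_cancel hs⟩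

theorem self_le_mul_self (a : 𝔐.Num) : a ≤ a * a := by
  rcases Arith.zero_lt_or_eq a with h | rfl
  · exact le_mul_of_one_le_left zero_le (by
      have := add_one_le_iff.2 h
      rwa [zero_add] at this)
  · exact zero_le

theorem left_le_pair (i j : 𝔐.Num) : i ≤ pair i j := le_add_self

theorem right_le_pair (i j : 𝔐.Num) : j ≤ pair i j :=
  (le_add_self : j ≤ i + j).trans ((self_le_mul_self _).trans le_self_add)

end

section

variable {𝔐 : L2Structure.{u}}

/-! ### Closure properties of `Σ⁰₁` and `Δ⁰₁` predicates and of definable functions -/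

section

variable {α β : Type u} [Ctx 𝔐 α] [Ctx 𝔐 β]

theorem S1.congr {P Q : α → Prop} (hP : S1 P) (h : ∀ a, Q a ↔ P a) : S1 Q := by
  rwa [show Q = P from funext fun a => propext (h a)]

theorem S1.reindex {P : β → Prop} (hP : S1 P) {h : α → β} {ρ : ℕ → Option ℕ} {c : ℕ → 𝔐.Num}
    (hh : Reindex h ρ c) : S1 (fun a => P (h a)) := by
  obtain ⟨Q, hQ, hPQ⟩ := hP
  exact ⟨fun p => Q (h p.1, p.2), hQ.reindex hh.succ, fun a => hPQ (h a)⟩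

variable [hM : Model 𝔐]

theorem S1.and {P Q : α → Prop} (hP : S1 P) (hQ : S1 Q) : S1 (fun a => P a ∧ Q a) := by
  obtain ⟨P', hP', hP⟩ := hP
  obtain ⟨Q', hQ', hQ⟩ := hQ
  have h1 := ((hP'.reindex (Reindex.fst (α := α)).succ).bex T0.v0).and
    ((hQ'.reindex (Reindex.fst (α := α)).succ).bex T0.v0)
  refine h1.ex.congr fun a => ?_
  rw [hP, hQ]
  constructor
  · rintro ⟨⟨m, hm⟩, n, hn⟩
    exact ⟨max m n + 1, ⟨m, lt_add_one_iff.2 (le_max_left _ _), hm⟩,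
      n, lt_add_one_iff.2 (le_max_right _ _), hn⟩
  · rintro ⟨_, ⟨m, -, hm⟩, n, -, hn⟩
    exact ⟨⟨m, hm⟩, n, hn⟩

theorem S1.or {P Q : α → Prop} (hP : S1 P) (hQ : S1 Q) : S1 (fun a => P a ∨ Q a) := by
  obtain ⟨P', hP', hP⟩ := hP
  obtain ⟨Q', hQ', hQ⟩ := hQ
  refine (hP'.or hQ').ex.congr fun a => ?_
  rw [hP, hQ, exists_or]

theorem S1.ex {P : α → 𝔐.Num → Prop} (hP : S1 (fun p : α × 𝔐.Num => P p.1 p.2)) :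
    S1 (fun a => ∃ x, P a x) := by
  obtain ⟨Q, hQ, hP⟩ := hP
  have h1 := ((hQ.reindex (Reindex.fst (α := α)).succ.succ).bex T0.v1).bex T0.v0
  refine h1.ex.congr fun a => ?_
  constructor
  · rintro ⟨x, hx⟩
    obtain ⟨m, hm⟩ := (hP (a, x)).1 hx
    exact ⟨max x m + 1, x, lt_add_one_iff.2 (le_max_left _ _),
      m, lt_add_one_iff.2 (le_max_right _ _), hm⟩
  · rintro ⟨_, x, -, m, -, hm⟩
    exact ⟨x, (hP (a, x)).2 ⟨m, hm⟩⟩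

/-- The collection principle for bounded predicates. -/
theorem S0.collection {Q : (α × 𝔐.Num) × 𝔐.Num → Prop} (hQ : S0 Q) (a : α) (t : 𝔐.Num)
    (h : ∀ x, x < t → ∃ m, Q ((a, x), m)) : ∃ b, ∀ x, x < t → ∃ m, m < b ∧ Q ((a, x), m) := by
  suffices ∃ b, ¬ t ≤ t ∨ ∀ x, x < t → ∃ m, m < b ∧ Q ((a, x), m) by
    obtain ⟨b, hb⟩ := this
    exact ⟨b, hb.resolve_left (not_not.2 le_rfl)⟩
  refine S1.induction (P := fun n => ∃ b, ¬ n ≤ t ∨ ∀ x, x < n → ∃ m, m < b ∧ Q ((a, x), m)) ?_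
    ⟨0, Or.inr fun x hx => absurd hx (hM.rca.not_lt_zero x)⟩ ?_ t
  · have h1 := (hQ.reindex (Reindex.mk_left a).succ).reindex
      (Reindex.snd (α := 𝔐.Num × 𝔐.Num)).succ
    have h2 := (h1.bex T0.v1).ball T0.id.fst
    have h3 : S0 (fun p : 𝔐.Num × 𝔐.Num => ¬ p.1 ≤ t) :=
      ((T0.const t).lt T0.id.fst).congr fun p => not_le
    exact (h3.or h2).ex
  · rintro n ⟨b, hb⟩
    by_cases hn : n < t
    · obtain ⟨m, hm⟩ := h n hn
      refine ⟨max b (m + 1), Or.inr fun x hx => ?_⟩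
      rcases (hM.rca.lt_succ _ _).1 hx with hx | rfl
      · obtain ⟨m', hm', hQ'⟩ := hb.resolve_left (not_not.2 hn.le) x hx
        exact ⟨m', lt_max_of_lt_left hm', hQ'⟩
      · exact ⟨m, lt_max_of_lt_right (lt_add_one_iff.2 le_rfl), hm⟩
    · exact ⟨0, Or.inl fun h' => hn (add_one_le_iff.1 h')⟩

theorem S1.ball_snd {P : α × 𝔐.Num → Prop} (hP : S1 P) :
    S1 (fun p : α × 𝔐.Num => ∀ x, x < p.2 → P (p.1, x)) := by
  obtain ⟨Q, hQ, hP⟩ := hP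
  have h1 := ((hQ.reindex (Reindex.fst_fst (α := α)).succ.succ).bex T0.v1).ball T0.v1
  refine h1.ex.congr fun p => ?_
  simp only [hP]
  constructor
  · exact hQ.collection p.1 p.2
  · rintro ⟨b, hb⟩ x hx
    obtain ⟨m, -, hm⟩ := hb x hx
    exact ⟨m, hm⟩

/-- `f` has a `Σ⁰₁` graph (which is then `Δ⁰₁`). -/
def DF (f : α → 𝔐.Num) : Prop := S1 (fun p : α × 𝔐.Num => p.2 = f p.1)

/-- `P` is a `Δ⁰₁` predicate with parameters. -/
def D1 (P : α → Prop) : Prop := S1 P ∧ S1 (fun a => ¬ P a)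

theorem T0.df {f : α → 𝔐.Num} (hf : T0 f) : DF f := (T0.v0.eq hf.fst).s1

theorem S1.subst {P : α → 𝔐.Num → Prop} (hP : S1 (fun p : α × 𝔐.Num => P p.1 p.2))
    {f : α → 𝔐.Num} (hf : DF f) : S1 (fun a => P a (f a)) := by
  refine (S1.ex (P := fun a x => x = f a ∧ P a x) (S1.and hf hP)).congr fun a => ?_
  simp

theorem DF.fst {f : α → 𝔐.Num} (hf : DF f) : DF (fun p : α × 𝔐.Num => f p.1) :=
  S1.reindex hf (Reindex.fst (α := α)).succ

theorem S1.comp {P : 𝔐.Num → Prop} (hP : S1 P) {f : α → 𝔐.Num} (hf : DF f) :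
    S1 (fun a => P (f a)) :=
  S1.subst (P := fun _ x => P x) (hP.reindex Reindex.snd) hf

theorem S1.comp₂ {P : 𝔐.Num → 𝔐.Num → Prop} (hP : S1 (fun p : 𝔐.Num × 𝔐.Num => P p.1 p.2))
    {f g : α → 𝔐.Num} (hf : DF f) (hg : DF g) : S1 (fun a => P (f a) (g a)) := by
  have h1 := hP.reindex (Reindex.snd (α := α)).succ
  exact S1.subst (P := fun a x => P x (g a))
    (S1.subst (P := fun (p : α × 𝔐.Num) y => P p.2 y) h1 hg.fst) hf

theorem S1.comp₃ {P : 𝔐.Num → 𝔐.Num → 𝔐.Num → Prop}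
    (hP : S1 (fun p : (𝔐.Num × 𝔐.Num) × 𝔐.Num => P p.1.1 p.1.2 p.2))
    {f g h : α → 𝔐.Num} (hf : DF f) (hg : DF g) (hh : DF h) :
    S1 (fun a => P (f a) (g a) (h a)) := by
  have h1 := hP.reindex (Reindex.snd (α := α)).succ.succ
  exact S1.subst (P := fun a x => P x (g a) (h a))
    (S1.subst (P := fun (p : α × 𝔐.Num) y => P p.2 y (h p.1))
      (S1.subst (P := fun (p : (α × 𝔐.Num) × 𝔐.Num) z => P p.1.2 p.2 z) h1 hh.fst.fst) hg.fst) hf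

theorem S1.ball {P : α → 𝔐.Num → Prop} (hP : S1 (fun p : α × 𝔐.Num => P p.1 p.2))
    {f : α → 𝔐.Num} (hf : DF f) : S1 (fun a => ∀ x, x < f a → P a x) :=
  S1.subst (P := fun a t => ∀ x, x < t → P a x) hP.ball_snd hf

theorem D1.s1 {P : α → Prop} (hP : D1 P) : S1 P := hP.1

theorem S0.d1 {P : α → Prop} (hP : S0 P) : D1 P := ⟨hP.s1, hP.not.s1⟩

theorem D1.congr {P Q : α → Prop} (hP : D1 P) (h : ∀ a, Q a ↔ P a) : D1 Q := by
  rwa [show Q = P from funext fun a => propext (h a)]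

theorem D1.not {P : α → Prop} (hP : D1 P) : D1 (fun a => ¬ P a) :=
  ⟨hP.2, hP.1.congr fun _ => not_not⟩

theorem D1.and {P Q : α → Prop} (hP : D1 P) (hQ : D1 Q) : D1 (fun a => P a ∧ Q a) :=
  ⟨hP.1.and hQ.1, (hP.2.or hQ.2).congr fun _ => not_and_or⟩

theorem D1.or {P Q : α → Prop} (hP : D1 P) (hQ : D1 Q) : D1 (fun a => P a ∨ Q a) :=
  ⟨hP.1.or hQ.1, (hP.2.and hQ.2).congr fun _ => not_or⟩

theorem D1.imp {P Q : α → Prop} (hP : D1 P) (hQ : D1 Q) : D1 (fun a => P a → Q a) :=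
  (hP.not.or hQ).congr fun _ => imp_iff_not_or

theorem D1.iff {P Q : α → Prop} (hP : D1 P) (hQ : D1 Q) : D1 (fun a => P a ↔ Q a) :=
  ((hP.imp hQ).and (hQ.imp hP)).congr fun _ => iff_def

theorem D1.ball {P : α → 𝔐.Num → Prop} (hP : D1 (fun p : α × 𝔐.Num => P p.1 p.2))
    {f : α → 𝔐.Num} (hf : DF f) : D1 (fun a => ∀ x, x < f a → P a x) := by
  refine ⟨S1.ball hP.1 hf, ?_⟩
  refine (S1.ex (P := fun a x => x < f a ∧ ¬ P a x) (S1.and ?_ hP.2)).congr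
    fun a => by push Not; rfl
  exact S1.subst (P := fun (p : α × 𝔐.Num) y => p.2 < y) (T0.v1.lt T0.v0).s1 hf.fst

theorem D1.bex {P : α → 𝔐.Num → Prop} (hP : D1 (fun p : α × 𝔐.Num => P p.1 p.2))
    {f : α → 𝔐.Num} (hf : DF f) : D1 (fun a => ∃ x, x < f a ∧ P a x) :=
  (D1.ball (P := fun a x => ¬ P a x) hP.not hf).not.congr fun a => by push Not; rfl

theorem D1.comp {P : 𝔐.Num → Prop} (hP : D1 P) {f : α → 𝔐.Num} (hf : DF f) :
    D1 (fun a => P (f a)) :=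
  ⟨hP.1.comp hf, S1.comp hP.2 hf⟩

theorem D1.comp₂ {P : 𝔐.Num → 𝔐.Num → Prop} (hP : D1 (fun p : 𝔐.Num × 𝔐.Num => P p.1 p.2))
    {f g : α → 𝔐.Num} (hf : DF f) (hg : DF g) : D1 (fun a => P (f a) (g a)) :=
  ⟨S1.comp₂ hP.1 hf hg, S1.comp₂ (P := fun x y => ¬ P x y) hP.2 hf hg⟩

theorem DF.id : DF (fun x : 𝔐.Num => x) := T0.id.df
theorem DF.const (c : 𝔐.Num) : DF (fun _ : α => c) := (T0.const c).df
theorem DF.v0 : DF (fun p : α × 𝔐.Num => p.2) := T0.v0.df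
theorem DF.v1 : DF (fun p : (α × 𝔐.Num) × 𝔐.Num => p.1.2) := DF.v0.fst
theorem DF.v2 : DF (fun p : ((α × 𝔐.Num) × 𝔐.Num) × 𝔐.Num => p.1.1.2) := DF.v1.fst
theorem DF.v3 : DF (fun p : (((α × 𝔐.Num) × 𝔐.Num) × 𝔐.Num) × 𝔐.Num => p.1.1.1.2) := DF.v2.fst
theorem DF.w1 : DF (fun p : 𝔐.Num × 𝔐.Num => p.1) := DF.id.fst
theorem DF.w2 : DF (fun p : (𝔐.Num × 𝔐.Num) × 𝔐.Num => p.1.1) := DF.w1.fst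
theorem DF.w3 : DF (fun p : ((𝔐.Num × 𝔐.Num) × 𝔐.Num) × 𝔐.Num => p.1.1.1) := DF.w2.fst
theorem DF.w4 : DF (fun p : (((𝔐.Num × 𝔐.Num) × 𝔐.Num) × 𝔐.Num) × 𝔐.Num => p.1.1.1.1) :=
  DF.w3.fst
theorem DF.w5 : DF (fun p : ((((𝔐.Num × 𝔐.Num) × 𝔐.Num) × 𝔐.Num) × 𝔐.Num) × 𝔐.Num =>
    p.1.1.1.1.1) := DF.w4.fst

theorem DF.comp {f : 𝔐.Num → 𝔐.Num} (hf : DF f) {g : α → 𝔐.Num} (hg : DF g) :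
    DF (fun a => f (g a)) :=
  S1.comp₂ (P := fun x y => y = f x) hf hg.fst DF.v0

theorem DF.comp₂ {f : 𝔐.Num → 𝔐.Num → 𝔐.Num} (hf : DF (fun p : 𝔐.Num × 𝔐.Num => f p.1 p.2))
    {g h : α → 𝔐.Num} (hg : DF g) (hh : DF h) : DF (fun a => f (g a) (h a)) :=
  S1.comp₃ (P := fun x y z => z = f x y) hf hg.fst hh.fst DF.v0

theorem DF.add {f g : α → 𝔐.Num} (hf : DF f) (hg : DF g) : DF (fun a => f a + g a) :=
  DF.comp₂ (f := fun x y => x + y) (T0.id.fst.add T0.v0).df hf hg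

theorem DF.mul {f g : α → 𝔐.Num} (hf : DF f) (hg : DF g) : DF (fun a => f a * g a) :=
  DF.comp₂ (f := fun x y => x * y) (T0.id.fst.mul T0.v0).df hf hg

theorem DF.pair {f g : α → 𝔐.Num} (hf : DF f) (hg : DF g) : DF (fun a => pair (f a) (g a)) :=
  ((hf.add hg).mul (hf.add hg)).add hf

theorem D1.eq {f g : α → 𝔐.Num} (hf : DF f) (hg : DF g) : D1 (fun a => f a = g a) :=
  D1.comp₂ (P := fun x y => x = y) (T0.id.fst.eq T0.v0).d1 hf hg

theorem D1.lt {f g : α → 𝔐.Num} (hf : DF f) (hg : DF g) : D1 (fun a => f a < g a) :=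
  D1.comp₂ (P := fun x y => x < y) (T0.id.fst.lt T0.v0).d1 hf hg

theorem D1.mem {A : Set 𝔐.Num} (hA : A ∈ 𝔐.Sets) {f : α → 𝔐.Num} (hf : DF f) :
    D1 (fun a => f a ∈ A) :=
  D1.comp (P := fun x => x ∈ A) (T0.id.mem hA).d1 hf

theorem D1.const (p : Prop) : D1 (fun _ : α => p) := by
  by_cases hp : p
  · exact (D1.eq (DF.const 0) (DF.const 0)).congr fun _ => by simp [hp]
  · exact (D1.eq (DF.const 0) (DF.const 0)).not.congr fun _ => by simp [hp]

theorem D1.bex_le {P : α → 𝔐.Num → Prop} (hP : D1 (fun p : α × 𝔐.Num => P p.1 p.2))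
    {f : α → 𝔐.Num} (hf : DF f) : D1 (fun a => ∃ x, x ≤ f a ∧ P a x) :=
  (D1.bex hP (hf.add (DF.const 1))).congr fun a => by simp only [lt_add_one_iff]

theorem DF.ite {P : α → Prop} [DecidablePred P] (hP : D1 P) {f g : α → 𝔐.Num} (hf : DF f)
    (hg : DF g) : DF (fun a => if P a then f a else g a) := by
  have hfst : D1 (fun p : α × 𝔐.Num => P p.1) :=
    ⟨hP.1.reindex Reindex.fst, S1.reindex hP.2 Reindex.fst⟩
  refine S1.congr (((hfst.and (D1.eq DF.v0 hf.fst)).or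
    (hfst.not.and (D1.eq DF.v0 hg.fst))).s1) fun p => ?_
  by_cases h : P p.1 <;> simp [h]

/-- `Δ⁰₁` comprehension. -/
theorem D1.mem_sets {P : 𝔐.Num → Prop} (hP : D1 P) : {n | P n} ∈ 𝔐.Sets := by
  obtain ⟨⟨Q, hQ, hPQ⟩, ⟨R, hR, hPR⟩⟩ := hP
  obtain ⟨θ, ψ, E, e, hE, hθ, hψ⟩ := hQ.exists_holdsAt hR.not
  obtain ⟨X, hX, hmem⟩ := hM.rca.delta_one_comprehension θ ψ E e hE fun n => by
    simp only [← hθ, ← hψ]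
    rw [← hPQ, ← not_exists, ← hPR, not_not]
  have : {n | P n} = X := by
    ext n
    rw [hmem]
    simp only [← hθ, ← hPQ]
    rfl
  rwa [this]

end

end

section

variable {𝔐 : L2Structure.{u}} [hM : Model 𝔐]

/-! ### Search for least witnesses -/

/-- Proofs of definability: the default value of the argument decomposes a predicate or a function
into constituents that are definable by a hypothesis in the context or by a closure property. -/
theorem by_def {p : Prop} (h : p := by
    repeat' first
      | assumption
      | apply DF.id | apply DF.v0 | apply DF.v1 | apply DF.v2 | apply DF.v3
      | apply DF.w1 | apply DF.w2 | apply DF.w3 | apply DF.w4 | apply DF.w5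
      | apply DF.const | apply D1.const
      | apply D1.not | apply D1.and | apply D1.or | apply D1.iff
      | apply D1.ball | apply D1.bex | apply D1.bex_le | apply D1.imp
      | apply D1.eq | apply D1.lt | apply D1.mem (by assumption)
      | apply DF.add | apply DF.mul | apply DF.pair
      | with_reducible apply S1.and | with_reducible apply S1.or | with_reducible apply S1.ex
      | with_reducible apply S1.ball
      | refine DF.comp (by assumption) ?_ | refine DF.comp₂ (by assumption) ?_ ?_
      | refine D1.comp (by assumption) ?_ | refine D1.comp₂ (by assumption) ?_ ?_
      | refine S1.comp (by assumption) ?_ | refine S1.comp₂ (by assumption) ?_ ?_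
      | refine S1.comp₃ (by assumption) ?_ ?_ ?_
      | with_reducible apply D1.s1) : p := h

theorem D1.induction {P : 𝔐.Num → Prop} (hP : D1 P) (h0 : P 0) (hs : ∀ n, P n → P (n + 1))
    (n : 𝔐.Num) : P n := hP.1.induction h0 hs n

theorem not_lt_zero' (n : 𝔐.Num) : ¬ n < 0 := hM.rca.not_lt_zero n

/-- The least number principle. -/
theorem D1.exists_least {P : 𝔐.Num → Prop} (hP : D1 P) {n : 𝔐.Num} (hn : P n) :
    ∃ m, P m ∧ ∀ k, k < m → ¬ P k := by
  by_contra! h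
  refine D1.induction (P := fun n => ∀ k, k < n → ¬ P k) by_def
    (fun k hk => absurd hk (not_lt_zero' k)) (fun n ih k hk hPk => ?_) (n + 1) n
    (lt_add_one_iff.2 le_rfl) hn
  rcases (lt_add_one_iff.1 hk).lt_or_eq with hk | rfl
  · exact ih k hk hPk
  · obtain ⟨l, hl, hPl⟩ := h k hPk
    exact ih l hl hPl

section

variable {α : Type u} [Ctx 𝔐 α]

theorem S1.section {P : α → 𝔐.Num → Prop} (hP : S1 (fun p : α × 𝔐.Num => P p.1 p.2)) (a : α) :
    S1 (P a) := hP.reindex (Reindex.mk_left a)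

theorem D1.section {P : α → 𝔐.Num → Prop} (hP : D1 (fun p : α × 𝔐.Num => P p.1 p.2)) (a : α) :
    D1 (P a) := ⟨S1.section hP.1 a, S1.section (P := fun a x => ¬ P a x) hP.2 a⟩

theorem D1.lift {P : α → 𝔐.Num → Prop} (hP : D1 (fun p : α × 𝔐.Num => P p.1 p.2)) :
    D1 (fun p : (α × 𝔐.Num) × 𝔐.Num => P p.1.1 p.2) :=
  ⟨S1.reindex hP.1 (Reindex.fst (α := α)).succ, S1.reindex hP.2 (Reindex.fst (α := α)).succ⟩

/-- Search for the least witness. -/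
theorem D1.exists_min {P : α → 𝔐.Num → Prop} (hP : D1 (fun p : α × 𝔐.Num => P p.1 p.2))
    (h : ∀ a, ∃ x, P a x) :
    ∃ f : α → 𝔐.Num, DF f ∧ ∀ a, P a (f a) ∧ ∀ x, x < f a → ¬ P a x := by
  have h' : ∀ a, ∃ x, P a x ∧ ∀ y, y < x → ¬ P a y := fun a => by
    obtain ⟨x, hx⟩ := h a
    exact (hP.section a).exists_least hx
  choose f hf hmin using h'
  refine ⟨f, ?_, fun a => ⟨hf a, hmin a⟩⟩
  have h1 : D1 (fun p : α × 𝔐.Num => P p.1 p.2 ∧ ∀ y, y < p.2 → ¬ P p.1 y) :=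
    hP.and (D1.ball (P := fun (p : α × 𝔐.Num) y => ¬ P p.1 y) hP.lift.not DF.v0)
  refine h1.1.congr fun p => ⟨fun h => h ▸ ⟨hf p.1, hmin p.1⟩, fun ⟨h, h'⟩ => ?_⟩
  rcases lt_trichotomy p.2 (f p.1) with hlt | heq | hgt
  · exact absurd h (hmin _ _ hlt)
  · exact heq
  · exact absurd (hf _) (h' _ hgt)

end

/-! ### Projections of pairs -/

open Classical in
/-- The first component of a pair, and `0` for a number that is not a pair. -/
noncomputable def left (z : 𝔐.Num) : 𝔐.Num := if h : ∃ i j, z = pair i j then h.choose else 0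

open Classical in
/-- The second component of a pair, and `0` for a number that is not a pair. -/
noncomputable def right (z : 𝔐.Num) : 𝔐.Num :=
  if h : ∃ i j, z = pair i j then h.choose_spec.choose else 0

theorem left_pair (i j : 𝔐.Num) : left (pair i j) = i := by
  have h : ∃ k l, pair i j = pair k l := ⟨i, j, rfl⟩
  rw [left, dif_pos h]
  exact (pair_inj.1 h.choose_spec.choose_spec).1.symm

theorem right_pair (i j : 𝔐.Num) : right (pair i j) = j := by
  have h : ∃ k l, pair i j = pair k l := ⟨i, j, rfl⟩
  rw [right, dif_pos h]
  exact (pair_inj.1 h.choose_spec.choose_spec).2.symm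

theorem left_df : DF (left : 𝔐.Num → 𝔐.Num) := by
  have h1 : D1 (fun p : 𝔐.Num × 𝔐.Num => (∃ j, j ≤ p.1 ∧ p.1 = pair p.2 j) ∨
      ¬ (∃ i, i ≤ p.1 ∧ ∃ j, j ≤ p.1 ∧ p.1 = pair i j) ∧ p.2 = 0) := by_def
  refine h1.1.congr fun p => ?_
  by_cases h : ∃ i j, p.1 = pair i j
  · obtain ⟨i, j, hij⟩ := h
    rw [hij, left_pair]
    refine ⟨fun h => Or.inl ⟨j, right_le_pair _ _, by rw [h]⟩, ?_⟩
    rintro (⟨j', -, h⟩ | ⟨h, -⟩)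
    · exact (pair_inj.1 h).1.symm
    · exact absurd ⟨i, left_le_pair _ _, j, right_le_pair _ _, rfl⟩ h
  · rw [left, dif_neg h]
    refine ⟨fun h' => Or.inr ⟨fun ⟨i, _, j, _, hij⟩ => h ⟨i, j, hij⟩, h'⟩, ?_⟩
    rintro (⟨j', -, h'⟩ | ⟨-, h'⟩)
    · exact absurd ⟨_, _, h'⟩ h
    · exact h'

theorem right_df : DF (right : 𝔐.Num → 𝔐.Num) := by
  have h1 : D1 (fun p : 𝔐.Num × 𝔐.Num => (∃ i, i ≤ p.1 ∧ p.1 = pair i p.2) ∨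
      ¬ (∃ i, i ≤ p.1 ∧ ∃ j, j ≤ p.1 ∧ p.1 = pair i j) ∧ p.2 = 0) := by_def
  refine h1.1.congr fun p => ?_
  by_cases h : ∃ i j, p.1 = pair i j
  · obtain ⟨i, j, hij⟩ := h
    rw [hij, right_pair]
    refine ⟨fun h => Or.inl ⟨i, left_le_pair _ _, by rw [h]⟩, ?_⟩
    rintro (⟨j', -, h⟩ | ⟨h, -⟩)
    · exact (pair_inj.1 h).2.symm
    · exact absurd ⟨i, left_le_pair _ _, j, right_le_pair _ _, rfl⟩ h
  · rw [right, dif_neg h]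
    refine ⟨fun h' => Or.inr ⟨fun ⟨i, _, j, _, hij⟩ => h ⟨i, j, hij⟩, h'⟩, ?_⟩
    rintro (⟨j', -, h'⟩ | ⟨-, h'⟩)
    · exact absurd ⟨_, _, h'⟩ h
    · exact h'

section

variable {α : Type u} [Ctx 𝔐 α]

theorem DF.left {f : α → 𝔐.Num} (hf : DF f) : DF (fun a => left (f a)) := left_df.comp hf

theorem DF.right {f : α → 𝔐.Num} (hf : DF f) : DF (fun a => right (f a)) := right_df.comp hf

/-- Uniformization: the least pair of a value and a witness is singled out. -/
theorem S1.uniformize {P : α → 𝔐.Num → Prop} (hP : S1 (fun p : α × 𝔐.Num => P p.1 p.2)) :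
    ∃ H : α → 𝔐.Num → Prop, S1 (fun p : α × 𝔐.Num => H p.1 p.2) ∧ (∀ a x, H a x → P a x) ∧
      (∀ a x y, H a x → H a y → x = y) ∧ ∀ a, (∃ x, P a x) → ∃ x, H a x := by
  obtain ⟨Q, hQ, hPQ⟩ := hP
  have hQ' : D1 (fun p : α × 𝔐.Num => Q ((p.1, left p.2), right p.2)) := by
    have h0 : D1 (fun q : (α × 𝔐.Num) × 𝔐.Num => Q ((q.1.1, q.1.2), q.2)) := hQ.d1
    have key : ∀ R : α → 𝔐.Num → 𝔐.Num → Prop,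
        S1 (fun q : (α × 𝔐.Num) × 𝔐.Num => R q.1.1 q.1.2 q.2) →
        S1 (fun p : α × 𝔐.Num => R p.1 (left p.2) (right p.2)) := by
      intro R hR
      refine S1.subst (P := fun (p : α × 𝔐.Num) x => R p.1 x (right p.2)) ?_ DF.v0.left
      refine S1.subst (P := fun (p : (α × 𝔐.Num) × 𝔐.Num) y => R p.1.1 p.2 y) ?_ DF.v1.right
      exact S1.reindex hR (Reindex.fst (α := α)).succ.succ
    exact ⟨key (fun a x y => Q ((a, x), y)) h0.1, key (fun a x y => ¬ Q ((a, x), y)) h0.2⟩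
  have hmin : D1 (fun p : α × 𝔐.Num => Q ((p.1, left p.2), right p.2) ∧
      ∀ z, z < p.2 → ¬ Q ((p.1, left z), right z)) :=
    hQ'.and (D1.ball (P := fun (p : α × 𝔐.Num) z => ¬ Q ((p.1, left z), right z))
      (D1.lift (P := fun a z => Q ((a, left z), right z)) hQ').not DF.v0)
  refine ⟨fun a x => ∃ z, (Q ((a, left z), right z) ∧
      ∀ w, w < z → ¬ Q ((a, left w), right w)) ∧ x = left z, ?_, ?_, ?_, ?_⟩
  · exact S1.ex (P := fun (p : α × 𝔐.Num) z => (Q ((p.1, left z), right z) ∧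
      ∀ w, w < z → ¬ Q ((p.1, left w), right w)) ∧ p.2 = left z)
      ((D1.lift (P := fun a z => Q ((a, left z), right z) ∧
        ∀ w, w < z → ¬ Q ((a, left w), right w)) hmin).and (D1.eq DF.v1 DF.v0.left)).1
  · rintro a x ⟨z, ⟨hz, -⟩, rfl⟩
    exact (hPQ (a, _)).2 ⟨_, hz⟩
  · rintro a x y ⟨z, ⟨hz, hz'⟩, rfl⟩ ⟨w, ⟨hw, hw'⟩, rfl⟩
    rcases lt_trichotomy z w with h | rfl | h
    · exact absurd hz (hw' _ h)
    · rfl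
    · exact absurd hw (hz' _ h)
  · rintro a ⟨x, hx⟩
    obtain ⟨m, hm⟩ := (hPQ (a, x)).1 hx
    obtain ⟨z, hz, hz'⟩ := (D1.section (P := fun a z => Q ((a, left z), right z)) hQ'
      a).exists_least (n := pair x m) (by simpa only [left_pair, right_pair] using hm)
    exact ⟨_, z, ⟨hz, hz'⟩, rfl⟩

end

/-! ### Codes of finite sets -/

theorem FinMem.lt {i c : 𝔐.Num} (h : FinMem i c) : i < c := by
  obtain ⟨k, m, n, rfl, hi, -⟩ := h
  exact hi.trans_le ((left_le_pair k m).trans (left_le_pair _ _))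

theorem finMem_d1 : D1 (fun p : 𝔐.Num × 𝔐.Num => FinMem p.1 p.2) := by
  have h1 : D1 (fun p : 𝔐.Num × 𝔐.Num => ∃ k, k ≤ p.2 ∧ ∃ m, m ≤ p.2 ∧ ∃ n, n ≤ p.2 ∧
      p.2 = pair (pair k m) n ∧ p.1 < k ∧ ∃ q, q ≤ n ∧ (m * (p.1 + 1) + 1) * q = n) := by_def
  refine h1.congr fun p => ⟨?_, ?_⟩
  · rintro ⟨k, m, n, h, hi, q, hq⟩
    rw [h]
    refine ⟨k, (left_le_pair _ _).trans (left_le_pair _ _), m,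
      (right_le_pair _ _).trans (left_le_pair _ _), n, right_le_pair _ _, rfl, hi, q, ?_, hq⟩
    rw [← hq]
    exact le_mul_of_one_le_left zero_le le_add_self
  · rintro ⟨k, -, m, -, n, -, h, hi, q, -, hq⟩
    exact ⟨k, m, n, h, hi, q, hq⟩

section

variable {α : Type u} [Ctx 𝔐 α]

theorem D1.finMem {f g : α → 𝔐.Num} (hf : DF f) (hg : DF g) : D1 (fun a => FinMem (f a) (g a)) :=
  finMem_d1.comp₂ hf hg

theorem finSub_d1 : D1 (fun p : 𝔐.Num × 𝔐.Num => FinSub p.1 p.2) := by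
  have h0 := finMem_d1 (𝔐 := 𝔐)
  have h1 : D1 (fun p : 𝔐.Num × 𝔐.Num => ∀ i, i < p.1 → FinMem i p.1 → FinMem i p.2) := by_def
  exact h1.congr fun p => ⟨fun h i _ => h i, fun h i hi => h i hi.lt hi⟩

theorem D1.finSubset {G : Set 𝔐.Num} (hG : G ∈ 𝔐.Sets) {f : α → 𝔐.Num} (hf : DF f) :
    D1 (fun a => FinSubset G (f a)) := by
  have h0 := finMem_d1 (𝔐 := 𝔐)
  have h1 : D1 (fun c : 𝔐.Num => ∀ i, i < c → FinMem i c → i ∈ G) := by_def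
  have h2 : D1 (fun c : 𝔐.Num => FinSubset G c) :=
    h1.congr fun p => ⟨fun h i _ => h i, fun h i hi => h i hi.lt hi⟩
  exact h2.comp hf

end

theorem dvd_of_dvd_add_mul {a p x : 𝔐.Num} (ha : 0 < a) (h : a ∣ p + a * x) : a ∣ p := by
  obtain ⟨y, hy⟩ := h
  have hxy : x ≤ y := by
    have : a * x ≤ a * y := hy ▸ le_add_self
    exact le_of_mul_le_mul_left this ha
  obtain ⟨z, rfl⟩ := exists_add_of_le hxy
  refine ⟨z, ?_⟩
  rw [mul_add, add_comm] at hy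
  exact add_left_cancel hy

/-- The moduli `m (i + 1) + 1` are pairwise coprime if `m` is a common multiple. -/
theorem dvd_of_dvd_mul_modulus {m i j n d : 𝔐.Num} (hd : d + 1 ∣ m)
    (hij : j = i + (d + 1) ∨ i = j + (d + 1))
    (h : m * (i + 1) + 1 ∣ n * (m * (j + 1) + 1)) : m * (i + 1) + 1 ∣ n := by
  have ha : 0 < m * (i + 1) + 1 := lt_add_one_iff.2 zero_le
  obtain ⟨t, ht⟩ := hd
  have h1 : m * (i + 1) + 1 ∣ n * m * (d + 1) := by
    rcases hij with rfl | rfl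
    · refine dvd_of_dvd_add_mul (x := n) ha ?_
      convert h using 1
      ring
    · obtain ⟨x, hx⟩ := h
      refine dvd_of_dvd_add_mul (x := x) ha ⟨n, ?_⟩
      rw [← hx]
      ring
  -- with `s = m (i + 1)`, the number `s ^ 2` is congruent to `1` modulo `s + 1`
  refine dvd_of_dvd_add_mul (x := n * (m * (i + 1))) ha ?_
  have h2 : n + (m * (i + 1) + 1) * (n * (m * (i + 1))) =
      n * m * (d + 1) * (t * (i + 1) * (i + 1)) + (m * (i + 1) + 1) * n := by
    have : n * m * (d + 1) * (t * (i + 1) * (i + 1)) =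
      n * m * ((d + 1) * t) * ((i + 1) * (i + 1)) := by ring
    rw [this, ← ht]
    ring
  rw [h2]
  exact dvd_add (h1.mul_right _) (dvd_mul_right _ _)

theorem exists_common_multiple (k : 𝔐.Num) : ∃ m, 0 < m ∧ ∀ i, i < k → i + 1 ∣ m := by
  have h1 : S1 (fun k : 𝔐.Num => ∃ m, 0 < m ∧ ∀ i, i < k → ∃ q, m = (i + 1) * q) := by
    have h2 : S1 (fun k : 𝔐.Num => ∃ m, 0 < m ∧ ∀ i, i < k → ∃ q, q ≤ m ∧ m = (i + 1) * q) :=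
      by_def
    refine h2.congr fun k => exists_congr fun m => and_congr_right fun _ =>
      forall_congr' fun i => imp_congr_right fun _ => exists_congr fun q => ?_
    refine ⟨fun h => ⟨?_, h⟩, And.right⟩
    rw [h]
    exact le_mul_of_one_le_left zero_le le_add_self
  refine h1.induction ⟨1, zero_lt_one, fun i hi => absurd hi (not_lt_zero' i)⟩ ?_ k
  rintro n ⟨m, hm, h⟩
  refine ⟨m * (n + 1), mul_pos hm (lt_add_one_iff.2 zero_le), fun i hi => ?_⟩
  rcases (lt_add_one_iff.1 hi).lt_or_eq with hi | rfl
  · obtain ⟨q, rfl⟩ := h i hi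
    exact ⟨q * (n + 1), by ring⟩
  · exact ⟨m, by ring⟩

/-- Bounded comprehension by codes of finite sets: the number coding the set is the product of the
moduli `m (i + 1) + 1` of its elements `i`, built up by induction. -/
theorem D1.exists_finCode {P : 𝔐.Num → Prop} (hP : D1 P) (k : 𝔐.Num) :
    ∃ c, ∀ i, FinMem i c ↔ i < k ∧ P i := by
  obtain ⟨m, hm, hdvd⟩ := exists_common_multiple k
  have h1 : S1 (fun j : 𝔐.Num => ∃ n, ∀ i, i < k →
      ((∃ q, (m * (i + 1) + 1) * q = n) ↔ i < j ∧ P i)) := by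
    have h2 : S1 (fun j : 𝔐.Num => ∃ n, ∀ i, i < k →
      ((∃ q, q ≤ n ∧ (m * (i + 1) + 1) * q = n) ↔ i < j ∧ P i)) := by_def
    refine h2.congr fun j => exists_congr fun n => forall_congr' fun i => imp_congr_right fun _ =>
      iff_congr (exists_congr fun q => ⟨fun h => ⟨?_, h⟩, And.right⟩) Iff.rfl
    rw [← h]
    exact le_mul_of_one_le_left zero_le le_add_self
  obtain ⟨n, hn⟩ := h1.induction (by
    refine ⟨1, fun i _ => ⟨fun ⟨q, hq⟩ => ?_, fun h => absurd h.1 (not_lt_zero' i)⟩⟩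
    have hq1 : 1 ≤ q := by
      by_contra! hq0
      obtain rfl : q = 0 := by
        rw [← zero_add (1 : 𝔐.Num), lt_add_one_iff] at hq0
        exact le_antisymm hq0 zero_le
      rw [mul_zero] at hq
      exact zero_ne_one hq
    have h3 : 0 < m * (i + 1) := mul_pos hm (lt_add_one_iff.2 zero_le)
    have h4 : m * (i + 1) + 1 ≤ 1 := (le_mul_of_one_le_right zero_le hq1).trans_eq hq
    have h5 : m * (i + 1) + 1 ≤ 0 + 1 := by rwa [zero_add]
    exact absurd (le_of_add_le_add_right h5) h3.not_ge) (fun j ⟨n, hn⟩ => by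
    by_cases hj : j < k ∧ P j
    · refine ⟨n * (m * (j + 1) + 1), fun i hi => ?_⟩
      rcases lt_trichotomy i j with h | rfl | h
      · obtain ⟨d, rfl⟩ := lt_iff_exists_add_one.1 h
        have hd : d + 1 ∣ m := hdvd d (lt_of_lt_of_le (lt_add_one_iff.2 le_add_self)
          (by rw [add_assoc]; exact hj.1.le))
        rw [lt_add_one_iff, le_iff_lt_or_eq, or_iff_left h.ne, ← hn i hi]
        refine ⟨fun ⟨q, hq⟩ => ?_, fun ⟨q, hq⟩ => ⟨q * (m * (i + (d + 1) + 1) + 1), ?_⟩⟩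
        · obtain ⟨q', hq'⟩ := dvd_of_dvd_mul_modulus hd (Or.inl rfl) ⟨q, hq.symm⟩
          exact ⟨q', hq'.symm⟩
        · rw [← mul_assoc, hq]
      · exact ⟨fun _ => ⟨lt_add_one_iff.2 le_rfl, hj.2⟩, fun _ => ⟨n, mul_comm _ _⟩⟩
      · obtain ⟨d, rfl⟩ := lt_iff_exists_add_one.1 h
        have hd : d + 1 ∣ m := hdvd d (lt_of_lt_of_le (lt_add_one_iff.2 le_add_self)
          (by rw [add_assoc]; exact hi.le))
        have hne : ¬ j + (d + 1) < j + 1 := fun h' => h.not_ge (lt_add_one_iff.1 h')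
        have hh := hn _ hi
        rw [iff_false_right (fun h' => h.not_gt h'.1)] at hh
        rw [iff_false_right (fun h' => hne h'.1)]
        rintro ⟨q, hq⟩
        obtain ⟨q', hq'⟩ := dvd_of_dvd_mul_modulus hd (Or.inr rfl) ⟨q, hq.symm⟩
        exact hh ⟨q', hq'.symm⟩
    · refine ⟨n, fun i hi => ?_⟩
      rw [hn i hi, lt_add_one_iff, le_iff_lt_or_eq]
      refine and_congr_left fun hPi => ⟨Or.inl, fun h => h.resolve_right fun h => hj ?_⟩
      exact h ▸ ⟨hi, hPi⟩) k
  refine ⟨pair (pair k m) n, fun i => ⟨?_, fun hi => ?_⟩⟩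
  · rintro ⟨k', m', n', h, hi, hq⟩
    obtain ⟨h', rfl⟩ := pair_inj.1 h
    obtain ⟨rfl, rfl⟩ := pair_inj.1 h'
    exact (hn i hi).1 hq
  · exact ⟨k, m, n, rfl, hi.1, (hn i hi.1).2 hi⟩

theorem D1.exists_finCode_fun {α : Type u} [Ctx 𝔐 α] {P : α → 𝔐.Num → Prop}
    (hP : D1 (fun p : α × 𝔐.Num => P p.1 p.2)) {b : α → 𝔐.Num} (hb : DF b) :
    ∃ f : α → 𝔐.Num, DF f ∧ ∀ a i, FinMem i (f a) ↔ i < b a ∧ P a i := by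
  have h1 : D1 (fun p : α × 𝔐.Num => (∀ i, i < b p.1 → (FinMem i p.2 ↔ P p.1 i)) ∧
      ∀ i, i < p.2 → FinMem i p.2 → i < b p.1) := by
    refine D1.and (D1.ball ((D1.finMem DF.v0 DF.v1).iff hP.lift) hb.fst)
      (D1.ball ((D1.finMem DF.v0 DF.v1).imp (D1.lt DF.v0 hb.fst.fst)) DF.v0)
  obtain ⟨f, hf, h⟩ := D1.exists_min (P := fun a c => (∀ i, i < b a → (FinMem i c ↔ P a i)) ∧
      ∀ i, i < c → FinMem i c → i < b a) h1 fun a => by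
    obtain ⟨c, hc⟩ := (hP.section a).exists_finCode (b a)
    exact ⟨c, fun i hi => by rw [hc, and_iff_right hi], fun i _ hi => ((hc i).1 hi).1⟩
  refine ⟨f, hf, fun a i => ⟨fun hi => ?_, fun hi => ((h a).1.1 i hi.1).2 hi.2⟩⟩
  have := (h a).1.2 i hi.lt hi
  exact ⟨this, ((h a).1.1 i this).1 hi⟩

/-! ### Recursion -/

/-- Dependent choice along a `Σ⁰₁` relation `R`, with a `Σ⁰₁` invariant `A`. -/
theorem S1.exists_seq {A : 𝔐.Num → 𝔐.Num → Prop} {R : 𝔐.Num → 𝔐.Num → 𝔐.Num → Prop}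
    (hA : S1 (fun p : 𝔐.Num × 𝔐.Num => A p.1 p.2))
    (hR : S1 (fun p : (𝔐.Num × 𝔐.Num) × 𝔐.Num => R p.1.1 p.1.2 p.2)) {x₀ : 𝔐.Num} (h0 : A 0 x₀)
    (hs₁ : ∀ n x, A n x → ∃ y, A (n + 1) y ∧ R n x y) :
    ∃ f : 𝔐.Num → 𝔐.Num, DF f ∧ f 0 = x₀ ∧ ∀ n, A n (f n) ∧ R n (f n) (f (n + 1)) := by
  obtain ⟨H', hH', hHR', huniq', hex'⟩ := S1.uniformize
    (P := fun (a : 𝔐.Num × 𝔐.Num) y => A (a.1 + 1) y ∧ R a.1 a.2 y) by_def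
  obtain ⟨H, rfl⟩ : ∃ H : 𝔐.Num → 𝔐.Num → 𝔐.Num → Prop, H' = fun a y => H a.1 a.2 y :=
    ⟨fun n x y => H' (n, x) y, rfl⟩
  -- every pair in `s` is the start or is justified by a pair in `s`
  obtain ⟨T, hTdef⟩ : ∃ T : 𝔐.Num → Prop, ∀ s, T s ↔ ∀ i, i < s → ∀ y, y < s →
      FinMem (pair i y) s → i = 0 ∧ y = x₀ ∨
        ∃ j, j < s ∧ ∃ x, x < s ∧ i = j + 1 ∧ FinMem (pair j x) s ∧ H j x y :=
    ⟨_, fun _ => Iff.rfl⟩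
  have hf := finMem_d1 (𝔐 := 𝔐)
  have hT : S1 T := by
    have h1 : S1 (fun s : 𝔐.Num => ∀ i, i < s → ∀ y, y < s → (¬ FinMem (pair i y) s ∨
      (i = 0 ∧ y = x₀ ∨ ∃ j, j < s ∧ ∃ x, x < s ∧ i = j + 1 ∧ FinMem (pair j x) s ∧ H j x y))) :=
      by_def
    exact h1.congr fun s => by simp only [hTdef, imp_iff_not_or]
  have hT' : ∀ s i y, T s → FinMem (pair i y) s →
      i = 0 ∧ y = x₀ ∨ ∃ j x, i = j + 1 ∧ FinMem (pair j x) s ∧ H j x y := by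
    intro s i y hs h
    rcases (hTdef s).1 hs i ((left_le_pair _ _).trans_lt h.lt) y
      ((right_le_pair _ _).trans_lt h.lt) h with h | h
    · exact Or.inl h
    · obtain ⟨j, -, x, -, h⟩ := h
      exact Or.inr ⟨j, x, h⟩
  have huniq : ∀ s t, T s → T t → ∀ n y z, FinMem (pair n y) s → FinMem (pair n z) t → y = z := by
    intro s t hs ht n
    suffices ∀ y, y < s → ∀ z, z < t → FinMem (pair n y) s → FinMem (pair n z) t → y = z from
      fun y z hy hz => this y ((right_le_pair _ _).trans_lt hy.lt) z
        ((right_le_pair _ _).trans_lt hz.lt) hy hz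
    refine D1.induction (P := fun n => ∀ y, y < s → ∀ z, z < t → FinMem (pair n y) s →
      FinMem (pair n z) t → y = z) by_def ?_ ?_ n
    · intro y _ z _ hy hz
      rcases hT' s _ _ hs hy with ⟨-, rfl⟩ | ⟨j, _, h, -⟩
      · rcases hT' t _ _ ht hz with ⟨-, rfl⟩ | ⟨j, _, h, -⟩
        · rfl
        · exact absurd h.symm (hM.rca.succ_ne_zero j)
      · exact absurd h.symm (hM.rca.succ_ne_zero j)
    · intro n ih y _ z _ hy hz
      rcases hT' s _ _ hs hy with ⟨h, -⟩ | ⟨j, x, h, hx, hxy⟩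
      · exact absurd h (hM.rca.succ_ne_zero n)
      rcases hT' t _ _ ht hz with ⟨h', -⟩ | ⟨j', x', h', hx', hxz⟩
      · exact absurd h' (hM.rca.succ_ne_zero n)
      obtain rfl := hM.rca.succ_inj _ _ h
      obtain rfl := hM.rca.succ_inj _ _ h'
      obtain rfl := ih x ((right_le_pair _ _).trans_lt hx.lt) x'
        ((right_le_pair _ _).trans_lt hx'.lt) hx hx'
      exact huniq' (n, x) _ _ hxy hxz
  have hex : ∀ n, ∃ y, (∃ s, T s ∧ FinMem (pair n y) s) ∧ A n y := by
    refine S1.induction (P := fun n => ∃ y, (∃ s, T s ∧ FinMem (pair n y) s) ∧ A n y) by_def ?_ ?_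
    · obtain ⟨s, hs⟩ := D1.exists_finCode (P := fun z : 𝔐.Num => z = pair 0 x₀) by_def
        (pair 0 x₀ + 1)
      refine ⟨x₀, ⟨s, (hTdef s).2 fun i _ y _ hiy => Or.inl ?_,
        (hs _).2 ⟨lt_add_one_iff.2 le_rfl, rfl⟩⟩, h0⟩
      exact pair_inj.1 ((hs _).1 hiy).2
    · rintro n ⟨y, ⟨s, hs, hny⟩, hAy⟩
      obtain ⟨y', hH⟩ := hex' (n, y) (hs₁ n y hAy)
      obtain ⟨s', hs'⟩ := D1.exists_finCode (P := fun z => FinMem z s ∨ z = pair (n + 1) y') by_def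
        (s + (pair (n + 1) y' + 1))
      have hmem : ∀ z, FinMem z s' ↔ FinMem z s ∨ z = pair (n + 1) y' := fun z => by
        rw [hs', and_iff_right_iff_imp]
        rintro (h | rfl)
        · exact h.lt.trans_le le_self_add
        · exact (lt_add_one_iff.2 le_rfl).trans_le le_add_self
      refine ⟨y', ⟨s', (hTdef s').2 fun i _ z _ hiz => ?_, (hmem _).2 (Or.inr rfl)⟩,
        (hHR' _ _ hH).1⟩
      have hjust : ∀ j x, FinMem (pair j x) s → i = j + 1 → H j x z → ∃ j, j < s' ∧ ∃ x, x < s' ∧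
          i = j + 1 ∧ FinMem (pair j x) s' ∧ H j x z := fun j x h hi hjx =>
        have h' := (hmem _).2 (Or.inl h)
        ⟨j, (left_le_pair _ _).trans_lt h'.lt, x, (right_le_pair _ _).trans_lt h'.lt, hi, h', hjx⟩
      rcases (hmem _).1 hiz with h | h
      · rcases hT' s _ _ hs h with h | ⟨j, x, hi, hjx, hH'⟩
        · exact Or.inl h
        · exact Or.inr (hjust j x hjx hi hH')
      · obtain ⟨rfl, rfl⟩ := pair_inj.1 h
        exact Or.inr (hjust n y hny rfl hH)
  choose f hfT hfA using hex
  have hgraph : ∀ n y, (∃ s, T s ∧ FinMem (pair n y) s) → y = f n := by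
    rintro n y ⟨s, hs, hy⟩
    obtain ⟨t, ht, hy'⟩ := hfT n
    exact huniq s t hs ht n _ _ hy hy'
  refine ⟨f, ?_, ?_, fun n => ⟨hfA n, ?_⟩⟩
  · have h1 : S1 (fun p : 𝔐.Num × 𝔐.Num => ∃ s, T s ∧ FinMem (pair p.1 p.2) s) := by_def
    exact h1.congr fun p => ⟨fun h => h ▸ hfT p.1, hgraph _ _⟩
  · obtain ⟨s, hs, h⟩ := hfT 0
    rcases hT' s _ _ hs h with ⟨-, h⟩ | ⟨j, x, h, -⟩
    · exact h
    · exact absurd h.symm (hM.rca.succ_ne_zero j)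
  · obtain ⟨s, hs, h⟩ := hfT (n + 1)
    rcases hT' s _ _ hs h with ⟨h, -⟩ | ⟨j, x, hj, hx, hxy⟩
    · exact absurd h (hM.rca.succ_ne_zero n)
    obtain rfl := hM.rca.succ_inj _ _ hj
    rw [hgraph _ _ ⟨s, hs, hx⟩] at hxy
    exact (hHR' (n, f n) _ hxy).2

end

section

variable {𝔐 : L2Structure.{u}}

/-! ### Points of `𝒫(ℕ)` and presentations by frames -/

/-- Two spaces are homeomorphic if two codes define, on points, the same relation and its inverse,
and if this relation is total on both sides. -/
theorem Homeomorphic.of_rel {X Y : Space 𝔐} {Φ Ψ : Set 𝔐.Num} (hΦ : Φ ∈ 𝔐.Sets)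
    (hΨ : Ψ ∈ 𝔐.Sets) (rel : (𝔐.Num → 𝔐.Num) → (𝔐.Num → 𝔐.Num) → Prop)
    (h : ∀ x y, X.IsPoint x → Y.IsPoint y → (MapsTo X Y Φ x y ↔ rel x y))
    (h' : ∀ x y, X.IsPoint x → Y.IsPoint y → (MapsTo Y X Ψ y x ↔ rel x y))
    (hX : ∀ x, X.IsPoint x → ∃ y, Y.IsPoint y ∧ rel x y)
    (hY : ∀ y, Y.IsPoint y → ∃ x, X.IsPoint x ∧ rel x y) : Homeomorphic X Y := by
  refine ⟨Φ, hΦ, Ψ, hΨ, fun x hx => ?_, fun y hy => ?_, fun x y hx hy => ?_, fun x y hx hy => ?_⟩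
  · obtain ⟨y, hy, hxy⟩ := hX x hx
    exact ⟨y, hy, (h x y hx hy).2 hxy⟩
  · obtain ⟨x, hx, hxy⟩ := hY y hy
    exact ⟨x, hx, (h' x y hx hy).2 hxy⟩
  · rw [h x y hx hy, h' x y hx hy]
    exact _root_.id
  · rw [h x y hx hy, h' x y hx hy]
    exact _root_.id

theorem FinSub.refl (c : 𝔐.Num) : FinSub c c := fun _ h => h

theorem FinSub.trans {c d e : 𝔐.Num} (h : FinSub c d) (h' : FinSub d e) : FinSub c e :=
  fun i hi => h' i (h i hi)

variable [hM : Model 𝔐]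

theorem coded_iff {f : 𝔐.Num → 𝔐.Num} : Coded f ↔ DF f := by
  refine ⟨fun h => ?_, fun h => ?_⟩
  · have h1 : D1 (fun p : 𝔐.Num × 𝔐.Num => pair p.1 p.2 ∈ {z | ∃ n, z = pair n (f n)}) :=
      D1.mem h by_def
    refine h1.1.congr fun p => ⟨fun h => ⟨p.1, by rw [h]⟩, fun ⟨n, hn⟩ => ?_⟩
    obtain ⟨rfl, h⟩ := pair_inj.1 hn
    exact h
  · have h1 : D1 (fun z : 𝔐.Num => ∃ n, n ≤ z ∧ z = pair n (f n)) := by_def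
    refine (h1.congr fun z => ?_).mem_sets
    refine exists_congr fun n => ⟨fun h => ⟨?_, h⟩, And.right⟩
    rw [h]
    exact left_le_pair _ _

theorem coded₂_iff {f : 𝔐.Num → 𝔐.Num → 𝔐.Num} :
    Coded₂ f ↔ DF (fun p : 𝔐.Num × 𝔐.Num => f p.1 p.2) := by
  refine ⟨fun h => ?_, fun h => ?_⟩
  · have h1 : D1 (fun p : (𝔐.Num × 𝔐.Num) × 𝔐.Num => pair (pair p.1.1 p.1.2) p.2 ∈
        {z | ∃ i n, z = pair (pair i n) (f i n)}) := D1.mem h by_def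
    refine h1.1.congr fun p => ⟨fun h => ⟨p.1.1, p.1.2, by rw [h]⟩, fun ⟨i, n, hn⟩ => ?_⟩
    obtain ⟨h1, h2⟩ := pair_inj.1 hn
    obtain ⟨h3, h4⟩ := pair_inj.1 h1
    rw [h2, ← h3, ← h4]
  · have h1 : D1 (fun z : 𝔐.Num => ∃ i, i ≤ z ∧ ∃ n, n ≤ z ∧ z = pair (pair i n) (f i n)) := by_def
    refine (h1.congr fun z => ⟨?_, ?_⟩).mem_sets
    · rintro ⟨i, n, rfl⟩
      exact ⟨i, (left_le_pair _ _).trans (left_le_pair _ _), n,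
        (right_le_pair _ _).trans (left_le_pair _ _), rfl⟩
    · rintro ⟨i, -, n, -, h⟩
      exact ⟨i, n, h⟩

/-- The set represented by a sequence of codes of finite sets. -/
def union (x : 𝔐.Num → 𝔐.Num) : Set 𝔐.Num := {n | ∃ i, FinMem n (x i)}

/-- The set `S` lies in the open set of all sets that include a term of the expression `a`. -/
def OpenMem (S : Set 𝔐.Num) (a : 𝔐.Num → 𝔐.Num) : Prop := ∃ j q, a j = q + 1 ∧ FinSubset S q

/-- A coded increasing sequence of finite sets. -/
structure IsIncreasing (x : 𝔐.Num → 𝔐.Num) : Prop where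
  df : DF x
  mono : ∀ i j, i ≤ j → FinSub (x i) (x j)

theorem IsIncreasing.of_succ {x : 𝔐.Num → 𝔐.Num} (hx : Coded x)
    (h : ∀ i, FinSub (x i) (x (i + 1))) : IsIncreasing x := by
  have hx := coded_iff.1 hx
  refine ⟨hx, fun i j hij => ?_⟩
  obtain ⟨k, rfl⟩ := exists_add_of_le hij
  have h0 := finSub_d1 (𝔐 := 𝔐)
  refine D1.induction (P := fun k => FinSub (x i) (x (i + k))) by_def ?_ (fun k hk => ?_) k
  · rw [add_zero]
    exact FinSub.refl _
  · rw [← add_assoc]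
    exact hk.trans (h _)

theorem IsIncreasing.of_isPoint {x : 𝔐.Num → 𝔐.Num} (hx : (powerSpace 𝔐).IsPoint x) :
    IsIncreasing x := by
  refine ⟨coded_iff.1 hx.1, fun i j hij => ?_⟩
  rcases hij.lt_or_eq with h | rfl
  · exact hx.2.2 i j h
  · exact FinSub.refl _

/-- A finite subset of the represented set is included in one of the finite sets. -/
theorem IsIncreasing.exists_finSub_iff {x : 𝔐.Num → 𝔐.Num} (hx : IsIncreasing x) {c : 𝔐.Num} :
    (∃ i, FinSub c (x i)) ↔ FinSubset (union x) c := by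
  refine ⟨fun ⟨i, hi⟩ n hn => ⟨i, hi n hn⟩, fun h => ?_⟩
  have h0 := finMem_d1 (𝔐 := 𝔐)
  have h1 := hx.df
  obtain ⟨i, hi⟩ := S1.induction
    (P := fun k => ∃ i, ∀ n, n < k → FinMem n c → FinMem n (x i)) by_def
    ⟨0, fun n hn => absurd hn (not_lt_zero' n)⟩ (fun k ⟨i, hi⟩ => by
      by_cases hk : FinMem k c
      · obtain ⟨j, hj⟩ := h k hk
        refine ⟨max i j, fun n hn hnc => ?_⟩
        rcases (lt_add_one_iff.1 hn).lt_or_eq with hn | rfl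
        · exact hx.mono _ _ (le_max_left _ _) _ (hi n hn hnc)
        · exact hx.mono _ _ (le_max_right _ _) _ hj
      · refine ⟨i, fun n hn hnc => ?_⟩
        rcases (lt_add_one_iff.1 hn).lt_or_eq with hn | rfl
        · exact hi n hn hnc
        · exact absurd hnc hk) c
  exact ⟨i, fun n hn => hi n hn.lt hn⟩

theorem IsIncreasing.exists_finLe_iff {x : 𝔐.Num → 𝔐.Num} (hx : IsIncreasing x)
    {a : 𝔐.Num → 𝔐.Num} : (∃ k, FinLe (x k) a) ↔ OpenMem (union x) a := by
  constructor
  · rintro ⟨k, j, q, h, hq⟩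
    exact ⟨j, q, h, hx.exists_finSub_iff.1 ⟨k, hq⟩⟩
  · rintro ⟨j, q, h, hq⟩
    obtain ⟨k, hk⟩ := hx.exists_finSub_iff.2 hq
    exact ⟨k, j, q, h, hk⟩

theorem powerSpace_mem_iff {x : 𝔐.Num → 𝔐.Num} (hx : (powerSpace 𝔐).IsPoint x) {c : 𝔐.Num} :
    (powerSpace 𝔐).Mem x c ↔ FinSubset (union x) c :=
  (IsIncreasing.of_isPoint hx).exists_finSub_iff

/-- Every `Σ⁰₁` class of numbers is represented by a point of `𝒫(ℕ)`. -/
theorem S1.exists_powerSpace_point {W : 𝔐.Num → Prop} (hW : S1 W) :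
    ∃ x, (powerSpace 𝔐).IsPoint x ∧ ∀ n, n ∈ union x ↔ W n := by
  obtain ⟨Q, hQ, hWQ⟩ := hW
  have hQ' : D1 (fun p : 𝔐.Num × 𝔐.Num => Q (p.1, p.2)) := hQ.d1
  obtain ⟨R, rfl⟩ : ∃ R : 𝔐.Num → 𝔐.Num → Prop, Q = fun p => R p.1 p.2 :=
    ⟨fun a b => Q (a, b), rfl⟩
  obtain ⟨x, hx, hmem⟩ := D1.exists_finCode_fun (α := 𝔐.Num) (P := fun i n => ∃ m, m ≤ i ∧ R n m)
    (b := fun i => i + 1) by_def by_def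
  refine ⟨x, ⟨coded_iff.2 hx, fun i n hn => ?_, fun i j hij n hn => ?_⟩, fun n => ?_⟩
  · exact lt_add_one_iff.1 ((hmem i n).1 hn).1
  · rw [hmem] at hn ⊢
    obtain ⟨hni, m, hm, hR⟩ := hn
    exact ⟨hni.trans (by gcongr), m, hm.trans hij.le, hR⟩
  · rw [hWQ]
    refine ⟨fun ⟨i, hi⟩ => ?_, fun ⟨m, hm⟩ => ⟨max n m, (hmem _ _).2
      ⟨lt_add_one_iff.2 (le_max_left _ _), m, le_max_right _ _, hm⟩⟩⟩
    obtain ⟨-, m, -, hm⟩ := (hmem i n).1 hi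
    exact ⟨m, hm⟩

theorem exists_singleton (n : 𝔐.Num) : ∃ c, ∀ i, FinMem i c ↔ i = n := by
  obtain ⟨c, hc⟩ := D1.exists_finCode (P := fun i => i = n) by_def (n + 1)
  refine ⟨c, fun i => (hc i).trans (and_iff_right_of_imp ?_)⟩
  rintro rfl
  exact lt_add_one_iff.2 le_rfl

theorem eq_of_finSubset_iff {S T H : Set 𝔐.Num} (hS : S ⊆ H) (hT : T ⊆ H)
    (h : ∀ c, FinSubset H c → (FinSubset S c ↔ FinSubset T c)) : S = T := by
  have key : ∀ n, n ∈ H → (n ∈ S ↔ n ∈ T) := fun n hn => by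
    obtain ⟨c, hc⟩ := exists_singleton n
    simpa only [FinSubset, hc, forall_eq] using h c fun i hi => (hc i).1 hi ▸ hn
  ext n
  exact ⟨fun hn => (key n (hS hn)).1 hn, fun hn => (key n (hT hn)).2 hn⟩

namespace FrameCode

variable (F : FrameCode 𝔐)

theorem isIncreasing {p : 𝔐.Num → 𝔐.Num} (hp : F.IsFinSeq p) : IsIncreasing p :=
  .of_succ hp.1 hp.2.2

theorem isPoint_iff {p : 𝔐.Num → 𝔐.Num} : F.ptSpace.IsPoint p ↔ F.IsFinSeq p ∧
    ∀ j, OpenMem (union p) (F.u j) → OpenMem (union p) (F.v j) := by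
  refine and_congr_right fun hp => ?_
  simp only [(F.isIncreasing hp).exists_finLe_iff]

theorem isFinSeq_iff {p : 𝔐.Num → 𝔐.Num} :
    F.IsFinSeq p ↔ IsIncreasing p ∧ union p ⊆ F.G := by
  constructor
  · intro hp
    refine ⟨F.isIncreasing hp, ?_⟩
    rintro n ⟨i, hi⟩
    exact hp.2.1 i n hi
  · rintro ⟨hp, hG⟩
    exact ⟨coded_iff.2 hp.df, fun i n hn => hG ⟨i, hn⟩, fun i => hp.mono _ _ le_self_add⟩

/-- The finite meets together with the expressions in `R`: the least generating pair. -/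
theorem exists_generates : ∃ w L, F.Generates w L ∧ ∀ k l, pair k l ∈ L →
    k = l ∨ ∃ j, w k = F.u j ∧ w l = F.v j := by
  classical
  have hu := coded₂_iff.1 F.u_coded
  have hv := coded₂_iff.1 F.v_coded
  have hne : (1 : 𝔐.Num) ≠ 0 := one_ne_zero
  have hne' : (2 : 𝔐.Num) ≠ 0 := two_ne_zero
  have hne'' : (2 : 𝔐.Num) ≠ 1 := (one_lt_two).ne'
  let w : 𝔐.Num → 𝔐.Num → 𝔐.Num := fun i n =>
    if left i = 0 then (if FinSubset F.G (right i) then right i + 1 else 0)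
    else if left i = 1 then F.u (right i) n else F.v (right i) n
  have hw1 : ∀ j, w (pair 1 j) = F.u j := fun j => by
    funext n
    simp only [w, left_pair, right_pair, if_neg hne, if_true]
  have hw2 : ∀ j, w (pair 2 j) = F.v j := fun j => by
    funext n
    simp only [w, left_pair, right_pair, if_neg hne', if_neg hne'']
  have hL : D1 (fun z : 𝔐.Num =>
      left z = right z ∨ ∃ j, j ≤ z ∧ z = pair (pair 1 j) (pair 2 j)) := by
    have h1 := left_df (𝔐 := 𝔐)
    have h2 := right_df (𝔐 := 𝔐)
    exact by_def
  refine ⟨w, _, ⟨coded₂_iff.2 ?_, hL.mem_sets, fun i => ?_, fun p hp => ?_, fun j => ?_,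
    fun i => ?_⟩, fun k l hkl => ?_⟩
  · exact DF.ite (D1.eq DF.w1.left (DF.const 0))
      (DF.ite (D1.finSubset F.G_mem DF.w1.right) (DF.w1.right.add (DF.const 1)) (DF.const 0))
      (DF.ite (D1.eq DF.w1.left (DF.const 1)) (DF.comp₂ hu DF.w1.right DF.v0)
        (DF.comp₂ hv DF.w1.right DF.v0))
  · by_cases h0 : left i = 0
    · by_cases hp : FinSubset F.G (right i)
      · have : w i = fun _ => right i + 1 := by funext n; simp only [w, if_pos h0, if_pos hp]
        rw [this]
        exact ⟨coded_iff.2 (DF.const _), fun _ => Or.inr ⟨_, rfl, hp⟩⟩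
      · have : w i = fun _ => 0 := by funext n; simp only [w, if_pos h0, if_neg hp]
        rw [this]
        exact ⟨coded_iff.2 (DF.const _), fun _ => Or.inl rfl⟩
    · by_cases h1 : left i = 1
      · have : w i = F.u (right i) := by funext n; simp only [w, if_neg h0, if_pos h1]
        rw [this]
        exact F.u_expr _
      · have : w i = F.v (right i) := by funext n; simp only [w, if_neg h0, if_neg h1]
        rw [this]
        exact F.v_expr _
  · exact ⟨pair 0 p, fun n => by simp only [w, left_pair, right_pair, if_true, if_pos hp]⟩
  · exact ⟨_, _, hw1 j, hw2 j, Or.inr ⟨j, (right_le_pair 1 j).trans (left_le_pair _ _), rfl⟩⟩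
  · exact Or.inl (by rw [left_pair, right_pair])
  · rcases hkl with h | ⟨j, -, h⟩
    · rw [left_pair, right_pair] at h
      exact Or.inl h
    · obtain ⟨rfl, rfl⟩ := pair_inj.1 h
      exact Or.inr ⟨j, hw1 j, hw2 j⟩

theorem openMem_of_finLe {p : 𝔐.Num → 𝔐.Num} {a : 𝔐.Num → 𝔐.Num} {i : 𝔐.Num}
    (h : FinLe (p i) a) : OpenMem (union p) a := by
  obtain ⟨j, q, haj, hq⟩ := h
  exact ⟨j, q, haj, fun n hn => ⟨i, hq n hn⟩⟩

theorem openMem_of_exprLe {S : Set 𝔐.Num} {a b : 𝔐.Num → 𝔐.Num} (h : ExprLe a b)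
    (ha : OpenMem S a) : OpenMem S b := by
  obtain ⟨j, q, haj, hq⟩ := ha
  obtain ⟨k, r, hbk, hr⟩ := h j q haj
  exact ⟨k, r, hbk, fun n hn => hq n (hr n hn)⟩

/-- The least congruence preorder is spatial: a point respects the generating pair that consists of
the finite meets and the relations, and conversely a sequence that respects any generating pair is
a point. -/
theorem prec_iff_ptLe {a b : 𝔐.Num → 𝔐.Num} (hb : IsExpr F.G b) : F.Prec a b ↔ F.PtLe a b := by
  constructor
  · rintro h p hp ⟨k, hk⟩
    obtain ⟨w, L, hgen, hL⟩ := F.exists_generates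
    obtain ⟨hseq, hR⟩ := F.isPoint_iff.1 hp
    obtain ⟨hinc, hG⟩ := F.isFinSeq_iff.1 hseq
    -- the tail of `p` that starts below `a`
    let p' : 𝔐.Num → 𝔐.Num := fun i => p (k + i)
    have hdf := hinc.df
    have hinc' : IsIncreasing p' :=
      ⟨by_def, fun i j hij => hinc.mono _ _ (by gcongr)⟩
    have hun : union p' = union p := by
      ext n
      refine ⟨fun ⟨i, hi⟩ => ⟨_, hi⟩, fun ⟨i, hi⟩ => ⟨i, hinc.mono _ _ le_add_self _ hi⟩⟩
    have hseq' : F.IsFinSeq p' := F.isFinSeq_iff.2 ⟨hinc', hun ▸ hG⟩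
    have hle : ∀ c d, pair c d ∈ L → OpenMem (union p') (w c) → OpenMem (union p') (w d) := by
      intro c d hcd hc
      rcases hL c d hcd with rfl | ⟨j, hj, hj'⟩
      · exact hc
      · rw [hj', hun]
        rw [hj, hun] at hc
        exact hR j hc
    obtain ⟨i, c, d, hic, hcd, hdb⟩ := h w L hgen p'
      ⟨hseq', fun c d hcd i hi => hinc'.exists_finLe_iff.2 (hle c d hcd (openMem_of_finLe hi))⟩
      (by simpa only [p', add_zero] using hk)
    rw [hinc.exists_finLe_iff, ← hun]
    exact openMem_of_exprLe hdb (hle c d hcd (openMem_of_finLe hic))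
  · intro h w L hgen p hp ha
    have hpt : F.ptSpace.IsPoint p := by
      refine ⟨hp.1, fun j ⟨k, hk⟩ => ?_⟩
      obtain ⟨c, d, hc, hd, hcd⟩ := hgen.rel_mem j
      rw [← hc] at hk
      rw [← hd]
      exact hp.2 c d hcd k hk
    obtain ⟨i, j, q, hbj, hq⟩ := h p hpt ⟨0, ha⟩
    have hqG : FinSubset F.G q := by
      rcases hb.2 j with h0 | ⟨c, hc, hcG⟩
      · rw [hbj] at h0
        exact absurd h0 (hM.rca.succ_ne_zero q)
      · obtain rfl := hM.rca.succ_inj _ _ (hbj.symm.trans hc)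
        exact hcG
    obtain ⟨c, hc⟩ := hgen.fin_mem q hqG
    refine ⟨i, c, c, ⟨0, q, hc 0, hq⟩, hgen.refl c, fun k r hr => ?_⟩
    rw [hc k] at hr
    obtain rfl := hM.rca.succ_inj _ _ hr
    exact ⟨j, q, hbj, FinSub.refl q⟩

/-- A `Π⁰₂`-subspace is presented by `⟨G; R⟩` if its points represent the same sets as the points
of `⟨G; R⟩`. -/
theorem presents_of_points {X : Pi02Code 𝔐}
    (hX : ∀ x, (powerSpace 𝔐).IsPoint x → (X.space.IsPoint x ↔ union x ⊆ F.G ∧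
      ∀ j, OpenMem (union x) (F.u j) → OpenMem (union x) (F.v j))) :
    F.Presents X.space := by
  have hXp : ∀ x, X.space.IsPoint x → (powerSpace 𝔐).IsPoint x := fun x hx => hx.1
  have hpt : ∀ x, X.space.IsPoint x → F.ptSpace.IsPoint x := fun x hx => by
    obtain ⟨h1, h2⟩ := (hX x (hXp x hx)).1 hx
    exact F.isPoint_iff.2 ⟨F.isFinSeq_iff.2 ⟨.of_isPoint (hXp x hx), h1⟩, h2⟩
  have hpt' : ∀ p, F.ptSpace.IsPoint p → ∃ x, X.space.IsPoint x ∧ union p = union x := by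
    intro p hp
    obtain ⟨hseq, hR⟩ := F.isPoint_iff.1 hp
    obtain ⟨hinc, hG⟩ := F.isFinSeq_iff.1 hseq
    have h0 := finMem_d1 (𝔐 := 𝔐)
    have h1 := hinc.df
    obtain ⟨x, hx, hun⟩ := S1.exists_powerSpace_point (W := fun n => ∃ i, FinMem n (p i)) by_def
    have hun : union p = union x := Set.ext fun n => (hun n).symm
    exact ⟨x, (hX x hx).2 ⟨hun ▸ hG, hun ▸ hR⟩, hun⟩
  have hmem : ∀ x, X.space.IsPoint x → ∀ c, X.space.Mem x c ↔ FinSubset (union x) c :=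
    fun x hx c => powerSpace_mem_iff (hXp x hx)
  have hmem' : ∀ p, F.ptSpace.IsPoint p → ∀ c, F.ptSpace.Mem p c ↔ FinSubset (union p) c :=
    fun p hp c => (F.isIncreasing hp.1).exists_finSub_iff
  have hG : ∀ p, F.ptSpace.IsPoint p → union p ⊆ F.G := fun p hp => (F.isFinSeq_iff.1 hp.1).2
  have hfin := finMem_d1 (𝔐 := 𝔐)
  have hsub := finSub_d1 (𝔐 := 𝔐)
  have hspatial : F.SpatialWith F.PtLe X.space := by
    have hU : D1 (fun z : 𝔐.Num => ∃ g, g ≤ z ∧ ∃ w, w ≤ z ∧ z = pair g (pair 0 w) ∧ FinMem g w) :=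
      by_def
    have hopen : ∀ x, X.space.IsPoint x → ∀ g, X.space.MemOpen x {z | pair g z ∈
        {z | ∃ g, g ≤ z ∧ ∃ w, w ≤ z ∧ z = pair g (pair 0 w) ∧ FinMem g w}} ↔ g ∈ union x := by
      intro x hx g
      constructor
      · rintro ⟨n, w, ⟨g', -, w', -, h, hg⟩, -, hw⟩
        obtain ⟨rfl, h'⟩ := pair_inj.1 h
        obtain ⟨-, rfl⟩ := pair_inj.1 h'
        exact (hmem x hx _).1 hw _ hg
      · intro hg
        obtain ⟨c, hc⟩ := exists_singleton g
        exact ⟨0, c, ⟨g, left_le_pair _ _, c, (right_le_pair _ _).trans (right_le_pair _ _), rfl,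
          (hc g).2 rfl⟩, trivial, (hmem x hx c).2 fun n hn => (hc n).1 hn ▸ hg⟩
    have himage : ∀ x, X.space.IsPoint x → ∀ a, MemImage X.space
        {z | ∃ g, g ≤ z ∧ ∃ w, w ≤ z ∧ z = pair g (pair 0 w) ∧ FinMem g w} x a ↔
          OpenMem (union x) a := fun x hx a => by
      simp only [MemImage, hopen x hx]
      rfl
    refine ⟨_, hU.mem_sets, fun a b _ _ => ?_, fun V hV => ?_⟩
    · constructor
      · intro h x hx
        rw [himage x hx, himage x hx]
        have := h x (hpt x hx)
        rwa [(F.isIncreasing (hpt x hx).1).exists_finLe_iff,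
          (F.isIncreasing (hpt x hx).1).exists_finLe_iff] at this
      · intro h p hp
        obtain ⟨x, hx, hpx⟩ := hpt' p hp
        rw [(F.isIncreasing hp.1).exists_finLe_iff, (F.isIncreasing hp.1).exists_finLe_iff, hpx,
          ← himage x hx, ← himage x hx]
        exact h x hx
    · classical
      have hl := left_df (𝔐 := 𝔐)
      have hr := right_df (𝔐 := 𝔐)
      have hT : D1 (fun z : 𝔐.Num => z ∈ V ∧ z = pair (left z) (right z) ∧
          FinSubset F.G (right z)) := D1.and by_def (D1.and by_def (D1.finSubset F.G_mem by_def))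
      refine ⟨fun z => if z ∈ V ∧ z = pair (left z) (right z) ∧ FinSubset F.G (right z)
        then right z + 1 else 0, ⟨coded_iff.2 (DF.ite hT by_def by_def), fun z => ?_⟩,
        fun x hx => ?_⟩
      · by_cases h : z ∈ V ∧ z = pair (left z) (right z) ∧ FinSubset F.G (right z)
        · exact Or.inr ⟨right z, if_pos h, h.2.2⟩
        · exact Or.inl (if_neg h)
      · rw [himage x hx]
        constructor
        · rintro ⟨n, w, hV, -, hw⟩
          have hw' := (hmem x hx w).1 hw
          refine ⟨pair n w, w, ?_, hw'⟩
          simp only [left_pair, right_pair]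
          exact if_pos ⟨hV, trivial, fun i hi => hG x (hpt x hx) (hw' i hi)⟩
        · rintro ⟨z, q, hz, hq⟩
          beta_reduce at hz
          split_ifs at hz with h
          · obtain rfl := hM.rca.succ_inj _ _ hz
            exact ⟨left z, right z, h.2.1 ▸ h.1, trivial, (hmem x hx _).2 hq⟩
          · exact absurd hz.symm (hM.rca.succ_ne_zero q)
  refine ⟨?_, ?_, hspatial⟩
  · have hΦ : D1 (fun z : 𝔐.Num => ∃ V, V ≤ z ∧ ∃ U, U ≤ z ∧ z = pair 0 (pair V U) ∧ FinSub V U) :=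
      by_def
    have hmemΦ : ∀ n V U : 𝔐.Num, pair n (pair V U) ∈
        {z | ∃ V, V ≤ z ∧ ∃ U, U ≤ z ∧ z = pair 0 (pair V U) ∧ FinSub V U} ↔
        n = 0 ∧ FinSub V U := by
      intro n V U
      constructor
      · rintro ⟨V', -, U', -, h, hVU⟩
        obtain ⟨rfl, h'⟩ := pair_inj.1 h
        obtain ⟨rfl, rfl⟩ := pair_inj.1 h'
        exact ⟨rfl, hVU⟩
      · rintro ⟨rfl, h⟩
        exact ⟨V, (left_le_pair _ _).trans (right_le_pair _ _), U,
          (right_le_pair _ _).trans (right_le_pair _ _), rfl, h⟩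
    refine Homeomorphic.of_rel hΦ.mem_sets hΦ.mem_sets (fun p x => union p = union x)
      (fun p x hp hx => ?_) (fun p x hp hx => ?_) hpt' fun x hx => ⟨x, hpt x hx, rfl⟩
    · simp only [MapsTo, hmemΦ, hmem x hx, hmem' p hp]
      have key : ∀ V, (∃ n U : 𝔐.Num, F.ptSpace.IsBasic U ∧ (n = 0 ∧ FinSub V U) ∧
          FinSubset (union p) U) ↔
          FinSubset (union p) V := fun V =>
        ⟨fun ⟨_, U, _, ⟨_, h⟩, h'⟩ n hn => h' n (h n hn), fun h =>
          ⟨0, V, fun n hn => hG p hp (h n hn), ⟨rfl, FinSub.refl V⟩, h⟩⟩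
      simp only [key]
      refine ⟨fun h => (eq_of_finSubset_iff (H := Set.univ) (Set.subset_univ _) (Set.subset_univ _)
        fun c _ => h c trivial).symm, fun h V _ => by rw [h]⟩
    · simp only [MapsTo, hmemΦ, hmem x hx, hmem' p hp]
      have key : ∀ V, (∃ n U : 𝔐.Num, X.space.IsBasic U ∧ (n = 0 ∧ FinSub V U) ∧
          FinSubset (union x) U) ↔
          FinSubset (union x) V := fun V =>
        ⟨fun ⟨_, U, _, ⟨_, h⟩, h'⟩ n hn => h' n (h n hn), fun h =>
          ⟨0, V, trivial, ⟨rfl, FinSub.refl V⟩, h⟩⟩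
      simp only [key]
      exact ⟨fun h => eq_of_finSubset_iff (hG p hp) (hG x (hpt x hx)) h, fun h V _ => by rw [h]⟩
  · obtain ⟨U, hU, h1, h2⟩ := hspatial
    exact ⟨U, hU, fun a b ha hb => by rw [F.prec_iff_ptLe hb, h1 a b ha hb], h2⟩

/-- The points of `⟨G; R⟩` form a `Π⁰₂`-subspace of `𝒫(ℕ)`: besides the relations, every number
outside of `G` gives the condition that it does not belong to the set. -/
theorem exists_presents : ∃ X : Pi02Code 𝔐, F.Presents X.space := by
  classical
  have hu := coded₂_iff.1 F.u_coded
  have hv := coded₂_iff.1 F.v_coded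
  have hl := left_df (𝔐 := 𝔐)
  have hr := right_df (𝔐 := 𝔐)
  have hG := F.G_mem
  have hne : (1 : 𝔐.Num) ≠ 0 := one_ne_zero
  have hfin := finMem_d1 (𝔐 := 𝔐)
  -- condition `(0, j)` is the `j`-th relation; `(1, j)` forbids the sets that are not in `G`
  let v : 𝔐.Num → 𝔐.Num → 𝔐.Num := fun i m => if left i = 0 then F.v (right i) m else 0
  let w : 𝔐.Num → 𝔐.Num → 𝔐.Num := fun i m => if left i = 0 then F.u (right i) m
    else if FinSubset F.G (right i) then 0 else right i + 1
  have hvc : Coded₂ v := coded₂_iff.2 (DF.ite by_def by_def by_def)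
  have hwc : Coded₂ w := coded₂_iff.2 (DF.ite by_def by_def
    (DF.ite (D1.finSubset F.G_mem by_def) by_def by_def))
  refine ⟨⟨v, w, hvc, hwc⟩, F.presents_of_points fun x hx => ?_⟩
  have key : (Pi02Code.space ⟨v, w, hvc, hwc⟩).IsPoint x ↔
      ∀ i, OpenMem (union x) (v i) ∨ ¬ OpenMem (union x) (w i) := by
    refine (and_iff_right hx).trans (forall_congr' fun i => ?_)
    simp only [OpenMem, powerSpace_mem_iff hx]
  rw [key]
  constructor
  · intro h
    refine ⟨fun n hn => ?_, fun j hj => ?_⟩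
    · by_contra hnG
      obtain ⟨c, hc⟩ := exists_singleton n
      have hcG : ¬ FinSubset F.G c := fun h => hnG (h n ((hc n).2 rfl))
      rcases h (pair 1 c) with ⟨m, q, h, -⟩ | h
      · simp only [v, left_pair, if_neg hne] at h
        exact hM.rca.succ_ne_zero q h.symm
      · refine h ⟨0, c, ?_, fun i hi => (hc i).1 hi ▸ hn⟩
        simp only [w, left_pair, right_pair, if_neg hne, if_neg hcG]
    · have h1 : v (pair 0 j) = F.v j := by
        funext m
        simp only [v, left_pair, right_pair, if_true]
      have h2 : w (pair 0 j) = F.u j := by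
        funext m
        simp only [w, left_pair, right_pair, if_true]
      rcases h (pair 0 j) with h | h
      · rwa [h1] at h
      · rw [h2] at h
        exact absurd hj h
  · rintro ⟨hxG, hR⟩ i
    by_cases hi : left i = 0
    · have h1 : v i = F.v (right i) := by
        funext m
        simp only [v, if_pos hi]
      have h2 : w i = F.u (right i) := by
        funext m
        simp only [w, if_pos hi]
      rw [h1, h2]
      by_cases h : OpenMem (union x) (F.u (right i))
      · exact Or.inl (hR _ h)
      · exact Or.inr h
    · refine Or.inr ?_
      rintro ⟨m, q, h, hq⟩
      simp only [w, if_neg hi] at h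
      split_ifs at h with h'
      · exact hM.rca.succ_ne_zero q h.symm
      · obtain rfl := hM.rca.succ_inj _ _ h
        exact h' fun n hn => hxG (hq n hn)

end FrameCode

/-- The conditions of a `Π⁰₂`-subspace, as relations between expressions over all numbers. -/
theorem Pi02Code.exists_presents (X : Pi02Code 𝔐) : ∃ F : FrameCode 𝔐, F.Presents X.space := by
  have hv := coded₂_iff.1 X.v_coded
  have hw := coded₂_iff.1 X.w_coded
  have hexpr : ∀ a : 𝔐.Num → 𝔐.Num, DF a → IsExpr Set.univ a := fun a ha =>
    ⟨coded_iff.2 ha, fun k => by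
      rcases (zero_le (a := a k)).eq_or_lt with h | h
      · exact Or.inl h.symm
      · obtain ⟨c, hc⟩ := exists_eq_add_one h
        exact Or.inr ⟨c, hc, fun _ _ => trivial⟩⟩
  have huniv : (Set.univ : Set 𝔐.Num) ∈ 𝔐.Sets := (D1.const (α := 𝔐.Num) True).mem_sets
  refine ⟨⟨Set.univ, X.w, X.v, huniv, X.w_coded, X.v_coded, fun j => hexpr _ by_def,
    fun j => hexpr _ by_def⟩, FrameCode.presents_of_points _ fun x hx => ?_⟩
  refine (and_iff_right hx).trans ?_
  rw [and_iff_right (Set.subset_univ _)]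
  refine forall_congr' fun i => ?_
  simp only [OpenMem, powerSpace_mem_iff hx]
  rw [imp_iff_not_or, or_comm]

end

section

variable {𝔐 : L2Structure.{u}} [hM : Model 𝔐]

/-! ### Spaces of unbounded filters as `Π⁰₂`-subspaces -/

/-- The class `K` of sets is defined by conditions "if `S` includes one of the finite sets in
`W i`, then it includes one of the finite sets in `V i`". -/
def IsPi02 (K : Set 𝔐.Num → Prop) : Prop :=
  ∃ V W : 𝔐.Num → 𝔐.Num → Prop, D1 (fun p : 𝔐.Num × 𝔐.Num => V p.1 p.2) ∧
    D1 (fun p : 𝔐.Num × 𝔐.Num => W p.1 p.2) ∧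
    ∀ S, K S ↔ ∀ i, (∃ c, W i c ∧ FinSubset S c) → ∃ c, V i c ∧ FinSubset S c

theorem IsPi02.and {K K' : Set 𝔐.Num → Prop} (hK : IsPi02 K) (hK' : IsPi02 K') :
    IsPi02 fun S => K S ∧ K' S := by
  obtain ⟨V, W, hV, hW, h⟩ := hK
  obtain ⟨V', W', hV', hW', h'⟩ := hK'
  have hl := left_df (𝔐 := 𝔐)
  have hr := right_df (𝔐 := 𝔐)
  refine ⟨fun i c => left i = 0 ∧ V (right i) c ∨ left i = 1 ∧ V' (right i) c,
    fun i c => left i = 0 ∧ W (right i) c ∨ left i = 1 ∧ W' (right i) c, by_def, by_def,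
    fun S => ?_⟩
  have hne : (1 : 𝔐.Num) ≠ 0 := one_ne_zero
  beta_reduce
  rw [h, h']
  constructor
  · rintro ⟨h, h'⟩ i ⟨c, ⟨hi, hW⟩ | ⟨hi, hW⟩, hc⟩
    · obtain ⟨d, hd, hdS⟩ := h (right i) ⟨c, hW, hc⟩
      exact ⟨d, Or.inl ⟨hi, hd⟩, hdS⟩
    · obtain ⟨d, hd, hdS⟩ := h' (right i) ⟨c, hW, hc⟩
      exact ⟨d, Or.inr ⟨hi, hd⟩, hdS⟩
  · intro h
    refine ⟨fun i ⟨c, hW, hc⟩ => ?_, fun i ⟨c, hW, hc⟩ => ?_⟩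
    · have := h (pair 0 i) ⟨c, Or.inl ⟨left_pair _ _, by rwa [right_pair]⟩, hc⟩
      simpa only [left_pair, right_pair, true_and, hne.symm, false_and, or_false] using this
    · have := h (pair 1 i) ⟨c, Or.inr ⟨left_pair _ _, by rwa [right_pair]⟩, hc⟩
      simpa only [left_pair, right_pair, true_and, hne, false_and, false_or] using this

theorem IsPi02.exists_code {K : Set 𝔐.Num → Prop} (hK : IsPi02 K) : ∃ X : Pi02Code 𝔐,
    ∀ x, X.space.IsPoint x ↔ (powerSpace 𝔐).IsPoint x ∧ K (union x) := by
  classical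
  obtain ⟨V, W, hV, hW, h⟩ := hK
  refine ⟨⟨fun i m => if V i m then m + 1 else 0, fun i m => if W i m then m + 1 else 0,
    coded₂_iff.2 (DF.ite hV by_def by_def), coded₂_iff.2 (DF.ite hW by_def by_def)⟩,
    fun x => and_congr_right fun hx => ?_⟩
  rw [h]
  refine forall_congr' fun i => ?_
  have key : ∀ T : 𝔐.Num → Prop, (∃ m c, (if T m then m + 1 else 0) = c + 1 ∧
      (powerSpace 𝔐).Mem x c) ↔ ∃ c, T c ∧ FinSubset (union x) c := by
    intro T
    simp only [powerSpace_mem_iff hx]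
    constructor
    · rintro ⟨m, c, hm, hc⟩
      split_ifs at hm with hT
      · obtain rfl := hM.rca.succ_inj _ _ hm
        exact ⟨m, hT, hc⟩
      · exact absurd hm.symm (hM.rca.succ_ne_zero c)
    · rintro ⟨c, hT, hc⟩
      exact ⟨c, c, if_pos hT, hc⟩
  rw [key, key, imp_iff_not_or, or_comm]

theorem exists_finMem_and_iff {S : Set 𝔐.Num} {n : 𝔐.Num} :
    (∃ c, FinMem n c ∧ FinSubset S c) ↔ n ∈ S := by
  refine ⟨fun ⟨c, hn, hc⟩ => hc n hn, fun hn => ?_⟩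
  obtain ⟨c, hc⟩ := exists_singleton n
  exact ⟨c, (hc n).2 rfl, fun i hi => (hc i).1 hi ▸ hn⟩

namespace PosetCode

variable (P : PosetCode 𝔐)

/-- `S` is an unbounded filter, as a set. The last clause also says that `S` is not empty: an `r`
outside of the poset is not below anything. -/
def IsUnboundedFilter (S : Set 𝔐.Num) : Prop :=
  (∀ p, p ∈ S → p ∈ P.P) ∧ (∀ p q, p ∈ S → q ∈ P.P → P.le p q → q ∈ S) ∧
    (∀ p q, p ∈ S → q ∈ S → ∃ r, r ∈ S ∧ P.le r p ∧ P.le r q) ∧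
    ∀ r, ∃ p, p ∈ S ∧ ¬ (r ∈ P.P ∧ P.lt r p)

theorem le_d1 : D1 (fun p : 𝔐.Num × 𝔐.Num => P.le p.1 p.2) := D1.mem P.rel_mem by_def

theorem isPi02_isUnboundedFilter : IsPi02 P.IsUnboundedFilter := by
  have hl := left_df (𝔐 := 𝔐)
  have hr := right_df (𝔐 := 𝔐)
  have hfin := finMem_d1 (𝔐 := 𝔐)
  have hle := P.le_d1
  have hP := P.P_mem
  have hlt : D1 (fun p : 𝔐.Num × 𝔐.Num => P.lt p.1 p.2) := hle.and (D1.not by_def)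
  refine IsPi02.and ?_ (IsPi02.and ?_ (IsPi02.and ?_ ?_))
  · refine ⟨fun _ _ => False, fun i c => FinMem i c ∧ i ∉ P.P, D1.const False,
      D1.and by_def (D1.not by_def), fun S => forall_congr' fun p => ?_⟩
    simp only [false_and, exists_false, ← exists_finMem_and_iff (S := S)]
    by_cases hp : p ∈ P.P
    · simp [hp]
    · simp [hp]
  · refine ⟨fun i c => FinMem (right i) c,
      fun i c => FinMem (left i) c ∧ right i ∈ P.P ∧ P.le (left i) (right i), by_def, by_def,
      fun S => ⟨fun h i ⟨c, ⟨h1, h2, h3⟩, hc⟩ => ?_, fun h p q hp hq hpq => ?_⟩⟩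
    · exact exists_finMem_and_iff.2 (h _ _ (hc _ h1) h2 h3)
    · obtain ⟨c, hc, hcS⟩ := exists_finMem_and_iff.2 hp
      have := h (pair p q) ⟨c, by
        beta_reduce
        rw [left_pair, right_pair]
        exact ⟨hc, hq, hpq⟩, hcS⟩
      beta_reduce at this
      rw [right_pair] at this
      exact exists_finMem_and_iff.1 this
  · refine ⟨fun i c => ∃ r, r < c ∧ FinMem r c ∧ P.le r (left i) ∧ P.le r (right i),
      fun i c => FinMem (left i) c ∧ FinMem (right i) c, by_def, by_def,
      fun S => ⟨fun h i ⟨c, ⟨h1, h2⟩, hc⟩ => ?_, fun h p q hp hq => ?_⟩⟩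
    · obtain ⟨r, hr, hr'⟩ := h _ _ (hc _ h1) (hc _ h2)
      obtain ⟨d, hd, hdS⟩ := exists_finMem_and_iff.2 hr
      exact ⟨d, ⟨r, hd.lt, hd, hr'⟩, hdS⟩
    · obtain ⟨c, hc⟩ := D1.exists_finCode (P := fun i => i = p ∨ i = q) by_def (p + q + 1)
      obtain ⟨d, ⟨r, -, hr, hr'⟩, hd⟩ := h (pair p q) ⟨c, by
        beta_reduce
        rw [left_pair, right_pair]
        exact ⟨(hc p).2 ⟨lt_add_one_iff.2 le_self_add, Or.inl rfl⟩,
          (hc q).2 ⟨lt_add_one_iff.2 le_add_self, Or.inr rfl⟩⟩, fun i hi => by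
        rcases ((hc i).1 hi).2 with rfl | rfl
        exacts [hp, hq]⟩
      rw [left_pair, right_pair] at hr'
      exact ⟨r, hd r hr, hr'⟩
  · refine ⟨fun i c => ∃ p, p < c ∧ FinMem p c ∧ ¬ (i ∈ P.P ∧ P.lt i p), fun _ _ => True, by_def,
      D1.const True, fun S => forall_congr' fun r => ?_⟩
    constructor
    · rintro ⟨p, hp, hrp⟩ -
      obtain ⟨c, hc, hcS⟩ := exists_finMem_and_iff.2 hp
      exact ⟨c, ⟨p, hc.lt, hc, hrp⟩, hcS⟩
    · intro h
      obtain ⟨c, hc⟩ := D1.exists_finCode (P := fun _ : 𝔐.Num => True) (D1.const True) 0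
      obtain ⟨d, ⟨p, -, hp, hrp⟩, hd⟩ := h ⟨c, trivial, fun i hi =>
        absurd ((hc i).1 hi).1 (not_lt_zero' i)⟩
      exact ⟨p, hd p hp, hrp⟩

variable {P}

/-- A finite subset of a filter has a lower bound in the generating sequence. -/
theorem IsFilter.exists_le {x : 𝔐.Num → 𝔐.Num} (hx : P.IsFilter x) {c : 𝔐.Num}
    (hc : FinSubset {p | P.FilterMem x p} c) : ∃ i, ∀ p, FinMem p c → P.le (x i) p := by
  have hfin := finMem_d1 (𝔐 := 𝔐)
  have hle := P.le_d1
  have hxd := coded_iff.1 hx.1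
  have hmono : ∀ i j p, p ∈ P.P → P.le (x i) p → i ≤ j → P.le (x j) p := by
    intro i j p hp hip hij
    rcases hij.lt_or_eq with h | rfl
    · exact P.trans _ (hx.2.1 j) _ (hx.2.1 i) _ hp (hx.2.2 i j h) hip
    · exact hip
  obtain ⟨i, hi⟩ := S1.induction
    (P := fun k => ∃ i, ∀ p, p < k → FinMem p c → P.le (x i) p) by_def
    ⟨0, fun n hn => absurd hn (not_lt_zero' n)⟩ (fun k ⟨i, hi⟩ => by
      by_cases hk : FinMem k c
      · obtain ⟨hkP, j, hj⟩ := hc k hk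
        refine ⟨max i j, fun p hp hpc => ?_⟩
        rcases (lt_add_one_iff.1 hp).lt_or_eq with hp | rfl
        · exact hmono i _ p (hc p hpc).1 (hi p hp hpc) (le_max_left _ _)
        · exact hmono j _ p hkP hj (le_max_right _ _)
      · refine ⟨i, fun p hp hpc => ?_⟩
        rcases (lt_add_one_iff.1 hp).lt_or_eq with hp | rfl
        · exact hi p hp hpc
        · exact absurd hpc hk) c
  exact ⟨i, fun p hp => hi p hp.lt hp⟩

theorem isUnboundedFilter_of_isPoint {x : 𝔐.Num → 𝔐.Num} (hx : P.UF.IsPoint x) :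
    P.IsUnboundedFilter {p | P.FilterMem x p} := by
  obtain ⟨hf, hunb⟩ := hx
  refine ⟨fun p hp => hp.1, fun p q hp hq hpq => ?_, fun p q hp hq => ?_, fun r => ?_⟩
  · obtain ⟨i, hi⟩ := hp.2
    exact ⟨hq, i, P.trans _ (hf.2.1 i) _ hp.1 _ hq hi hpq⟩
  · obtain ⟨c, hc⟩ := D1.exists_finCode (P := fun i => i = p ∨ i = q) by_def (p + q + 1)
    obtain ⟨i, hi⟩ := hf.exists_le (c := c) fun i hi => by
      rcases ((hc i).1 hi).2 with rfl | rfl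
      exacts [hp, hq]
    exact ⟨x i, ⟨hf.2.1 i, i, P.refl _ (hf.2.1 i)⟩,
      hi p ((hc p).2 ⟨lt_add_one_iff.2 le_self_add, Or.inl rfl⟩),
      hi q ((hc q).2 ⟨lt_add_one_iff.2 le_add_self, Or.inr rfl⟩)⟩
  · by_contra! h
    have h0 := h (x 0) ⟨hf.2.1 0, 0, P.refl _ (hf.2.1 0)⟩
    exact hunb ⟨r, h0.1, fun p hp => (h p hp).2⟩

/-- An enumerated unbounded filter is generated by a decreasing sequence, whose terms are found by
searching for an element below the last term and below the elements enumerated so far. -/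
theorem exists_isPoint {y : 𝔐.Num → 𝔐.Num} (hy : DF y) (hS : P.IsUnboundedFilter (union y)) :
    ∃ x, P.UF.IsPoint x ∧ ∀ p, P.FilterMem x p ↔ p ∈ union y := by
  obtain ⟨hP, hup, hdir, hunb⟩ := hS
  have hfin := finMem_d1 (𝔐 := 𝔐)
  have hle := P.le_d1
  have hun : S1 (fun n => n ∈ union y) := (by_def : S1 fun n => ∃ i, FinMem n (y i))
  have hlow : ∀ n z, z ∈ union y → ∃ r, r ∈ union y ∧ P.le r z ∧
      ∀ q, q < y n → FinMem q (y n) → P.le r q := by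
    intro n z hz
    refine S1.induction (P := fun k => ∃ r, r ∈ union y ∧ P.le r z ∧
      ∀ q, q < k → FinMem q (y n) → P.le r q) ?_ ?_ ?_ (y n)
    · refine S1.ex (S1.and ?_ (D1.s1 by_def))
      exact hun.comp DF.v0
    · exact ⟨z, hz, P.refl _ (hP z hz), fun q hq => absurd hq (not_lt_zero' q)⟩
    · rintro k ⟨r, hr, hrz, hrq⟩
      by_cases hk : FinMem k (y n)
      · obtain ⟨s, hs, hsr, hsk⟩ := hdir r k hr ⟨n, hk⟩
        refine ⟨s, hs, P.trans _ (hP s hs) _ (hP r hr) _ (hP z hz) hsr hrz, fun q hq hqn => ?_⟩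
        rcases (lt_add_one_iff.1 hq).lt_or_eq with hq | rfl
        · exact P.trans _ (hP s hs) _ (hP r hr) _ (hP q ⟨n, hqn⟩) hsr (hrq q hq hqn)
        · exact hsk
      · refine ⟨r, hr, hrz, fun q hq hqn => ?_⟩
        rcases (lt_add_one_iff.1 hq).lt_or_eq with hq | rfl
        · exact hrq q hq hqn
        · exact absurd hqn hk
  obtain ⟨x₀, hx₀, -⟩ := hunb 0
  obtain ⟨x, hx, -, hxs⟩ := S1.exists_seq (A := fun _ z => z ∈ union y)
    (R := fun n z r => P.le r z ∧ ∀ q, q < y n → FinMem q (y n) → P.le r q) (hun.comp DF.v0)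
    by_def hx₀ hlow
  have hdecr : ∀ i k, P.le (x (i + k)) (x i) := by
    intro i k
    refine D1.induction (P := fun k => P.le (x (i + k)) (x i)) by_def ?_ (fun k hk => ?_) k
    · rw [add_zero]
      exact P.refl _ (hP _ (hxs i).1)
    · rw [← add_assoc]
      exact P.trans _ (hP _ (hxs _).1) _ (hP _ (hxs _).1) _ (hP _ (hxs _).1) (hxs (i + k)).2.1 hk
  have hmem : ∀ p, P.FilterMem x p ↔ p ∈ union y := by
    refine fun p => ⟨fun ⟨hp, i, hi⟩ => hup _ _ (hxs i).1 hp hi, fun hp => ⟨hP p hp, ?_⟩⟩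
    obtain ⟨n, hn⟩ := hp
    exact ⟨n + 1, (hxs n).2.2 p hn.lt hn⟩
  refine ⟨x, ⟨⟨coded_iff.2 hx, fun n => hP _ (hxs n).1, fun i j hij => ?_⟩, ?_⟩, hmem⟩
  · obtain ⟨k, rfl⟩ := exists_add_of_le hij.le
    exact hdecr i k
  · rintro ⟨r, hr, h⟩
    obtain ⟨p, hp, hrp⟩ := hunb r
    exact hrp ⟨hr, h p ((hmem p).2 hp)⟩

variable (P) in
theorem exists_homeomorphic : ∃ X : Pi02Code 𝔐, Homeomorphic P.UF X.space := by
  obtain ⟨X, hX⟩ := P.isPi02_isUnboundedFilter.exists_code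
  have hfin := finMem_d1 (𝔐 := 𝔐)
  have hle := P.le_d1
  have hP := P.P_mem
  have hΦ : D1 (fun z : 𝔐.Num => ∃ V, V ≤ z ∧ ∃ U, U ≤ z ∧ z = pair 0 (pair V U) ∧ U ∈ P.P ∧
      ∀ q, q < V → FinMem q V → q ∈ P.P ∧ P.le U q) := by_def
  have hΨ : D1 (fun z : 𝔐.Num => ∃ V, V ≤ z ∧ ∃ U, U ≤ z ∧ z = pair 0 (pair V U) ∧ FinMem V U) :=
    by_def
  have hpair : ∀ (R : 𝔐.Num → 𝔐.Num → Prop) (n V U : 𝔐.Num), pair n (pair V U) ∈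
      {z | ∃ V, V ≤ z ∧ ∃ U, U ≤ z ∧ z = pair 0 (pair V U) ∧ R V U} ↔ n = 0 ∧ R V U := by
    intro R n V U
    constructor
    · rintro ⟨V', -, U', -, h, hVU⟩
      obtain ⟨rfl, h'⟩ := pair_inj.1 h
      obtain ⟨rfl, rfl⟩ := pair_inj.1 h'
      exact ⟨rfl, hVU⟩
    · rintro ⟨rfl, h⟩
      exact ⟨V, (left_le_pair _ _).trans (right_le_pair _ _), U,
        (right_le_pair _ _).trans (right_le_pair _ _), rfl, h⟩
  have hmem : ∀ y, X.space.IsPoint y → ∀ c, X.space.Mem y c ↔ FinSubset (union y) c :=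
    fun y hy c => powerSpace_mem_iff ((hX y).1 hy).1
  refine ⟨X, Homeomorphic.of_rel hΦ.mem_sets hΨ.mem_sets
    (fun x y => {p | P.FilterMem x p} = union y) (fun x y hx hy => ?_) (fun x y hx hy => ?_)
    (fun x hx => ?_) fun y hy => ?_⟩
  · have key : ∀ V, (∃ n U : 𝔐.Num, P.UF.IsBasic U ∧ (n = 0 ∧ U ∈ P.P ∧
        ∀ q, q < V → FinMem q V → q ∈ P.P ∧ P.le U q) ∧ P.UF.Mem x U) ↔
        FinSubset {p | P.FilterMem x p} V := by
      refine fun V => ⟨?_, fun h => ?_⟩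
      · rintro ⟨-, U, -, ⟨-, hU, h⟩, -, i, hi⟩ q hq
        obtain ⟨hqP, hUq⟩ := h q hq.lt hq
        exact ⟨hqP, i, P.trans _ (hx.1.2.1 i) _ hU _ hqP hi hUq⟩
      · obtain ⟨i, hi⟩ := hx.1.exists_le h
        exact ⟨0, x i, hx.1.2.1 i, ⟨rfl, hx.1.2.1 i, fun q _ hq => ⟨(h q hq).1, hi q hq⟩⟩,
          hx.1.2.1 i, i, P.refl _ (hx.1.2.1 i)⟩
    simp only [MapsTo, hpair (fun V U => U ∈ P.P ∧ ∀ q, q < V → FinMem q V → q ∈ P.P ∧ P.le U q),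
      hmem y hy, key]
    exact ⟨fun h => (eq_of_finSubset_iff (H := Set.univ) (Set.subset_univ _) (Set.subset_univ _)
      fun c _ => h c trivial).symm, fun h V _ => by rw [h]⟩
  · have key : ∀ p, (∃ n U : 𝔐.Num, X.space.IsBasic U ∧ (n = 0 ∧ FinMem p U) ∧
        FinSubset (union y) U) ↔ p ∈ union y := by
      intro p
      rw [← exists_finMem_and_iff]
      exact ⟨fun ⟨_, U, _, ⟨_, h⟩, h'⟩ => ⟨U, h, h'⟩,
        fun ⟨U, h, h'⟩ => ⟨0, U, trivial, ⟨rfl, h⟩, h'⟩⟩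
    simp only [MapsTo, hpair (fun V U => FinMem V U), hmem y hy, key]
    refine ⟨fun h => ?_, fun h p _ => by rw [← h]; rfl⟩
    ext p
    exact ⟨fun hp => (h p hp.1).1 hp, fun hp => (h p (((hX y).1 hy).2.1 p hp)).2 hp⟩
  · have hxd := coded_iff.1 hx.1.1
    obtain ⟨y, hy, hmem⟩ := S1.exists_powerSpace_point (W := fun p => P.FilterMem x p)
      (by_def : S1 fun p => p ∈ P.P ∧ ∃ i, P.le (x i) p)
    have hun : {p | P.FilterMem x p} = union y := Set.ext fun p => (hmem p).symm
    exact ⟨y, (hX y).2 ⟨hy, hun ▸ isUnboundedFilter_of_isPoint hx⟩, hun⟩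
  · obtain ⟨hyp, hS⟩ := (hX y).1 hy
    obtain ⟨x, hx, hmem⟩ := exists_isPoint (coded_iff.1 hyp.1) hS
    exact ⟨x, hx, Set.ext hmem⟩

end PosetCode

end

section

/-! ### The ordered field of fractions -/

section OrderedField

open TensorProduct

variable (M : Type u) [CommSemiring M] [LinearOrder M] [IsStrictOrderedRing M]
  [CanonicallyOrderedAdd M]

/-- The ring of differences of an ordered semiring: the tensor product with `ℤ` is the additive
group of differences, with its ring structure. -/
def DiffRing : Type u := ℤ ⊗[ℕ] M

noncomputable instance : CommRing (DiffRing M) := inferInstanceAs (CommRing (ℤ ⊗[ℕ] M))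

variable {M}

/-- The embedding of an ordered semiring into its ring of differences. -/
noncomputable def toDiffRing : M →+* DiffRing M :=
  (Algebra.TensorProduct.includeRight : M →ₐ[ℕ] ℤ ⊗[ℕ] M).toRingHom

theorem toDiffRing_injective : Function.Injective (toDiffRing (M := M)) := by
  let φ : ℤ →ₗ[ℕ] M →ₗ[ℕ] Algebra.GrothendieckAddGroup M :=
    LinearMap.mk₂ ℕ (fun z m => z • Algebra.GrothendieckAddGroup.of m)
      (fun a b m => add_smul _ _ _) (fun n a m => smul_assoc n a _)
      (fun z a b => by rw [map_add, smul_add]) (fun n z a => by rw [map_nsmul, smul_comm])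
  intro a b hab
  have h : TensorProduct.lift φ (1 ⊗ₜ a) = TensorProduct.lift φ (1 ⊗ₜ b) :=
    congrArg (TensorProduct.lift φ) hab
  simp only [TensorProduct.lift.tmul, φ, LinearMap.mk₂_apply, one_smul] at h
  exact Algebra.GrothendieckAddGroup.of_injective h

theorem DiffRing.exists_eq_sub (z : DiffRing M) : ∃ a b, z = toDiffRing a - toDiffRing b := by
  induction z using TensorProduct.induction_on with
  | zero => exact ⟨0, 0, (sub_self _).symm⟩
  | tmul n m =>
    have key : ∀ k : ℕ, (k : ℤ) ⊗ₜ[ℕ] m = toDiffRing (k • m) := fun k => by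
      change (k : ℤ) ⊗ₜ[ℕ] m = (1 : ℤ) ⊗ₜ[ℕ] (k • m)
      rw [← TensorProduct.smul_tmul]
      simp
    obtain ⟨k, rfl | rfl⟩ := n.eq_nat_or_neg
    · exact ⟨k • m, 0, by rw [map_zero, sub_zero, ← key]⟩
    · refine ⟨0, k • m, ?_⟩
      rw [map_zero, zero_sub, ← key]
      exact TensorProduct.neg_tmul _ _
  | add x y hx hy =>
    obtain ⟨a, b, rfl⟩ := hx
    obtain ⟨c, d, rfl⟩ := hy
    refine ⟨a + c, b + d, ?_⟩
    rw [map_add, map_add, add_sub_add_comm]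
    rfl

theorem DiffRing.eq_or_eq_neg (z : DiffRing M) : ∃ a, z = toDiffRing a ∨ z = -toDiffRing a := by
  obtain ⟨a, b, rfl⟩ := z.exists_eq_sub
  rcases le_total a b with h | h
  · obtain ⟨c, rfl⟩ := exists_add_of_le h
    exact ⟨c, Or.inr (by rw [map_add]; ring)⟩
  · obtain ⟨c, rfl⟩ := exists_add_of_le h
    exact ⟨c, Or.inl (by rw [map_add]; ring)⟩

instance : IsDomain (DiffRing M) := by
  have : Nontrivial (DiffRing M) := toDiffRing_injective.nontrivial
  have : NoZeroDivisors (DiffRing M) := by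
    refine ⟨fun {x y} h => ?_⟩
    obtain ⟨a, ha⟩ := x.eq_or_eq_neg
    obtain ⟨b, hb⟩ := y.eq_or_eq_neg
    have hab : toDiffRing (a * b) = toDiffRing 0 := by
      rw [map_mul, map_zero]
      rcases ha with rfl | rfl <;> rcases hb with rfl | rfl <;> simpa using h
    rcases mul_eq_zero.1 (toDiffRing_injective hab) with rfl | rfl
    · exact Or.inl (by rcases ha with rfl | rfl <;> simp)
    · exact Or.inr (by rcases hb with rfl | rfl <;> simp)
  exact NoZeroDivisors.to_isDomain _

variable (M) in
/-- An ordered semiring embeds into an ordered field of fractions, in which every positive element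
is at least the inverse of an element of the semiring. -/
theorem exists_orderedField (h1 : ∀ a : M, a ≠ 0 → 1 ≤ a) :
    ∃ (K : Type u) (_ : Field K) (_ : LinearOrder K) (_ : IsStrictOrderedRing K) (ι : M →+* K),
      StrictMono ι ∧ ∀ ε : K, 0 < ε → ∃ b, 1 ≤ ε * ι b := by
  let K := FractionRing (DiffRing M)
  let ι : M →+* K := (algebraMap (DiffRing M) K).comp toDiffRing
  have hι : Function.Injective ι :=
    (IsFractionRing.injective (DiffRing M) K).comp toDiffRing_injective
  have hne : ∀ {b : M}, b ≠ 0 → ι b ≠ 0 := fun {b} hb h => hb (hι (by rw [h, map_zero]))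
  -- every element of `K` is a fraction of elements of `M`, up to the sign
  have hrep : ∀ x : K, ∃ a b, b ≠ 0 ∧ (x * ι b = ι a ∨ -x * ι b = ι a) := by
    intro x
    obtain ⟨y, z, hz, rfl⟩ := IsFractionRing.div_surjective (A := DiffRing M) x
    have hz0 : z ≠ 0 := nonZeroDivisors.ne_zero hz
    obtain ⟨a, ha⟩ := y.eq_or_eq_neg
    obtain ⟨b, hb⟩ := z.eq_or_eq_neg
    have hb0 : b ≠ 0 := by
      rintro rfl
      rcases hb with rfl | rfl <;> simp at hz0
    have hb' : algebraMap (DiffRing M) K (toDiffRing b) ≠ 0 := hne hb0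
    refine ⟨a, b, hb0, ?_⟩
    simp only [ι, RingHom.comp_apply]
    rcases ha with rfl | rfl <;> rcases hb with rfl | rfl <;>
      simp only [map_neg, neg_div, div_neg, neg_neg, neg_mul, div_mul_cancel₀ _ hb', true_or,
        or_true]
  -- the elements that are fractions of elements of `M` are the nonnegative ones
  let C : RingCone K :=
    { carrier := {x | ∃ a b, b ≠ 0 ∧ x * ι b = ι a}
      mul_mem' := by
        rintro x y ⟨a, b, hb, h⟩ ⟨c, d, hd, h'⟩
        exact ⟨a * c, b * d, mul_ne_zero hb hd, by rw [map_mul, map_mul, ← h, ← h']; ring⟩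
      one_mem' := ⟨1, 1, one_ne_zero, by simp⟩
      add_mem' := by
        rintro x y ⟨a, b, hb, h⟩ ⟨c, d, hd, h'⟩
        exact ⟨a * d + c * b, b * d, mul_ne_zero hb hd, by
          rw [map_mul, map_add, map_mul, map_mul, ← h, ← h']; ring⟩
      zero_mem' := ⟨0, 1, one_ne_zero, by simp⟩
      eq_zero_of_mem_of_neg_mem' := by
        rintro x ⟨a, b, hb, h⟩ ⟨c, d, hd, h'⟩
        have h0 : ι (a * d + c * b) = ι 0 := by
          rw [map_add, map_mul, map_mul, ← h, ← h', map_zero]; ring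
        have h1 := (add_eq_zero.1 (hι h0)).1
        have h2 : a = 0 := (mul_eq_zero.1 h1).resolve_right hd
        rw [h2, map_zero] at h
        exact (mul_eq_zero.1 h).resolve_right (hne hb) }
  have htot : ∀ x : K, x ∈ C ∨ -x ∈ C := fun x => by
    obtain ⟨a, b, hb, h | h⟩ := hrep x
    exacts [Or.inl ⟨a, b, hb, h⟩, Or.inr ⟨a, b, hb, h⟩]
  classical
  let P : PartialOrder K := .mkOfAddGroupCone C
  have hO : IsOrderedRing K := .mkOfCone C
  have hle : ∀ x y : K, x ≤ y ↔ y - x ∈ C := fun x y => Iff.rfl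
  let L : LinearOrder K :=
    { P with
      le_total := fun x y => by
        rw [hle, hle, ← neg_sub y x]
        exact htot _
      toDecidableLE := Classical.decRel _ }
  have hO' : IsOrderedRing K := hO
  have hS : IsStrictOrderedRing K := IsOrderedRing.toIsStrictOrderedRing K
  have hnn : ∀ a, 0 ≤ ι a := fun a => (hle _ _).2 ⟨a, 1, one_ne_zero, by simp⟩
  have hmono : StrictMono ι := by
    refine Monotone.strictMono_of_injective (fun a b hab => ?_) hι
    obtain ⟨c, rfl⟩ := exists_add_of_le hab
    rw [map_add]
    exact le_add_of_nonneg_right (hnn c)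
  refine ⟨K, inferInstance, L, hS, ι, hmono, fun ε hε => ?_⟩
  obtain ⟨a, b, hb, h⟩ := (hle 0 ε).1 hε.le
  rw [sub_zero] at h
  refine ⟨b, ?_⟩
  rw [h, ← map_one ι]
  refine hmono.monotone (h1 a ?_)
  rintro rfl
  rw [map_zero] at h
  exact (mul_ne_zero hε.ne' (hne hb)) h

end OrderedField

end

section

variable {𝔐 : L2Structure.{u}} [hM : Model 𝔐]

/-! ### Rational numbers and powers of two -/

section

variable {α : Type u} [Ctx 𝔐 α]

/-- A definable family of rational numbers. -/
structure RatNum.Definable (q : α → RatNum 𝔐) : Prop where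
  pos : DF fun a => (q a).pos
  neg : DF fun a => (q a).neg
  den : DF fun a => (q a).den

theorem RatNum.Definable.add {q r : α → RatNum 𝔐} (hq : RatNum.Definable q)
    (hr : RatNum.Definable r) : RatNum.Definable fun a => (q a).add (r a) :=
  ⟨.add (.mul hq.pos (.add hr.den (.const 1))) (.mul hr.pos (.add hq.den (.const 1))),
    .add (.mul hq.neg (.add hr.den (.const 1))) (.mul hr.neg (.add hq.den (.const 1))),
    .add (.add (.mul hq.den hr.den) hq.den) hr.den⟩

theorem RatNum.Definable.lt {q r : α → RatNum 𝔐} (hq : RatNum.Definable q)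
    (hr : RatNum.Definable r) : D1 fun a => (q a).lt (r a) :=
  .lt (.add (.mul hq.pos (.add hr.den (.const 1))) (.mul hr.neg (.add hq.den (.const 1))))
    (.add (.mul hr.pos (.add hq.den (.const 1))) (.mul hq.neg (.add hr.den (.const 1))))

theorem RatNum.Definable.code {q : α → RatNum 𝔐} (hq : RatNum.Definable q) :
    DF fun a => (q a).code := .pair (.pair hq.pos hq.neg) hq.den

/-- The rational number with a given code. -/
noncomputable def RatNum.ofCode (z : 𝔐.Num) : RatNum 𝔐 :=
  ⟨left (left z), right (left z), right z⟩

theorem RatNum.ofCode_code (q : RatNum 𝔐) : RatNum.ofCode q.code = q := by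
  simp only [RatNum.ofCode, RatNum.code, left_pair, right_pair]

theorem RatNum.Definable.ofCode {f : α → 𝔐.Num} (hf : DF f) :
    RatNum.Definable fun a => RatNum.ofCode (f a) := ⟨hf.left.left, hf.left.right, hf.right⟩

end

theorem exists_twoPow : ∃ f : 𝔐.Num → 𝔐.Num, DF f ∧ f 0 = 1 ∧ (∀ n, f (n + 1) = f n + f n) ∧
    ∀ k, ∃ c, (twoNeg k : RatNum 𝔐) = ⟨1, 0, c⟩ ∧ f k = c + 1 := by
  obtain ⟨f, hf, h0, hR⟩ := S1.exists_seq (𝔐 := 𝔐) (A := fun n x => n < x)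
    (R := fun _ x y => y = x + x) (x₀ := 1) by_def by_def zero_lt_one
    (fun n x hx => ⟨x + x, by
      refine lt_of_le_of_lt (add_one_le_iff.2 hx) ?_
      exact lt_add_of_pos_right x (pos_of_gt hx), rfl⟩)
  refine ⟨f, hf, h0, fun n => (hR n).2, fun k => ?_⟩
  have hu : ∀ y, IsTwoPow k y ↔ y = f k := by
    refine fun y => ⟨?_, fun h => ⟨f, coded_iff.2 hf, h0, fun n => (hR n).2, h.symm⟩⟩
    rintro ⟨g, hg, hg0, hgs, rfl⟩
    have hg' := coded_iff.1 hg
    refine D1.induction (P := fun k => g k = f k) by_def (by rw [hg0, h0]) (fun n ih => ?_) k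
    rw [hgs, (hR n).2, ih]
  have hex : ∃ c, IsTwoPow k (c + 1) := by
    obtain ⟨c, hc⟩ := exists_eq_add_one (pos_of_gt (hR k).1)
    exact ⟨c, (hu _).2 hc.symm⟩
  refine ⟨hex.choose, ?_, ((hu _).1 hex.choose_spec).symm⟩
  rw [twoNeg, dif_pos hex]

theorem RatNum.Definable.twoNeg {α : Type u} [Ctx 𝔐 α] {f : α → 𝔐.Num} (hf : DF f) :
    RatNum.Definable fun a => twoNeg (f a) := by
  obtain ⟨g, hg, -, -, h⟩ := exists_twoPow (𝔐 := 𝔐)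
  choose c hc hgc using h
  have h1 : D1 (fun p : 𝔐.Num × 𝔐.Num => p.2 + 1 = g p.1) := by_def
  have hcd : DF c := h1.1.congr fun p => by
    rw [hgc]
    exact ⟨fun h => by rw [h], fun h => hM.rca.succ_inj _ _ h⟩
  refine ⟨?_, ?_, ?_⟩ <;> simp only [hc]
  exacts [.const 1, .const 0, hcd.comp hf]

variable (𝔐) in
/-- An ordered field that contains the numbers of a model, and in which each positive element is
at least the inverse of a number. -/
structure RatField (K : Type u) [Field K] [LinearOrder K] [IsStrictOrderedRing K] where
  ι : 𝔐.Num →+* K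
  strictMono : StrictMono ι
  exists_one_le : ∀ ε : K, 0 < ε → ∃ b, 1 ≤ ε * ι b

namespace RatField

variable {K : Type u} [Field K] [LinearOrder K] [IsStrictOrderedRing K] (v : RatField 𝔐 K)

/-- The value of a rational number. -/
def val (q : RatNum 𝔐) : K := (v.ι q.pos - v.ι q.neg) / (v.ι q.den + 1)

/-- The value of `2 ^ (-k)`. -/
noncomputable def e (k : 𝔐.Num) : K := v.val (twoNeg k)

theorem ι_nonneg (a : 𝔐.Num) : 0 ≤ v.ι a := by
  rw [← map_zero v.ι]
  exact v.strictMono.monotone zero_le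

theorem lt_iff {q r : RatNum 𝔐} : q.lt r ↔ v.val q < v.val r := by
  have hq := v.ι_nonneg q.den
  have hr := v.ι_nonneg r.den
  rw [val, val, div_lt_div_iff₀ (by linarith) (by linarith), RatNum.lt, ← v.strictMono.lt_iff_lt]
  simp only [map_add, map_mul, map_one]
  constructor <;> intro h <;> linarith

theorem le_iff {q r : RatNum 𝔐} : q.le r ↔ v.val q ≤ v.val r := by
  have hq := v.ι_nonneg q.den
  have hr := v.ι_nonneg r.den
  have h : ∀ a b : 𝔐.Num, NLe a b ↔ v.ι a ≤ v.ι b := fun a b => v.strictMono.le_iff_le.symm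
  rw [val, val, div_le_div_iff₀ (by linarith) (by linarith), RatNum.le, h]
  simp only [map_add, map_mul, map_one]
  constructor <;> intro h <;> linarith

theorem val_zero : v.val RatNum.zero = 0 := by simp [val, RatNum.zero]

theorem val_add (q r : RatNum 𝔐) : v.val (q.add r) = v.val q + v.val r := by
  have hq := v.ι_nonneg q.den
  have hr := v.ι_nonneg r.den
  have hq' : v.ι q.den + 1 ≠ 0 := by linarith
  have hr' : v.ι r.den + 1 ≠ 0 := by linarith
  have h : v.ι (q.den * r.den + q.den + r.den) + 1 = (v.ι q.den + 1) * (v.ι r.den + 1) := by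
    simp only [map_add, map_mul]
    ring
  rw [val, val, val, div_add_div _ _ hq' hr', RatNum.add, h]
  simp only [map_add, map_mul, map_one]
  congr 1
  ring

theorem e_eq : ∃ f : 𝔐.Num → 𝔐.Num, DF f ∧ (∀ n, f (n + 1) = f n + f n) ∧ (∀ n, n < f n) ∧
    ∀ k, v.e k = 1 / v.ι (f k) := by
  obtain ⟨f, hf, h0, hs, h⟩ := exists_twoPow (𝔐 := 𝔐)
  refine ⟨f, hf, hs, fun n => ?_, fun k => ?_⟩
  · refine D1.induction (P := fun n => n < f n) by_def (h0 ▸ zero_lt_one) (fun n ih => ?_) n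
    rw [hs]
    exact lt_of_le_of_lt (add_one_le_iff.2 ih) (lt_add_of_pos_right _ (pos_of_gt ih))
  · obtain ⟨c, hc, hfc⟩ := h k
    rw [e, hc, hfc, val]
    simp

theorem e_pos (k : 𝔐.Num) : 0 < v.e k := by
  obtain ⟨f, -, -, h, he⟩ := v.e_eq
  rw [he]
  refine one_div_pos.2 ?_
  rw [← map_zero v.ι]
  exact v.strictMono (pos_of_gt (h k))

theorem e_succ (k : 𝔐.Num) : v.e (k + 1) = v.e k / 2 := by
  obtain ⟨f, -, hs, h, he⟩ := v.e_eq
  rw [he, he, hs, map_add, ← two_mul, one_div, one_div, mul_inv]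
  ring

theorem e_le {k l : 𝔐.Num} (h : k ≤ l) : v.e l ≤ v.e k := by
  obtain ⟨f, hf, hs, h0, he⟩ := v.e_eq
  have key : f k ≤ f l := by
    refine D1.induction (P := fun l => k ≤ l → f k ≤ f l) by_def (fun h => ?_)
      (fun n ih h => ?_) l h
    · rw [le_antisymm h zero_le]
    · rcases h.lt_or_eq with h | rfl
      · rw [hs]
        exact (ih (lt_add_one_iff.1 h)).trans le_self_add
      · exact le_rfl
  rw [he, he]
  refine one_div_le_one_div_of_le ?_ (v.strictMono.monotone key)
  rw [← map_zero v.ι]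
  exact v.strictMono (pos_of_gt (h0 k))

theorem two_mul_e_le {k l : 𝔐.Num} (h : k < l) : 2 * v.e l ≤ v.e k := by
  have := v.e_le (add_one_le_iff.2 h)
  rw [e_succ] at this
  linarith

theorem lt_of_e_lt {k l : 𝔐.Num} (h : v.e l < v.e k) : k < l := by
  by_contra! h'
  exact (v.e_le h').not_gt h

theorem exists_e_lt {ε : K} (hε : 0 < ε) : ∃ k, ∀ l, k ≤ l → 8 * v.e l < ε := by
  obtain ⟨f, -, -, h, he⟩ := v.e_eq
  obtain ⟨b, hb⟩ := v.exists_one_le ε hε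
  refine ⟨b + 1 + 1 + 1, fun l hl => ?_⟩
  have h1 := v.e_le hl
  rw [e_succ, e_succ, e_succ] at h1
  have h2 : v.e b < ε := by
    rw [he, div_lt_iff₀]
    · exact hb.trans_lt (mul_lt_mul_of_pos_left (v.strictMono (h b)) hε)
    · rw [← map_zero v.ι]
      exact v.strictMono (pos_of_gt (h b))
  linarith

end RatField

end

section

variable {𝔐 : L2Structure.{u}} [hM : Model 𝔐]

/-! ### Distances in a quasi-metric space -/

namespace QMCode

variable (C : QMCode 𝔐) {K : Type u} [Field K] [LinearOrder K] [IsStrictOrderedRing K]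
  (v : RatField 𝔐 K)

/-- The distance from `a` to `b` is less than `q`. -/
def DistLt (a b : 𝔐.Num) (q : K) : Prop := ∃ k, v.val (C.d a b k) + 2 * v.e k < q

/-- The distance from `a` to the point `x` is less than `q`. -/
def PtDistLt (a : 𝔐.Num) (x : 𝔐.Num → 𝔐.Num) (q : K) : Prop :=
  ∃ k, C.DistLt v a (x k) (q - v.e k)

variable {C v} {a b c : 𝔐.Num} {q r : K} {x : 𝔐.Num → 𝔐.Num}

theorem realLt_iff {s : RatNum 𝔐} : RealLt (C.d a b) (ratReal s) ↔ C.DistLt v a b (v.val s) := by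
  refine exists_congr fun k => ?_
  rw [v.lt_iff, v.val_add, v.val_add, ← two_mul]
  rfl

theorem DistLt.mono (h : C.DistLt v a b q) (hqr : q ≤ r) : C.DistLt v a b r :=
  h.imp fun _ h => h.trans_le hqr

theorem DistLt.exists_lt (h : C.DistLt v a b q) : ∃ r, r < q ∧ C.DistLt v a b r := by
  obtain ⟨k, hk⟩ := h
  exact ⟨(v.val (C.d a b k) + 2 * v.e k + q) / 2, by linarith, k, by linarith⟩

theorem le_add_e (ha : a ∈ C.A) (hb : b ∈ C.A) {k i : 𝔐.Num} (h : k ≤ i) :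
    v.val (C.d a b k) ≤ v.val (C.d a b i) + v.e k ∧
      v.val (C.d a b i) ≤ v.val (C.d a b k) + v.e k := by
  have h' := C.d_real a ha b hb k i h
  rwa [v.le_iff, v.le_iff, v.val_add, v.val_add] at h'

/-- Upper bounds for the distance bound all approximations. -/
theorem DistLt.val_lt (h : C.DistLt v a b q) (ha : a ∈ C.A) (hb : b ∈ C.A) (k : 𝔐.Num) :
    v.val (C.d a b k) < q + v.e k := by
  obtain ⟨i, hi⟩ := h
  rcases le_total k i with hki | hik
  · have := (le_add_e (v := v) ha hb hki).1
    have := v.e_pos i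
    linarith
  · have := (le_add_e (v := v) ha hb hik).2
    have := v.e_pos i
    have := v.e_pos k
    linarith

theorem DistLt.of_val {k : 𝔐.Num} (ha : a ∈ C.A) (hb : b ∈ C.A)
    (h : v.val (C.d a b k) + v.e k < q) : C.DistLt v a b q := by
  obtain ⟨j, hj⟩ := v.exists_e_lt (sub_pos.2 h)
  refine ⟨max j k, ?_⟩
  have h1 := hj (max j k) (le_max_left _ _)
  have h2 := (le_add_e (v := v) ha hb (le_max_right j k)).2
  have := v.e_pos (max j k)
  linarith

theorem DistLt.pos (h : C.DistLt v a b q) (ha : a ∈ C.A) (hb : b ∈ C.A) : 0 < q := by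
  obtain ⟨k, hk⟩ := h
  have h' := C.d_nonneg a ha b hb k
  rw [v.le_iff, v.val_add, v.val_add] at h'
  have h0 : v.val (ratReal RatNum.zero k) = 0 := v.val_zero
  change _ ≤ _ + (v.e k + v.e k) at h'
  linarith

theorem val_self_le (ha : a ∈ C.A) (k : 𝔐.Num) : v.val (C.d a a k) ≤ 2 * v.e k := by
  have h' := C.d_self a ha k
  rw [v.le_iff, v.val_add, v.val_add] at h'
  have h0 : v.val (ratReal RatNum.zero k) = 0 := v.val_zero
  change _ ≤ _ + (v.e k + v.e k) at h'
  linarith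

theorem distLt_self (ha : a ∈ C.A) (hq : 0 < q) : C.DistLt v a a q := by
  obtain ⟨k, hk⟩ := v.exists_e_lt hq
  refine ⟨k, ?_⟩
  have := hk k le_rfl
  have := val_self_le (v := v) ha k
  have := v.e_pos k
  linarith

theorem DistLt.trans (h : C.DistLt v a b q) (h' : C.DistLt v b c r) (ha : a ∈ C.A) (hb : b ∈ C.A)
    (hc : c ∈ C.A) : C.DistLt v a c (q + r) := by
  obtain ⟨q', hq, hab⟩ := h.exists_lt
  obtain ⟨r', hr, hbc⟩ := h'.exists_lt
  obtain ⟨k, hk⟩ := v.exists_e_lt (sub_pos.2 hq)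
  refine ⟨k, ?_⟩
  have h1 := hab.val_lt ha hb (k + 1)
  have h2 := hbc.val_lt hb hc (k + 1)
  have h3 := C.d_triangle a ha b hb c hc k
  rw [v.le_iff, v.val_add, v.val_add, realAdd, v.val_add] at h3
  change _ ≤ _ + (v.e k + v.e k) at h3
  have := hk k le_rfl
  have := v.e_pos k
  rw [v.e_succ] at h1 h2
  linarith

theorem PtDistLt.mono (h : C.PtDistLt v a x q) (hqr : q ≤ r) : C.PtDistLt v a x r :=
  h.imp fun _ h => h.mono (sub_le_sub_right hqr _)

theorem DistLt.trans_pt (h : C.DistLt v a b q) (h' : C.PtDistLt v b x r) (ha : a ∈ C.A)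
    (hb : b ∈ C.A) (hx : ∀ n, x n ∈ C.A) : C.PtDistLt v a x (q + r) := by
  obtain ⟨k, hk⟩ := h'
  exact ⟨k, (h.trans hk ha hb (hx k)).mono (add_sub_assoc q r _).ge⟩

theorem IsPoint.distLt (hx : C.IsPoint x) {n m : 𝔐.Num} (h : n < m) :
    C.DistLt v (x n) (x m) (v.e n) := realLt_iff.1 (hx.2.2 n m h).1

theorem ptDistLt_self (hx : C.IsPoint x) {n : 𝔐.Num} (h : v.e n < q) : C.PtDistLt v (x n) x q :=
  ⟨n, distLt_self (hx.2.1 n) (sub_pos.2 h)⟩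

/-- Almost all terms of a point that lies in a ball belong to a smaller ball. -/
theorem PtDistLt.exists_forall (h : C.PtDistLt v a x q) (ha : a ∈ C.A) (hx : C.IsPoint x) :
    ∃ r, r < q ∧ ∃ k, ∀ m, k < m → C.DistLt v a (x m) r := by
  obtain ⟨k, hk⟩ := h
  obtain ⟨r, hr, hk⟩ := hk.exists_lt
  exact ⟨r + v.e k, by linarith, k, fun m hm =>
    hk.trans (hx.distLt hm) ha (hx.2.1 k) (hx.2.1 m)⟩

theorem realLt_dist_iff (ha : a ∈ C.A) (hx : C.IsPoint x) {s : RatNum 𝔐} :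
    RealLt (C.dist (fun _ => a) x) (ratReal s) ↔ C.PtDistLt v a x (v.val s) := by
  have h0 : RealLt (C.dist (fun _ => a) x) (ratReal s) ↔
      ∃ k, v.val (C.d a (x (k + 1 + 1 + 1)) (k + 1 + 1)) + 2 * v.e k < v.val s := by
    refine exists_congr fun k => ?_
    rw [v.lt_iff, v.val_add, v.val_add, ← two_mul]
    rfl
  rw [h0]
  constructor
  · rintro ⟨k, hk⟩
    refine ⟨k + 1 + 1 + 1, DistLt.of_val ha (hx.2.1 _) (k := k + 1 + 1) ?_⟩
    have := v.e_pos k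
    rw [v.e_succ (k + 1 + 1), v.e_succ (k + 1), v.e_succ k]
    linarith
  · intro h
    obtain ⟨r, hr, k, hk⟩ := h.exists_forall ha hx
    obtain ⟨l, hl⟩ := v.exists_e_lt (sub_pos.2 hr)
    refine ⟨max k l, ?_⟩
    have hlt : k < max k l + 1 + 1 + 1 := by
      rw [lt_add_one_iff, add_assoc]
      exact (le_max_left k l).trans le_self_add
    have h1 := (hk _ hlt).val_lt ha (hx.2.1 _) (max k l + 1 + 1)
    have h2 := hl (max k l) (le_max_right _ _)
    have := v.e_pos (max k l)
    rw [v.e_succ, v.e_succ] at h1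
    linarith

theorem code_inj {s t : RatNum 𝔐} (h : s.code = t.code) : s = t := by
  rw [← RatNum.ofCode_code s, h, RatNum.ofCode_code]

theorem isBasic_iff {s : RatNum 𝔐} :
    C.space.IsBasic (pair a s.code) ↔ a ∈ C.A ∧ 0 < v.val s := by
  rw [← v.val_zero, ← v.lt_iff]
  constructor
  · rintro ⟨b, t, h, hb, ht⟩
    obtain ⟨rfl, hst⟩ := pair_inj.1 h
    obtain rfl := code_inj hst
    exact ⟨hb, ht⟩
  · rintro ⟨ha, hs⟩
    exact ⟨a, s, rfl, ha, hs⟩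

theorem mem_iff (ha : a ∈ C.A) {s : RatNum 𝔐} (hs : 0 < v.val s) (hx : C.IsPoint x) :
    C.space.Mem x (pair a s.code) ↔ C.PtDistLt v a x (v.val s) := by
  rw [← realLt_dist_iff ha hx]
  rw [← v.val_zero, ← v.lt_iff] at hs
  constructor
  · rintro ⟨b, t, h, -, -, hx⟩
    obtain ⟨rfl, hst⟩ := pair_inj.1 h
    obtain rfl := code_inj hst
    exact hx
  · exact fun h => ⟨a, s, rfl, ha, hs, h⟩

/-! ### The poset of formal balls -/

variable (C) in
/-- The formal ball with centre `b` and radius `2 ^ (-m)` lies well inside the ball with centre `a`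
and rational radius `s`. -/
def Inside (b m a : 𝔐.Num) (s : RatNum 𝔐) : Prop :=
  ((C.d a b m).add ((twoNeg m).add ((twoNeg m).add (twoNeg m)))).lt s

variable {m n : 𝔐.Num} {s : RatNum 𝔐}

variable (v) in
theorem inside_iff : C.Inside b m a s ↔ v.val (C.d a b m) + 3 * v.e m < v.val s := by
  rw [Inside, v.lt_iff, v.val_add, v.val_add, v.val_add]
  have : v.val (twoNeg m) = v.e m := rfl
  rw [this, show v.e m + (v.e m + v.e m) = 3 * v.e m by ring]

variable (v) in
theorem Inside.distLt (h : C.Inside b m a s) (ha : a ∈ C.A) (hb : b ∈ C.A) :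
    C.DistLt v a b (v.val s - 2 * v.e m) := by
  rw [inside_iff v] at h
  exact DistLt.of_val (k := m) ha hb (by linarith)

theorem DistLt.inside (h : C.DistLt v a b q) (ha : a ∈ C.A) (hb : b ∈ C.A)
    (hq : q + 4 * v.e m ≤ v.val s) : C.Inside b m a s := by
  rw [inside_iff v]
  have := h.val_lt ha hb m
  linarith

theorem Inside.lt (v : RatField 𝔐 K) (h : C.Inside b m a (twoNeg n)) (ha : a ∈ C.A)
    (hb : b ∈ C.A) : n < m := by
  have h0 := (h.distLt v ha hb).pos ha hb
  change 0 < v.e n - _ at h0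
  have := v.e_pos m
  exact v.lt_of_e_lt (by linarith)

theorem Inside.trans {l : 𝔐.Num} (v : RatField 𝔐 K) (h : C.Inside c l b (twoNeg m))
    (h' : C.Inside b m a (twoNeg n)) (ha : a ∈ C.A) (hb : b ∈ C.A) (hc : c ∈ C.A) :
    C.Inside c l a (twoNeg n) := by
  refine ((h'.distLt v ha hb).trans (h.distLt v hb hc) ha hb hc).inside ha hc ?_
  have := v.two_mul_e_le (Inside.lt v h hb hc)
  change v.e n - _ + (v.e m - _) + _ ≤ v.e n
  linarith

variable (C) in
theorem exists_dist_df : ∃ D : 𝔐.Num → 𝔐.Num, DF D ∧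
    ∀ a b k, D (pair (pair a b) k) = (C.d a b k).code := by
  have hl := left_df (𝔐 := 𝔐)
  have hr := right_df (𝔐 := 𝔐)
  have h1 : D1 (fun p : 𝔐.Num × 𝔐.Num =>
      pair (pair (pair (left (left p.1)) (right (left p.1))) (right p.1)) p.2 ∈
        {z | ∃ a b k, z = pair (pair (pair a b) k) (C.d a b k).code}) := D1.mem C.d_mem by_def
  refine ⟨fun z => (C.d (left (left z)) (right (left z)) (right z)).code, ?_,
    fun a b k => by simp only [left_pair, right_pair]⟩
  refine h1.1.congr fun p => ⟨fun h => ⟨_, _, _, by rw [h]⟩, ?_⟩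
  rintro ⟨a, b, k, h⟩
  obtain ⟨h, h4⟩ := pair_inj.1 h
  obtain ⟨h, h3⟩ := pair_inj.1 h
  obtain ⟨h1, h2⟩ := pair_inj.1 h
  rw [h4, ← h1, ← h2, ← h3]

theorem inside_d1 {α : Type u} [Ctx 𝔐 α] {f g h : α → 𝔐.Num} {s : α → RatNum 𝔐} (hf : DF f)
    (hg : DF g) (hh : DF h) (hs : RatNum.Definable s) :
    D1 (fun x => C.Inside (f x) (g x) (h x) (s x)) := by
  obtain ⟨D, hD, hDC⟩ := C.exists_dist_df
  have h1 : RatNum.Definable fun x => C.d (h x) (f x) (g x) := by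
    have := RatNum.Definable.ofCode (hD.comp (.pair (.pair hh hf) hg))
    simpa only [hDC, RatNum.ofCode_code] using this
  have h2 := RatNum.Definable.twoNeg hg
  exact (h1.add (h2.add (h2.add h2))).lt hs

/-- `P` is the poset of formal balls `(a, n)` with centre `a` and radius `2 ^ (-n)`, ordered by
equality or strong inclusion. -/
def IsBallPoset (C : QMCode 𝔐) (P : PosetCode 𝔐) : Prop :=
  (∀ z, z ∈ P.P ↔ ∃ a ∈ C.A, ∃ n, z = pair a n) ∧ ∀ a n b m, P.le (pair b m) (pair a n) ↔
    b = a ∧ m = n ∨ C.Inside b m a (twoNeg n)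

variable (C) in
theorem exists_isBallPoset (v : RatField 𝔐 K) : ∃ P : PosetCode 𝔐, IsBallPoset C P := by
  have hl := left_df (𝔐 := 𝔐)
  have hr := right_df (𝔐 := 𝔐)
  have hA := C.A_mem
  have hP : D1 (fun z : 𝔐.Num => z = pair (left z) (right z) ∧ left z ∈ C.A) := by_def
  have hI : D1 (fun p : 𝔐.Num × 𝔐.Num =>
      C.Inside (left p.1) (right p.1) (left p.2) (twoNeg (right p.2))) :=
    inside_d1 by_def by_def by_def (.twoNeg by_def)
  have hR : D1 (fun z : 𝔐.Num => left z = right z ∨ C.Inside (left (left z)) (right (left z))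
      (left (right z)) (twoNeg (right (right z)))) :=
    .or by_def (hI.comp₂ (P := fun p q => C.Inside (left p) (right p) (left q) (twoNeg (right q)))
      by_def by_def)
  refine ⟨⟨_, _, hP.mem_sets, hR.mem_sets, ?_, ?_⟩, ?_, ?_⟩
  · intro p _
    exact Or.inl (by rw [left_pair, right_pair])
  · rintro p ⟨-, hp⟩ q ⟨-, hq⟩ r ⟨-, hr⟩ (h | h) (h' | h')
    all_goals
      simp only [left_pair, right_pair] at h h'
      simp only [Set.mem_ofPred_eq, left_pair, right_pair]
    · exact Or.inl (h.trans h')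
    · exact Or.inr (h ▸ h')
    · exact Or.inr (h' ▸ h)
    · exact Or.inr (Inside.trans v h h' hr hq hp)
  · refine fun z => ⟨fun ⟨h, h'⟩ => ⟨_, h', _, h⟩, ?_⟩
    rintro ⟨a, ha, n, rfl⟩
    exact ⟨by rw [left_pair, right_pair], by rwa [left_pair]⟩
  · intro a n b m
    simp only [PosetCode.le, Set.mem_ofPred_eq, left_pair, right_pair, pair_inj]

end QMCode

end

section

variable {𝔐 : L2Structure.{u}} [hM : Model 𝔐]

/-! ### Smyth-complete spaces as spaces of unbounded filters -/

namespace QMCode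

variable {C : QMCode 𝔐} {K : Type u} [Field K] [LinearOrder K] [IsStrictOrderedRing K]
  {v : RatField 𝔐 K} {P : PosetCode 𝔐} {a b c : 𝔐.Num} {q r : K} {x y : 𝔐.Num → 𝔐.Num}
  {m n : 𝔐.Num}

theorem IsBallPoset.pair_mem (hP : IsBallPoset C P) : pair a n ∈ P.P ↔ a ∈ C.A := by
  rw [hP.1]
  constructor
  · rintro ⟨b, hb, m, h⟩
    rwa [(pair_inj.1 h).1]
  · exact fun h => ⟨a, h, n, rfl⟩

theorem IsBallPoset.lt (hP : IsBallPoset C P) (v : RatField 𝔐 K) (ha : a ∈ C.A) (hb : b ∈ C.A)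
    (h : C.Inside b m a (twoNeg n)) : P.lt (pair b m) (pair a n) := by
  have hnm := Inside.lt v h ha hb
  refine ⟨(hP.2 _ _ _ _).2 (Or.inr h), fun h' => ?_⟩
  rcases (hP.2 _ _ _ _).1 h' with ⟨-, h'⟩ | h'
  · exact hnm.ne h'
  · exact hnm.not_gt (Inside.lt v h' hb ha)

/-- Below each formal ball in an unbounded filter there is, in the filter, one that lies strongly
inside it. -/
theorem IsBallPoset.exists_inside (hP : IsBallPoset C P) (v : RatField 𝔐 K)
    (hy : P.UF.IsPoint y) (h : P.FilterMem y (pair a n)) :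
    ∃ c ∈ C.A, ∃ m, P.FilterMem y (pair c m) ∧ C.Inside c m a (twoNeg n) := by
  have ha := hP.pair_mem.1 h.1
  have hlt : P.lt (pair a (n + 1 + 1 + 1)) (pair a n) := by
    refine hP.lt v ha ha ?_
    rw [inside_iff v]
    have h1 := val_self_le (v := v) ha (n + 1 + 1 + 1)
    have h2 := v.e_pos n
    change _ < v.e n
    rw [v.e_succ, v.e_succ, v.e_succ] at *
    linarith
  by_contra! hno
  refine hy.2 ⟨pair a (n + 1 + 1 + 1), hP.pair_mem.2 ha, fun p hp => ?_⟩
  -- a common lower bound of `p` and the given ball, in the filter, is not strictly below the ball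
  obtain ⟨i, hi⟩ := h.2
  obtain ⟨j, hj⟩ := hp.2
  have hle : ∀ k l, k ≤ l → P.le (y l) (y k) := fun k l hkl => by
    rcases hkl.lt_or_eq with hkl | rfl
    · exact hy.1.2.2 k l hkl
    · exact P.refl _ (hy.1.2.1 k)
  have hmem := hy.1.2.1 (max i j)
  have h1 := P.trans _ hmem _ (hy.1.2.1 i) _ h.1 (hle _ _ (le_max_left i j)) hi
  have h2 := P.trans _ hmem _ (hy.1.2.1 j) _ hp.1 (hle _ _ (le_max_right i j)) hj
  obtain ⟨c, hc, m, hcm⟩ := (hP.1 _).1 hmem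
  rw [hcm] at h1 h2 hmem
  have hcF : P.FilterMem y (pair c m) := ⟨hmem, max i j, by rw [hcm]; exact P.refl _ hmem⟩
  rcases (hP.2 _ _ _ _).1 h1 with ⟨rfl, rfl⟩ | h1
  · refine ⟨P.trans _ (hP.pair_mem.2 ha) _ hmem _ hp.1 hlt.1 h2, fun h' => hlt.2 ?_⟩
    exact P.trans _ hmem _ hp.1 _ (hP.pair_mem.2 ha) h2 h'
  · exact absurd h1 (hno c hc m hcF)

variable (C v P) in
/-- The filter generated by `y` consists of the formal balls to which the point `x` belongs. -/
def Corresponds (x y : 𝔐.Num → 𝔐.Num) : Prop :=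
  ∀ a ∈ C.A, ∀ n, P.FilterMem y (pair a n) ↔ C.PtDistLt v a x (v.e n)

/-- The formal inverse image of `N_(a, n)` is the ball with centre `a` and radius `2 ^ (-n)`. -/
theorem IsBallPoset.exists_code (hP : IsBallPoset C P) (v : RatField 𝔐 K) : ∃ Φ ∈ 𝔐.Sets, ∀ x y,
    C.IsPoint x → (MapsTo C.space P.UF Φ x y ↔ Corresponds C v P x y) := by
  have hl := left_df (𝔐 := 𝔐)
  have hr := right_df (𝔐 := 𝔐)
  have hpow : DF fun V : 𝔐.Num => (twoNeg (right V)).code :=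
    RatNum.Definable.code (.twoNeg by_def)
  have h1 : D1 (fun z : 𝔐.Num => right (right z) =
      pair (left (left (right z))) (twoNeg (right (left (right z)))).code) :=
    .eq by_def (.pair by_def (hpow.comp (g := fun z => left (right z)) by_def))
  refine ⟨_, h1.mem_sets, fun x y hx => ⟨fun h a ha n => ?_, fun h V hV => ?_⟩⟩
  · rw [show v.e n = v.val (twoNeg n) from rfl, ← mem_iff ha (v.e_pos n) hx,
      show P.FilterMem y (pair a n) ↔ _ from h _ (hP.pair_mem.2 ha)]
    constructor
    · rintro ⟨k, U, -, h, hxU⟩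
      simp only [Set.mem_ofPred_eq, left_pair, right_pair] at h
      rwa [← h]
    · refine fun h => ⟨0, _, isBasic_iff.2 ⟨ha, v.e_pos n⟩, ?_, h⟩
      simp only [Set.mem_ofPred_eq, left_pair, right_pair]
  · obtain ⟨a, ha, n, rfl⟩ := (hP.1 V).1 hV
    refine (h a ha n).trans ?_
    rw [show v.e n = v.val (twoNeg n) from rfl, ← mem_iff ha (v.e_pos n) hx]
    constructor
    · refine fun h => ⟨0, _, isBasic_iff.2 ⟨ha, v.e_pos n⟩, ?_, h⟩
      simp only [Set.mem_ofPred_eq, left_pair, right_pair]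
    · rintro ⟨k, U, -, h, hxU⟩
      simp only [Set.mem_ofPred_eq, left_pair, right_pair] at h
      rwa [← h]

theorem Corresponds.ptDistLt_iff (h : Corresponds C v P x y)
    (hx : C.IsPoint x) (ha : a ∈ C.A) {s : RatNum 𝔐} : C.PtDistLt v a x (v.val s) ↔
      ∃ c ∈ C.A, ∃ m, P.FilterMem y (pair c m) ∧ C.Inside c m a s := by
  constructor
  · intro hs
    obtain ⟨q, hq, k, hk⟩ := hs.exists_forall ha hx
    obtain ⟨l, hl⟩ := v.exists_e_lt (sub_pos.2 hq)
    have hm := hl (max k l) (le_max_right _ _)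
    have h0 := v.e_pos (max k l)
    refine ⟨x (max k l + 1), hx.2.1 _, max k l, (h _ (hx.2.1 _) _).2 (ptDistLt_self hx ?_),
      (hk _ (lt_add_one_iff.2 (le_max_left _ _))).inside ha (hx.2.1 _) (by linarith)⟩
    rw [v.e_succ]
    linarith
  · rintro ⟨c, hc, m, hF, hI⟩
    have := v.e_pos m
    exact ((hI.distLt v ha hc).trans_pt ((h c hc m).1 hF) ha hc hx.2.1).mono (by linarith)

/-- The formal inverse image of a ball with rational radius consists of the `N_(c, m)` for the formal
balls `(c, m)` that lie well inside it. -/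
theorem IsBallPoset.exists_code_symm (hP : IsBallPoset C P) (v : RatField 𝔐 K) : ∃ Ψ ∈ 𝔐.Sets,
    ∀ x y, C.IsPoint x → P.UF.IsPoint y →
      (MapsTo P.UF C.space Ψ y x ↔ Corresponds C v P x y) := by
  have hl := left_df (𝔐 := 𝔐)
  have hr := right_df (𝔐 := 𝔐)
  have h1 : D1 (fun z : 𝔐.Num => C.Inside (left (right (right z))) (right (right (right z)))
      (left (left (right z))) (RatNum.ofCode (right (left (right z))))) :=
    inside_d1 by_def by_def by_def (.ofCode by_def)
  have key : ∀ (a : 𝔐.Num) (s : RatNum 𝔐) (y : 𝔐.Num → 𝔐.Num), (∃ k U, P.UF.IsBasic U ∧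
      pair k (pair (pair a s.code) U) ∈ {z | C.Inside (left (right (right z)))
        (right (right (right z))) (left (left (right z)))
        (RatNum.ofCode (right (left (right z))))} ∧ P.UF.Mem y U) ↔
      ∃ c ∈ C.A, ∃ m, P.FilterMem y (pair c m) ∧ C.Inside c m a s := by
    intro a s y
    constructor
    · rintro ⟨k, U, hU, h, hy⟩
      obtain ⟨c, hc, m, rfl⟩ := (hP.1 U).1 hU
      simp only [Set.mem_ofPred_eq, left_pair, right_pair, RatNum.ofCode_code] at h
      exact ⟨c, hc, m, hy, h⟩
    · rintro ⟨c, hc, m, hy, h⟩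
      refine ⟨0, pair c m, hy.1, ?_, hy⟩
      simpa only [Set.mem_ofPred_eq, left_pair, right_pair, RatNum.ofCode_code] using h
  refine ⟨_, h1.mem_sets, fun x y hx hy => ⟨fun h a ha n => ?_, fun h V hV => ?_⟩⟩
  · have h' := h _ (isBasic_iff.2 ⟨ha, v.e_pos n⟩)
    rw [key, mem_iff ha (v.e_pos n) hx] at h'
    refine ⟨fun hF => h'.2 (hP.exists_inside v hy hF), fun hx => ?_⟩
    obtain ⟨c, hc, m, hF, hI⟩ := h'.1 hx
    have ha' := hP.pair_mem (n := n).2 ha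
    obtain ⟨i, hi⟩ := hF.2
    exact ⟨ha', i, P.trans _ (hy.1.2.1 i) _ hF.1 _ ha' hi (hP.lt v ha hc hI).1⟩
  · obtain ⟨a, s, rfl, ha, hs⟩ := hV
    rw [v.lt_iff, v.val_zero] at hs
    rw [key, mem_iff ha hs hx, h.ptDistLt_iff hx ha]

/-- The formal balls to which a point belongs form an unbounded filter. -/
theorem IsBallPoset.exists_filter (hP : IsBallPoset C P) (v : RatField 𝔐 K) (hx : C.IsPoint x) :
    ∃ y, P.UF.IsPoint y ∧ Corresponds C v P x y := by
  -- the `i`-th ball has centre `x (3 i + 1)` and radius `2 ^ (-3 i)`; the radii shrink by factors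
  -- of `1 / 8`, which makes each ball lie strongly inside the preceding one
  have hthree : ∀ i : 𝔐.Num, i ≤ 3 * i := fun i => by
    rw [show (3 : 𝔐.Num) * i = i + (i + i) by ring]
    exact le_self_add
  have he : ∀ i, v.e (3 * i + 1) = v.e (3 * i) / 2 := fun i => v.e_succ _
  have hmem : ∀ i, pair (x (3 * i + 1)) (3 * i) ∈ P.P := fun i => hP.pair_mem.2 (hx.2.1 _)
  have hc : Coded fun i : 𝔐.Num => pair (x (3 * i + 1)) (3 * i) := by
    have hx' := coded_iff.1 hx.1
    exact coded_iff.2 by_def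
  have hdec : ∀ i j, i < j →
      P.le (pair (x (3 * j + 1)) (3 * j)) (pair (x (3 * i + 1)) (3 * i)) := fun i j hij => by
    refine (hP.2 _ _ _ _).2 (Or.inr ?_)
    have h3 : 3 * i + 1 + 1 + 1 ≤ 3 * j := by
      rw [show 3 * i + 1 + 1 + 1 = 3 * (i + 1) by ring]
      exact mul_le_mul_right (add_one_le_iff.2 hij) 3
    have h4 := v.e_le h3
    rw [v.e_succ, v.e_succ, v.e_succ] at h4
    refine (hx.distLt (v := v) (n := 3 * i + 1) (m := 3 * j + 1) ?_).inside (hx.2.1 _) (hx.2.1 _) ?_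
    · refine add_lt_add_left ?_ 1
      refine lt_of_lt_of_le ?_ h3
      rw [lt_add_one_iff, add_assoc]
      exact le_self_add
    · rw [he]
      change _ ≤ v.e (3 * i)
      linarith
  have hcor : Corresponds C v P x fun i => pair (x (3 * i + 1)) (3 * i) := by
    intro a ha n
    constructor
    · rintro ⟨-, i, hi⟩
      have h0 := v.e_pos (3 * i)
      rcases (hP.2 _ _ _ _).1 hi with ⟨rfl, rfl⟩ | hi
      · refine ptDistLt_self hx ?_
        rw [he]
        linarith
      · refine ⟨3 * i + 1, (hi.distLt v ha (hx.2.1 _)).mono ?_⟩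
        change v.e n - _ ≤ _
        rw [he]
        linarith
    · intro h
      obtain ⟨q, hq, k, hk⟩ := h.exists_forall ha hx
      obtain ⟨l, hl⟩ := v.exists_e_lt (sub_pos.2 hq)
      have h1 := hl (3 * max k l) ((le_max_right k l).trans (hthree _))
      have h0 := v.e_pos (3 * max k l)
      refine ⟨hP.pair_mem.2 ha, max k l, (hP.2 _ _ _ _).2 (Or.inr ?_)⟩
      refine (hk (3 * max k l + 1) ?_).inside ha (hx.2.1 _) ?_
      · exact lt_add_one_iff.2 ((le_max_left k l).trans (hthree _))
      · change _ ≤ v.e n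
        linarith
  refine ⟨_, ⟨⟨hc, hmem, hdec⟩, ?_⟩, hcor⟩
  rintro ⟨r, hr, h⟩
  obtain ⟨c, hc, m, rfl⟩ := (hP.1 r).1 hr
  obtain ⟨h1, h2⟩ := h _ ⟨hmem m, m, P.refl _ (hmem m)⟩
  rcases (hP.2 _ _ _ _).1 h1 with ⟨h3, h4⟩ | h1
  · rw [h3, ← h4] at h2
    exact h2 (P.refl _ (hP.pair_mem.2 (hx.2.1 _)))
  · exact (Inside.lt v h1 (hx.2.1 _) hc).not_ge (hthree m)

/-- The centres of balls in an unbounded filter whose radii tend to `0` form a left-Cauchy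
sequence; the point that Smyth-completeness provides belongs to exactly the balls in the filter. -/
theorem IsBallPoset.exists_point (hP : IsBallPoset C P) (v : RatField 𝔐 K) (hC : C.SmythComplete)
    (hy : P.UF.IsPoint y) : ∃ x, C.IsPoint x ∧ Corresponds C v P x y := by
  have hl := left_df (𝔐 := 𝔐)
  have hr := right_df (𝔐 := 𝔐)
  have hy' := coded_iff.1 hy.1.1
  have hpair : ∀ i, y i = pair (left (y i)) (right (y i)) ∧ left (y i) ∈ C.A := fun i => by
    obtain ⟨a, ha, n, h⟩ := (hP.1 _).1 (hy.1.2.1 i)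
    rw [h, left_pair, right_pair]
    exact ⟨rfl, ha⟩
  have hF : ∀ i, P.FilterMem y (pair (left (y i)) (right (y i))) := fun i => by
    rw [← (hpair i).1]
    exact ⟨hy.1.2.1 i, i, P.refl _ (hy.1.2.1 i)⟩
  -- every ball in the filter has a term of the sequence inside it
  have hin : ∀ a n, P.FilterMem y (pair a n) →
      ∃ j, C.Inside (left (y j)) (right (y j)) a (twoNeg n) := by
    intro a n h
    obtain ⟨c, hc, m, hcF, hI⟩ := hP.exists_inside v hy h
    obtain ⟨j, hj⟩ := hcF.2
    rw [(hpair j).1] at hj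
    refine ⟨j, ?_⟩
    rcases (hP.2 _ _ _ _).1 hj with ⟨h1, h2⟩ | hj
    · rwa [h1, h2]
    · exact Inside.trans v hj hI (hP.pair_mem.1 h.1) hc (hpair j).2
  have hrad : ∀ k, ∃ i, k ≤ right (y i) := by
    refine fun k => S1.induction (P := fun k => ∃ i, k ≤ right (y i)) by_def ⟨0, zero_le⟩ ?_ k
    rintro k ⟨i, hi⟩
    obtain ⟨j, hj⟩ := hin _ _ (hF i)
    exact ⟨j, add_one_le_iff.2 (hi.trans_lt (Inside.lt v hj (hpair i).2 (hpair j).2))⟩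
  -- the `i k`-th ball in the sequence `y` is the first one with radius at most `2 ^ (-k)`
  obtain ⟨i, hi, hmin⟩ := D1.exists_min (P := fun k i => k ≤ right (y i)) by_def hrad
  have himono : ∀ k l, k ≤ l → i k ≤ i l := fun k l hkl => by
    by_contra! h
    exact (hmin k).2 _ h (hkl.trans (hmin l).1)
  have hmono : ∀ j l q, j ≤ l → v.e (right (y j)) ≤ q → C.DistLt v (left (y j)) (left (y l)) q := by
    intro j l q hjl hq
    have h0 := v.e_pos (right (y l))
    have h1 := v.e_pos (right (y j))
    have hle : P.le (y l) (y j) := by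
      rcases hjl.lt_or_eq with h | rfl
      · exact hy.1.2.2 _ _ h
      · exact P.refl _ (hy.1.2.1 j)
    rw [(hpair j).1, (hpair l).1] at hle
    rcases (hP.2 _ _ _ _).1 hle with ⟨h, -⟩ | h
    · rw [h]
      exact distLt_self (hpair j).2 (h1.trans_le hq)
    · refine (h.distLt v (hpair j).2 (hpair l).2).mono ?_
      change v.e (right (y j)) - _ ≤ _
      linarith
  have hcA : ∀ k, left (y (i k)) ∈ C.A := fun k => (hpair _).2
  obtain ⟨x, hx, hcx, hlim⟩ := hC (fun k => left (y (i k)))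
    ⟨coded_iff.2 by_def, hcA, fun n m _ hnm => (realLt_iff (v := v)).2
      (hmono _ _ _ (himono n m hnm.le) (v.e_le (hmin n).1))⟩
  simp only [realLt_iff (v := v)] at hcx hlim
  refine ⟨x, hx, fun a ha n => ⟨fun h => ?_, fun h => ?_⟩⟩
  · obtain ⟨j, hj⟩ := hin _ _ h
    let k := right (y j) + 1
    have hjk : j ≤ i (k + 1) := by
      by_contra! hlt
      have hle := hy.1.2.2 _ _ hlt
      rw [(hpair j).1, (hpair (i (k + 1))).1] at hle
      have h1 : right (y j) < right (y (i (k + 1))) := by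
        refine lt_of_lt_of_le ?_ (hmin (k + 1)).1
        exact lt_add_one_iff.2 (lt_add_one_iff.2 le_rfl).le
      rcases (hP.2 _ _ _ _).1 hle with ⟨-, h⟩ | h
      · exact h1.ne h
      · exact h1.not_gt (Inside.lt v h (hpair _).2 (hpair j).2)
    have h1 := ((hj.distLt v ha (hpair j).2).trans (hmono _ _ _ hjk le_rfl) ha (hpair j).2
      (hcA _)).trans (hcx k) ha (hcA _) (hx.2.1 _)
    have h0 := v.e_pos k
    refine ⟨k + 1, h1.mono ?_⟩
    change v.e n - _ + _ + v.e k ≤ _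
    have h2 : v.e k = _ := v.e_succ _
    have h3 : v.e (k + 1) = _ := v.e_succ _
    linarith
  · obtain ⟨q, hq, k, hk⟩ := h.exists_forall ha hx
    obtain ⟨l, hl⟩ := v.exists_e_lt (sub_pos.2 hq)
    obtain ⟨N, hN⟩ := hlim l
    let m := max (max k N) l + 1
    have hkm : k < m := lt_add_one_iff.2 ((le_max_left k N).trans (le_max_left _ _))
    have hNm : N < m := lt_add_one_iff.2 ((le_max_right k N).trans (le_max_left _ _))
    have hlm : l < m := lt_add_one_iff.2 (le_max_right _ _)
    refine ⟨hP.pair_mem.2 ha, i m, ?_⟩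
    rw [(hpair (i m)).1]
    refine (hP.2 _ _ _ _).2 (Or.inr ?_)
    refine ((hk m hkm).trans (hN m hNm) ha (hx.2.1 _) (hcA m)).inside ha (hcA m) ?_
    have h1 := hl l le_rfl
    have h2 := v.e_le (hlm.le.trans (hmin m).1)
    have h3 := v.e_pos l
    change q + v.e l + _ ≤ v.e n
    linarith

variable (C) in
/-- A Smyth-complete space is homeomorphic to the space of unbounded filters of the poset of its
formal balls. -/
theorem exists_homeomorphic (hC : C.SmythComplete) :
    ∃ P : PosetCode 𝔐, Homeomorphic C.space P.UF := by
  obtain ⟨K, _, _, _, ι, h1, h2⟩ := exists_orderedField 𝔐.Num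
    fun a ha => (zero_add (1 : 𝔐.Num)) ▸ add_one_le_iff.2 (pos_of_ne_zero ha)
  let v : RatField 𝔐 K := ⟨ι, h1, h2⟩
  obtain ⟨P, hP⟩ := C.exists_isBallPoset v
  obtain ⟨Φ, hΦ, hΦ'⟩ := hP.exists_code v
  obtain ⟨Ψ, hΨ, hΨ'⟩ := hP.exists_code_symm v
  exact ⟨P, .of_rel hΦ hΨ (Corresponds C v P) (fun x y hx _ => hΦ' x y hx) hΨ'
    (fun x hx => hP.exists_filter v hx) (fun y hy => hP.exists_point v hC hy)⟩

end QMCode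

end

end SOA

theorem mainTheorem1 (𝔐 : SOA.L2Structure.{u}) (h𝔐 : SOA.ModelsRCA0 𝔐) :
    (∀ C : SOA.QMCode 𝔐, C.SmythComplete →
      ∃ P : SOA.PosetCode 𝔐, SOA.Homeomorphic C.space P.UF) ∧
    (∀ P : SOA.PosetCode 𝔐, ∃ X : SOA.Pi02Code 𝔐, SOA.Homeomorphic P.UF X.space) ∧
    (∀ X : SOA.Pi02Code 𝔐, ∃ F : SOA.FrameCode 𝔐, F.Presents X.space) ∧
    (∀ F : SOA.FrameCode 𝔐, ∃ X : SOA.Pi02Code 𝔐, F.Presents X.space) := by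
  -- each kind of code contains a set of the model, so that there is one
  refine ⟨fun C hC => ?_, fun P => ?_, fun X => ?_, fun F => ?_⟩
  · have : SOA.Model 𝔐 := ⟨h𝔐, ⟨⟨_, C.A_mem⟩⟩⟩
    exact C.exists_homeomorphic hC
  · have : SOA.Model 𝔐 := ⟨h𝔐, ⟨⟨_, P.P_mem⟩⟩⟩
    exact P.exists_homeomorphic
  · have : SOA.Model 𝔐 := ⟨h𝔐, ⟨⟨_, X.v_coded⟩⟩⟩
    exact X.exists_presents
  · have : SOA.Model 𝔐 := ⟨h𝔐, ⟨⟨_, F.G_mem⟩⟩⟩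
    exact F.exists_presents
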